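/- **The chain.** Let $N\ge 0$, $\eta,\zeta_\pm\in\mathbb C\setminus\{0\}$, $\kappa_\pm,\tau_\pm\in\mathbb C$ with $1+4\kappa_\pm^2\neq0$, and $\epsilon_\pm\in\{1,-1\}$, where $\epsilon_\pm=1$ if $\kappa_\pm=0$. On $\mathbb C^2\otimes\mathbb C^2$ let $R(\lambda)=\lambda\,\mathrm{Id}+\eta P$ ($P$ the flip), and let $$K(\lambda;\zeta,\kappa,\tau)=\frac1\zeta\begin{pmatrix}\zeta+\lambda&2\kappa e^{\tau}\lambda\\2\kappa e^{-\tau}\lambda&\zeta-\lambda\end{pmatrix},\qquad K_-(\lambda)=K(\lambda-\tfrac\eta2;\zeta_-,\kappa_-,\tau_-).$$ For $\xi_1,\dots,\xi_N\in\mathbb C$, on $\mathbb C^2_0\otimes(\mathbb C^2)^{\otimes N}$ put $$M(\lambda)=R_{0N}(\lambda-\xi_N-\tfrac\eta2)\cdots R_{01}(\lambda-\xi_1-\tfrac\eta2),\qquad \hat M(\lambda)=(-1)^N\sigma^y_0M^{t_0}(-\lambda)\sigma_0^y,$$ where $t_0$ is transposition in the space $0$. Put $s_\pm=\epsilon_\pm\sqrt{1+4\kappa_\pm^2}$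 and $$W=\begin{pmatrix}1&-\frac{1-s_+}{2\kappa_+e^{-\tau_+}}\\ \frac{1-s_-}{2\kappa_-e^{\tau_-}}&1\end{pmatrix},\quad \Gamma_W=W^{\otimes N},\quad \bar\zeta_\pm=\frac{\zeta_\pm}{s_\pm},\quad \bar{\mathsf b}_-=\frac{1}{s_-}\Big[2\kappa_-e^{\tau_-}+\frac{(1-s_+)(1+s_-)e^{\tau_+}}{2\kappa_+}\Big],$$ where for $\kappa_\pm=0$ the quotient $(1-s_\pm)/\kappa_\pm$ stands for its limit $0$. Suppose that $\det W\ne0$ and $\bar{\mathsf b}_-\neq0$. Let $\bar K_-=WK_-W^{-1}$, with entries $\bar a_-(\lambda)$ in position $(1,1)$ and $\bar b_-(\lambda)=(\lambda-\frac\eta2)\,\bar{\mathsf b}_- /\bar\zeta_-$ in position $(1,2)$, and $$W_0\Gamma_W\,M(\lambda)K_-(\lambda)\hat M(\lambda)\,\Gamma_W^{-1}W_0^{-1}=\begin{pmatrix}\bar{\mathcal A}_-(\lambda)&\bar{\mathcal B}_-(\lambda)\\ \bar{\mathcal C}_-(\lambda)&\bar{\mathcal D}_-(\lambda)\end{pmatrix}$$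 as a $2\times2$ matrix in the space $0$. Let $\mathcal B(\lambda)=(-1)^N\bar{\mathcal B}_-(\lambda)/\bar b_-(\lambda)$, extended by continuity to $\lambda=\eta/2$. **Genericity.** Suppose that $\xi_j\notin\{0,\eta,-\eta\}$ and $2\xi_j\notin\{\eta,-\eta\}$ for all $j$, that $\xi_j+\xi_k,\ \xi_j-\xi_k\notin\{0,\eta,-\eta\}$ for all $j\neq k$, and that $\xi_j\notin\{\pm\bar\zeta_+,\pm\bar\zeta_-\}$ for all $j$. **The SoV states.** Let $\xi_n^{(h)}=\xi_n+\frac\eta2-h\eta$ for $h\in\{0,1\}$, $\widehat V(x_1,\dots,x_N)=\det_{1\le i,j\le N}[x_i^{2(j-1)}]$, $a(\lambda)=\prod_n(\lambda-\xi_n+\frac\eta2)$, $d(\lambda)=\prod_n(\lambda-\xi_n-\frac\eta2)$, $\mathsf A_-(\lambda)=(-1)^N\bar a_-(\lambda)a(\lambda)d(-\lambda)$, $k_n=\frac{2\xi_n+\eta}{2\xi_n-\eta}$, and $$f_n=-\prod_{m\ne n}\frac{(\xi_n-\xi_m+\eta)(\xi_n+\xi_m+\eta)}{(\xi_n-\xi_m-\eta)(\xi_n+\xi_m-\eta)},\qquad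 g_n=\frac{(\xi_n+\bar\zeta_+)(\xi_n+\bar\zeta_-)}{(\xi_n-\bar\zeta_+)(\xi_n-\bar\zeta_-)},$$ $$N_{\boldsymbol\xi}=\widehat V(\xi_1,\dots,\xi_N)\,\frac{\widehat V(\xi_1^{(0)},\dots,\xi_N^{(0)})}{\widehat V(\xi_1^{(1)},\dots,\xi_N^{(1)})}\prod_{n=1}^N\frac{\xi_n\bar{\mathsf b}_-}{\xi_n-\bar\zeta_-}.$$ Let $\langle 0|$ be the covector with all spins up and $|\underline0\rangle$ the vector with all spins down. For $\mathbf h\in\{0,1\}^N$ put (ordered products, $n=1,\dots,N$ from left to right) $$\langle\mathbf h_-|=\langle0|\prod_{n=1}^N\Big(\frac{\bar{\mathcal A}_-(\frac\eta2-\xi_n)}{\mathsf A_-(\frac\eta2-\xi_n)}\Big)^{1-h_n},\qquad |\mathbf h_-\rangle=\prod_{n=1}^N\Big(\frac{\bar{\mathcal D}_-(\xi_n+\frac\eta2)}{k_n\mathsf A_-(\frac\eta2-\xi_n)}\Big)^{h_n}|\underline0\rangle,$$ and, with $\widehat V_{\mathbf h}=\widehat V(\xi_1^{(h_1)},\dots,\xi_N^{(h_N)})$,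 $$|\Omega\rangle=\tfrac1{N_{\boldsymbol\xi}}\sum_{\mathbf h}\widehat V_{\mathbf h}|\mathbf h_-\rangle,\qquad \langle\Omega_L|=\tfrac1{N_{\boldsymbol\xi}}\sum_{\mathbf h}\prod_n(f_ng_n)^{h_n}\,\widehat V_{\mathbf h}\langle\mathbf h_-|,$$ $$\langle\underline\Omega|=\tfrac1{N_{\boldsymbol\xi}}\sum_{\mathbf h}\prod_nf_n^{h_n}\,\widehat V_{\mathbf h}\langle\mathbf h_-|,\qquad |\underline\Omega_R\rangle=\tfrac1{N_{\boldsymbol\xi}}\sum_{\mathbf h}\prod_ng_n^{-h_n}\,\widehat V_{\mathbf h}|\mathbf h_-\rangle .$$ For $\beta(\lambda)=\prod_{k=1}^{n_\beta}(\lambda^2-\beta_k^2)$, with arbitrary $n_\beta\ge0$ and $\beta_k\in\mathbb C$, the separate states are $$|\beta\rangle=\Gamma_W^{-1}\prod_k\mathcal B(\beta_k)|\Omega\rangle,\quad |\underline\beta\rangle=\Gamma_W^{-1}\prod_k\mathcal B(\beta_k)|\underline\Omega_R\rangle,\quad \langle\beta|=\langle\Omega_L|\prod_k\mathcal B(\beta_k)\,\Gamma_W,\quad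 \langle\underline\beta|=\langle\underline\Omega|\prod_k\mathcal B(\beta_k)\,\Gamma_W .$$ **Proposition.** Let $\alpha(\lambda)=\prod_{k=1}^{n_\alpha}(\lambda^2-\alpha_k^2)$ and $\beta(\lambda)=\prod_{k=1}^{n_\beta}(\lambda^2-\beta_k^2)$. For $w,v\in\mathbb C^N$ write $$\mathcal D[w]=\frac1{N_{\boldsymbol\xi}}\det_{1\le i,j\le N}\Big[\sum_{h=0}^1w_i^h\,\alpha(\xi_i^{(h)})\,\beta(\xi_i^{(h)})\,(\xi_i^{(h)})^{2(j-1)}\Big],$$ $$\mathcal D'[v]=\prod_{n=1}^N\frac{\xi_n-\bar\zeta_-}{\xi_n\bar{\mathsf b}_-}\;\frac{\det_{1\le i,j\le N}\big[\sum_{h=0}^1v_i^h\,\alpha(\xi_i^{(h)})\,\beta(\xi_i^{(h)})\,(\xi_i^{(1-h)})^{2(j-1)}\big]}{\widehat V(\xi_1,\dots,\xi_N)} .$$ Then $$\langle\alpha|\beta\rangle=\langle\beta|\alpha\rangle=\langle\Omega_L|\prod_k\mathcal B(\alpha_k)\prod_k\mathcal B(\beta_k)|\Omega\rangle=\mathcal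 D[(f_ig_i)_i]=\mathcal D'[(-g_i)_i],$$ $$\langle\underline\alpha|\beta\rangle=\langle\beta|\underline\alpha\rangle=\langle\alpha|\underline\beta\rangle=\langle\underline\beta|\alpha\rangle=\langle\underline\Omega|\prod_k\mathcal B(\alpha_k)\prod_k\mathcal B(\beta_k)|\Omega\rangle=\mathcal D[(f_i)_i]=\mathcal D'[(-1)_i],$$ $$\langle\underline\alpha|\underline\beta\rangle=\langle\underline\beta|\underline\alpha\rangle=\langle\underline\Omega|\prod_k\mathcal B(\alpha_k)\prod_k\mathcal B(\beta_k)|\underline\Omega_R\rangle=\mathcal D[(f_ig_i^{-1})_i]=\mathcal D'[(-g_i^{-1})_i].$$ -/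

import Mathlib

open Matrix Filter Topology

/-- Parameters of the inhomogeneous open XXX spin-1/2 chain of length `N`: the parameter `η` of the
R-matrix, the inhomogeneities `ξ`, the boundary parameters `ζ±`, `κ±`, `τ±` (suffix `p` for `+`,
suffix `m` for `-`), and the two signs `ε±` which select the gauge matrix `W`. -/
structure OpenXXX (N : ℕ) where
  η : ℂ
  ξ : Fin N → ℂ
  ζp : ℂ
  ζm : ℂ
  κp : ℂ
  κm : ℂ
  τp : ℂ
  τm : ℂ
  εp : ℤˣ
  εm : ℤˣ

namespace OpenXXX

/-- A spin configuration; at each site `0` is spin up and `1` is spin down. -/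
abbrev Conf (N : ℕ) := Fin N → Fin 2

/-- Operators on the quantum space `(ℂ²)^{⊗N}`, in the canonical spin basis. -/
abbrev Op (N : ℕ) := Matrix (Conf N) (Conf N) ℂ

/-- Vectors (or covectors, as rows) of the quantum space in the canonical spin basis. -/
abbrev Vec (N : ℕ) := Conf N → ℂ

/-- Operators on `ℂ² ⊗ (ℂ²)^{⊗N}` (auxiliary space first), as `2 × 2` matrices of operators. The
transpose of such a matrix is the partial transpose in the auxiliary space. -/
abbrev AuxOp (N : ℕ) := Matrix (Fin 2) (Fin 2) (Op N)

/-- The operator acting as the `2 × 2` matrix `X` at site `n` and trivially at the other sites. -/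
def siteOp {N : ℕ} (n : Fin N) (X : Matrix (Fin 2) (Fin 2) ℂ) : Op N :=
  Matrix.of fun s t => if ∀ m, m ≠ n → s m = t m then X (s n) (t n) else 0

/-- A scalar `2 × 2` matrix acting on the auxiliary space. -/
def auxOp (N : ℕ) (X : Matrix (Fin 2) (Fin 2) ℂ) : AuxOp N :=
  X.map fun x => x • (1 : Op N)

/-- The rational R-matrix on `ℂ² ⊗ ℂ²`. -/
def rMatrix (η lam : ℂ) : Matrix (Fin 2 × Fin 2) (Fin 2 × Fin 2) ℂ :=
  (!![lam + η, 0, 0, 0;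
      0, lam, η, 0;
      0, η, lam, 0;
      0, 0, 0, lam + η] : Matrix (Fin 4) (Fin 4) ℂ).submatrix finProdFinEquiv finProdFinEquiv

/-- The R-matrix acting on the auxiliary space and on site `n`. -/
def rAux {N : ℕ} (η : ℂ) (n : Fin N) (lam : ℂ) : AuxOp N :=
  Matrix.of fun i j => siteOp n (Matrix.of fun s t => rMatrix η lam (i, s) (j, t))

/-- The scalar boundary matrix `K(λ; ζ, κ, τ)`. -/
noncomputable def kMatrix (lam ζ κ τ : ℂ) : Matrix (Fin 2) (Fin 2) ℂ :=
  (1 / ζ) • !![ζ + lam, 2 * κ * Complex.exp τ * lam;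
               2 * κ * Complex.exp (-τ) * lam, ζ - lam]

/-- The Pauli matrix `σ^y`. -/
def sigmaY : Matrix (Fin 2) (Fin 2) ℂ := !![0, -Complex.I; Complex.I, 0]

/-- `V̂(x₁, …, x_N) = det [x_i^{2(j-1)}]`. -/
def vdm {N : ℕ} (x : Fin N → ℂ) : ℂ :=
  (Matrix.of fun i j : Fin N => x i ^ (2 * (j : ℕ))).det

/-- `⟨0|`, all spins up. -/
def bra0 (N : ℕ) : Vec N := Pi.single (fun _ => 0) 1

/-- `|0̲⟩`, all spins down. -/
def ketDown (N : ℕ) : Vec N := Pi.single (fun _ => 1) 1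

/-- The even polynomial `∏_k (λ² - b_k²)`. -/
def evenPoly {n : ℕ} (b : Fin n → ℂ) (lam : ℂ) : ℂ := ∏ k, (lam ^ 2 - b k ^ 2)

variable {N : ℕ} (c : OpenXXX N)

/-- `a(λ) = ∏ (λ - ξ_n + η/2)`. -/
noncomputable def a (lam : ℂ) : ℂ := ∏ n, (lam - c.ξ n + c.η / 2)

/-- `d(λ) = ∏ (λ - ξ_n - η/2)`. -/
noncomputable def d (lam : ℂ) : ℂ := ∏ n, (lam - c.ξ n - c.η / 2)

/-- Bulk monodromy matrix `R_{0N}(λ - ξ_N - η/2) ⋯ R_{01}(λ - ξ_1 - η/2)`. -/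
noncomputable def monodromy (lam : ℂ) : AuxOp N :=
  (List.ofFn fun n : Fin N => rAux c.η n (lam - c.ξ n - c.η / 2)).reverse.prod

/-- `M̂(λ) = (-1)^N σ^y M^{t₀}(-λ) σ^y`. -/
noncomputable def monodromyHat (lam : ℂ) : AuxOp N :=
  (-1 : ℂ) ^ N • (auxOp N sigmaY * (c.monodromy (-lam))ᵀ * auxOp N sigmaY)

/-- `K₋(λ) = K(λ - η/2; ζ₋, κ₋, τ₋)`. -/
noncomputable def kMinus (lam : ℂ) : Matrix (Fin 2) (Fin 2) ℂ :=
  kMatrix (lam - c.η / 2) c.ζm c.κm c.τm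

/-- Boundary monodromy matrix `U₋(λ) = M(λ) K₋(λ) M̂(λ)`. -/
noncomputable def uMinus (lam : ℂ) : AuxOp N :=
  c.monodromy lam * auxOp N (c.kMinus lam) * c.monodromyHat lam

/-- `ε₊ √(1 + 4 κ₊²)`. -/
noncomputable def sp : ℂ := ((c.εp : ℤ) : ℂ) * Complex.sqrt (1 + 4 * c.κp ^ 2)

/-- `ε₋ √(1 + 4 κ₋²)`. -/
noncomputable def sm : ℂ := ((c.εm : ℤ) : ℂ) * Complex.sqrt (1 + 4 * c.κm ^ 2)

/-- The gauge matrix `W = W_{ε₊,ε₋}`. If `κ± = 0` and `ε± = 1`, the corresponding off-diagonal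
entry is `0 / 0 = 0`, which is its limit as `κ± → 0`. -/
noncomputable def W : Matrix (Fin 2) (Fin 2) ℂ :=
  !![1, -((1 - c.sp) / (2 * c.κp * Complex.exp (-c.τp)));
     (1 - c.sm) / (2 * c.κm * Complex.exp c.τm), 1]

/-- `Γ_W = W ⊗ ⋯ ⊗ W`. -/
noncomputable def gammaW : Op N := Matrix.of fun s t => ∏ n, c.W (s n) (t n)

/-- The gauge-transformed boundary monodromy matrix `Ū₋ = W₀ Γ_W U₋ Γ_W⁻¹ W₀⁻¹`. -/
noncomputable def uBar (lam : ℂ) : AuxOp N :=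
  auxOp N c.W * (c.uMinus lam).map (fun X => c.gammaW * X * c.gammaW⁻¹) * auxOp N c.W⁻¹

noncomputable def opA (lam : ℂ) : Op N := c.uBar lam 0 0

noncomputable def opB (lam : ℂ) : Op N := c.uBar lam 0 1

noncomputable def opD (lam : ℂ) : Op N := c.uBar lam 1 1

/-- The gauge-transformed boundary matrix `K̄₋ = W K₋ W⁻¹`; its entries `0 0` and `0 1` are the
functions `ā₋(λ)` and `b̄₋(λ)`. -/
noncomputable def kBar (lam : ℂ) : Matrix (Fin 2) (Fin 2) ℂ := c.W * c.kMinus lam * c.W⁻¹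

/-- `ζ̄₊`. -/
noncomputable def zetaBarP : ℂ := c.ζp / c.sp

/-- `ζ̄₋`. -/
noncomputable def zetaBarM : ℂ := c.ζm / c.sm

/-- The constant `b̄₋`, for which `b̄₋(λ) = (λ - η/2) b̄₋ / ζ̄₋`. For `κ± ≠ 0` it equals
`ε₋ (2κ₋ e^{τ₋} / √(1+4κ₋²)) [1 + (1 - ε₊√(1+4κ₊²)) (1 + ε₋√(1+4κ₋²)) / (4κ₊κ₋ e^{τ₋-τ₊})]`;
the expanded form below is also correct if some `κ± = 0` with `ε± = 1`. -/
noncomputable def bConst : ℂ :=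
  (2 * c.κm * Complex.exp c.τm
    + (1 - c.sp) * (1 + c.sm) * Complex.exp c.τp / (2 * c.κp)) / c.sm

/-- `ξ_n^{(h)} = ξ_n + η/2 - h η`. -/
noncomputable def xiH (n : Fin N) (h : Fin 2) : ℂ := c.ξ n + c.η / 2 - ((h : ℕ) : ℂ) * c.η

/-- `V̂(ξ_1^{(h_1)}, …, ξ_N^{(h_N)})`. -/
noncomputable def vdmH (h : Conf N) : ℂ := vdm fun n => c.xiH n (h n)

/-- The normalization factor `N_{ξ,-}`. -/
noncomputable def normFactor : ℂ :=
  vdm c.ξ * (c.vdmH (fun _ => 0) / c.vdmH (fun _ => 1)) *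
    ∏ n, (c.ξ n * c.bConst / (c.ξ n - c.zetaBarM))

/-- `A₋(λ) = (-1)^N ā₋(λ) a(λ) d(-λ)`. -/
noncomputable def aMinus (lam : ℂ) : ℂ := (-1) ^ N * c.kBar lam 0 0 * c.a lam * c.d (-lam)

/-- `k_n = (2ξ_n + η) / (2ξ_n - η)`. -/
noncomputable def kCoef (n : Fin N) : ℂ := (2 * c.ξ n + c.η) / (2 * c.ξ n - c.η)

/-- The left SoV state `⟨h₋| = ⟨0| ∏ (Ā₋(η/2 - ξ_n) / A₋(η/2 - ξ_n))^{1 - h_n}`. -/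
noncomputable def braSoV (h : Conf N) : Vec N :=
  bra0 N ᵥ* (List.ofFn fun n : Fin N =>
    ((c.aMinus (c.η / 2 - c.ξ n))⁻¹ • c.opA (c.η / 2 - c.ξ n)) ^ (1 - (h n : ℕ))).prod

/-- The right SoV state `|h₋⟩ = ∏ (D̄₋(ξ_n + η/2) / (k_n A₋(η/2 - ξ_n)))^{h_n} |0̲⟩`. -/
noncomputable def ketSoV (h : Conf N) : Vec N :=
  (List.ofFn fun n : Fin N =>
    ((c.kCoef n * c.aMinus (c.η / 2 - c.ξ n))⁻¹ • c.opD (c.ξ n + c.η / 2)) ^ (h n : ℕ)).prod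
    *ᵥ ketDown N

noncomputable def f (n : Fin N) : ℂ :=
  -∏ m ∈ Finset.univ.erase n,
    ((c.ξ n - c.ξ m + c.η) * (c.ξ n + c.ξ m + c.η)) /
      ((c.ξ n - c.ξ m - c.η) * (c.ξ n + c.ξ m - c.η))

noncomputable def g (n : Fin N) : ℂ :=
  ((c.ξ n + c.zetaBarP) * (c.ξ n + c.zetaBarM)) / ((c.ξ n - c.zetaBarP) * (c.ξ n - c.zetaBarM))

/-- `|Ω⟩`. -/
noncomputable def ketOmega : Vec N :=
  c.normFactor⁻¹ • ∑ h : Conf N, c.vdmH h • c.ketSoV h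

/-- `⟨Ω_L|`. -/
noncomputable def braOmegaL : Vec N :=
  c.normFactor⁻¹ • ∑ h : Conf N, ((∏ n, (c.f n * c.g n) ^ (h n : ℕ)) * c.vdmH h) • c.braSoV h

/-- `⟨Ω̲|`. -/
noncomputable def braOmegaU : Vec N :=
  c.normFactor⁻¹ • ∑ h : Conf N, ((∏ n, c.f n ^ (h n : ℕ)) * c.vdmH h) • c.braSoV h

/-- `|Ω̲_R⟩`. -/
noncomputable def ketOmegaUR : Vec N :=
  c.normFactor⁻¹ • ∑ h : Conf N, ((∏ n, (c.g n)⁻¹ ^ (h n : ℕ)) * c.vdmH h) • c.ketSoV h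

/-- The renormalized operator `(-1)^N B̄₋(λ) / b̄₋(λ)`, a polynomial in `λ`; at the zero `λ = η/2`
of `b̄₋(λ)` it is defined by continuity. -/
noncomputable def renB (lam : ℂ) : Op N :=
  open Classical in
  if c.kBar lam 0 1 = 0 then
    limUnder (𝓝[≠] lam) (fun μ => ((-1) ^ N / c.kBar μ 0 1) • c.opB μ)
  else ((-1) ^ N / c.kBar lam 0 1) • c.opB lam

/-- The ordered product of the renormalized operators at `b_1, …, b_n`. -/
noncomputable def prodB {n : ℕ} (b : Fin n → ℂ) : Op N := (List.ofFn fun k => c.renB (b k)).prod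

/-- `|β⟩ = Γ_W⁻¹ ∏ 𝓑(b_k) |Ω⟩`. -/
noncomputable def ket {n : ℕ} (b : Fin n → ℂ) : Vec N := c.gammaW⁻¹ *ᵥ (c.prodB b *ᵥ c.ketOmega)

/-- `⟨β̲| = ⟨Ω̲| ∏ 𝓑(b_k) Γ_W`. -/
noncomputable def braU {n : ℕ} (b : Fin n → ℂ) : Vec N := (c.braOmegaU ᵥ* c.prodB b) ᵥ* c.gammaW

/-- `⟨β| = ⟨Ω_L| ∏ 𝓑(b_k) Γ_W`. -/
noncomputable def bra {n : ℕ} (b : Fin n → ℂ) : Vec N := (c.braOmegaL ᵥ* c.prodB b) ᵥ* c.gammaW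

/-- `|β̲⟩ = Γ_W⁻¹ ∏ 𝓑(b_k) |Ω̲_R⟩`. -/
noncomputable def ketU {n : ℕ} (b : Fin n → ℂ) : Vec N :=
  c.gammaW⁻¹ *ᵥ (c.prodB b *ᵥ c.ketOmegaUR)

/-- `N_{ξ,-}⁻¹ det [∑_h w_i^h α(ξ_i^{(h)}) β(ξ_i^{(h)}) (ξ_i^{(h)})^{2(j-1)}]`. -/
noncomputable def detForm (w : Fin N → ℂ) (α β : ℂ → ℂ) : ℂ :=
  1 / c.normFactor * (Matrix.of fun i j : Fin N =>
    ∑ h : Fin 2, w i ^ (h : ℕ) * α (c.xiH i h) * β (c.xiH i h) * c.xiH i h ^ (2 * (j : ℕ))).det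

/-- `∏ (ξ_n - ζ̄₋)/(ξ_n b̄₋) · det [∑_h v_i^h α(ξ_i^{(h)}) β(ξ_i^{(h)}) (ξ_i^{(1-h)})^{2(j-1)}]
/ V̂(ξ_1, …, ξ_N)`. -/
noncomputable def detFormAlt (v : Fin N → ℂ) (α β : ℂ → ℂ) : ℂ :=
  (∏ n, (c.ξ n - c.zetaBarM) / (c.ξ n * c.bConst)) *
    ((Matrix.of fun i j : Fin N =>
      ∑ h : Fin 2, v i ^ (h : ℕ) * α (c.xiH i h) * β (c.xiH i h) *
        c.xiH i (1 - h) ^ (2 * (j : ℕ))).det / vdm c.ξ)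

end OpenXXX

/-!
Scalar products of separate states of the open XXX chain.

The proof is the quantum separation of variables: the covectors `⟨h₋|` and the vectors `|h₋⟩` are
simultaneous eigenvectors of the commuting family `B̄₋(λ)`, and the two families are dual bases up
to the norms `normFactor / vdmH h`. In these bases a product of renormalized operators acts by the
values of an even polynomial at the nodes `ξ_n^{(h_n)}`, so every scalar product is a sum over
configurations of a product over the sites times a Vandermonde determinant, and expanding a
determinant in its rows shows that such a sum is a determinant.

*Eigenvectors.* The gauge transformation by `W` commutes with the R-matrix, so it only changes the
boundary matrix, which becomes upper triangular (`uBar_eq_dressed`, `kBar_eq`). Dressing with a site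
preserves both the reflection equation and a crossing symmetry relating `U(λ)` and `U(-λ)`
(`Reflection.lax_mul_lax`, `Crossing.lax_mul_lax`). The extreme covector and vector are eigenvectors
of `B̄₋(λ)`, and by the reflection equation `Ā₋(η/2 - ξ_n)` and `D̄₋(ξ_n + η/2)` flip the label of
site `n` (`EigL.vecMul_opA`, `EigR.opD_mulVec`); hence `Generic.braSoV_labels` and
`Generic.ketSoV_labels`.

*Duality.* Different labels are orthogonal because they have different eigenvalues
(`EigL.dotProduct_eq_zero`). For equal labels, the exchange relation of `Ā₋` with `B̄₋` evaluated at
special points, with the crossing symmetry, expresses the matrix element of `D̄₋` between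
neighbouring labels through that of `Ā₋` (`EigL.opD_ratio`). This ratio is that of two Vandermonde
determinants, so the pairing times `vdmH h` does not depend on `h` (`Generic.overlap`). Its value is
found at `h = 0` (`Generic.overlap_zero`): since `⟨0| Ā₋ ⋯ Ā₋ |0̲⟩` has to flip all `N` spins, only
the part proportional to `b̄₋(λ) A(λ) C(-λ)` of each `Ā₋(λ)` contributes, and the bulk exchange
relations bring the product to a product of operators `C`, each of which flips one site.

*Determinants.* The operators `B̄₋(λ)` are diagonalized by `sovMatrix`, which also gives the value
of the renormalized operator at the zero of `b̄₋` (`Generic.renB_eq`). The sums over configurations are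
computed in `Generic.pairing`, compared with the determinants in `detForm_eq` and `detFormAlt_eq`,
and the two kinds of determinants are related by `Generic.prod_f_mul_vdmH`: up to signs and a
constant, the coefficients `f_n` turn the Vandermonde determinant of a configuration into that of
its complement.
-/

namespace OpenXXX

/-! ### Exchange relations over a noncommutative ring -/

section Algebra

variable {R : Type*} [Ring R]

variable (R) in
/-- The flip of the two auxiliary spaces. -/
def flip : Matrix (Fin 2 × Fin 2) (Fin 2 × Fin 2) R :=
  Matrix.of fun p q => if p = q.swap then 1 else 0

theorem flip_mul_apply (X : Matrix (Fin 2 × Fin 2) (Fin 2 × Fin 2) R) (p q : Fin 2 × Fin 2) :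
    (flip R * X) p q = X p.swap q := by
  obtain ⟨i, k⟩ := p
  rw [Matrix.mul_apply, Finset.sum_eq_single (k, i)]
  · simp [flip]
  · rintro ⟨a, b⟩ - h
    have : ¬ (i = b ∧ k = a) := by rintro ⟨rfl, rfl⟩; exact h rfl
    simp [flip, this]
  · simp

theorem mul_flip_apply (X : Matrix (Fin 2 × Fin 2) (Fin 2 × Fin 2) R) (p q : Fin 2 × Fin 2) :
    (X * flip R) p q = X p q.swap := by
  obtain ⟨j, l⟩ := q
  rw [Matrix.mul_apply, Finset.sum_eq_single (l, j)]
  · simp [flip]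
  · rintro ⟨a, b⟩ - h
    have : ¬ (a = l ∧ b = j) := by rintro ⟨rfl, rfl⟩; exact h rfl
    simp [flip, this]
  · simp

theorem flip_mul_flip : flip R * flip R = 1 := by
  ext ⟨i, k⟩ ⟨j, l⟩
  rw [flip_mul_apply]
  simp [flip, Matrix.one_apply, and_comm]

variable [Algebra ℂ R]

/-- The embedding of operators on the first of two auxiliary spaces. -/
def aux1 : Matrix (Fin 2) (Fin 2) R →ₐ[ℂ] Matrix (Fin 2 × Fin 2) (Fin 2 × Fin 2) R :=
  AlgHom.ofLinearMap
    { toFun := fun X => Matrix.of fun p q => if p.2 = q.2 then X p.1 q.1 else 0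
      map_add' := fun X Y => by ext p q; by_cases h : p.2 = q.2 <;> simp [h]
      map_smul' := fun r X => by ext p q; by_cases h : p.2 = q.2 <;> simp [h] }
    (by ext ⟨i, k⟩ ⟨j, l⟩; by_cases h : k = l <;> simp [h, Matrix.one_apply])
    (fun X Y => by
      ext ⟨i, k⟩ ⟨j, l⟩
      by_cases h : k = l <;> simp [h, Matrix.mul_apply, Fintype.sum_prod_type])

/-- The embedding of operators on the second of two auxiliary spaces. -/
def aux2 : Matrix (Fin 2) (Fin 2) R →ₐ[ℂ] Matrix (Fin 2 × Fin 2) (Fin 2 × Fin 2) R :=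
  AlgHom.ofLinearMap
    { toFun := fun X => Matrix.of fun p q => if p.1 = q.1 then X p.2 q.2 else 0
      map_add' := fun X Y => by ext p q; by_cases h : p.1 = q.1 <;> simp [h]
      map_smul' := fun r X => by ext p q; by_cases h : p.1 = q.1 <;> simp [h] }
    (by ext ⟨i, k⟩ ⟨j, l⟩; by_cases h : i = j <;> simp [h, Matrix.one_apply])
    (fun X Y => by
      ext ⟨i, k⟩ ⟨j, l⟩
      by_cases h : i = j <;> simp [h, Matrix.mul_apply, Fintype.sum_prod_type])

theorem aux1_apply (X : Matrix (Fin 2) (Fin 2) R) (p q : Fin 2 × Fin 2) :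
    aux1 X p q = if p.2 = q.2 then X p.1 q.1 else 0 := rfl

theorem aux2_apply (X : Matrix (Fin 2) (Fin 2) R) (p q : Fin 2 × Fin 2) :
    aux2 X p q = if p.1 = q.1 then X p.2 q.2 else 0 := rfl

theorem flip_mul_aux1 (X : Matrix (Fin 2) (Fin 2) R) : flip R * aux1 X = aux2 X * flip R := by
  ext ⟨i, k⟩ ⟨j, l⟩
  rw [flip_mul_apply, mul_flip_apply]; rfl

theorem flip_mul_aux2 (X : Matrix (Fin 2) (Fin 2) R) : flip R * aux2 X = aux1 X * flip R := by
  ext ⟨i, k⟩ ⟨j, l⟩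
  rw [flip_mul_apply, mul_flip_apply]; rfl

theorem aux1_mul_aux2_apply (X Y : Matrix (Fin 2) (Fin 2) R) (i k j l : Fin 2) :
    (aux1 X * aux2 Y) (i, k) (j, l) = X i j * Y k l := by
  simp [Matrix.mul_apply, Fintype.sum_prod_type, aux1_apply, aux2_apply]

theorem aux2_mul_aux1_apply (X Y : Matrix (Fin 2) (Fin 2) R) (i k j l : Fin 2) :
    (aux2 Y * aux1 X) (i, k) (j, l) = Y k l * X i j := by
  simp [Matrix.mul_apply, Fintype.sum_prod_type, aux1_apply, aux2_apply]

theorem aux1_commute_aux2 {X Y : Matrix (Fin 2) (Fin 2) R}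
    (h : ∀ i j k l, Commute (X i j) (Y k l)) : Commute (aux1 X) (aux2 Y) := by
  ext ⟨i, k⟩ ⟨j, l⟩
  rw [aux1_mul_aux2_apply, aux2_mul_aux1_apply]
  exact h i j k l

/-- `p` has the entries of the flip of the auxiliary space with a site on which the ring acts: the
elements `p i j` multiply like the matrix units `E_{ji}` of that site. -/
structure IsExchange {R : Type*} [Ring R] (p : Matrix (Fin 2) (Fin 2) R) : Prop where
  mul_apply : ∀ i j k l, p i j * p k l = if i = l then p k j else 0
  trace_eq : p 0 0 + p 1 1 = 1

/-- The Lax operator `u + η P` built on an exchange matrix `P`. -/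
def lax (η : ℂ) (p : Matrix (Fin 2) (Fin 2) R) (u : ℂ) : Matrix (Fin 2) (Fin 2) R := u • 1 + η • p

variable (R) in
/-- The R-matrix acting on the two auxiliary spaces. -/
def rFlip (η u : ℂ) : Matrix (Fin 2 × Fin 2) (Fin 2 × Fin 2) R := u • 1 + η • flip R

theorem IsExchange.mul_self {R : Type*} [Ring R] {p : Matrix (Fin 2) (Fin 2) R}
    (hp : IsExchange p) : p * p = 1 := by
  have h := hp.trace_eq
  ext i j
  rw [Matrix.mul_apply, Fin.sum_univ_two]
  simp only [hp.mul_apply]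
  fin_cases i <;> fin_cases j <;> simp [h]

theorem IsExchange.aux1_mul_aux2 {p : Matrix (Fin 2) (Fin 2) R} (hp : IsExchange p) :
    aux1 p * aux2 p = flip R * aux1 p := by
  ext ⟨i, k⟩ ⟨j, l⟩
  rw [aux1_mul_aux2_apply, flip_mul_apply, hp.mul_apply, aux1_apply]; rfl

theorem IsExchange.aux2_mul_aux1 {p : Matrix (Fin 2) (Fin 2) R} (hp : IsExchange p) :
    aux2 p * aux1 p = aux1 p * flip R := by
  ext ⟨i, k⟩ ⟨j, l⟩
  rw [aux2_mul_aux1_apply, mul_flip_apply, hp.mul_apply, aux1_apply]; rfl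

/-- The Yang–Baxter equation, with the R-matrix of the auxiliary spaces in the middle. -/
theorem IsExchange.yangBaxter_mid {p : Matrix (Fin 2) (Fin 2) R} (hp : IsExchange p)
    (η x y : ℂ) :
    aux1 (lax η p x) * rFlip R η (x + y) * aux2 (lax η p y) =
      aux2 (lax η p y) * rFlip R η (x + y) * aux1 (lax η p x) := by
  have h12 := hp.aux1_mul_aux2
  have h21 := hp.aux2_mul_aux1
  have f1 := flip_mul_aux1 p
  have f2 := flip_mul_aux2 p
  have s1 : aux1 p * aux1 p = 1 := by rw [← map_mul, hp.mul_self, map_one]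
  have s2 : aux2 p * aux2 p = 1 := by rw [← map_mul, hp.mul_self, map_one]
  have c1 : aux1 p * flip R * aux2 p = flip R := by
    rw [mul_assoc, f2, ← mul_assoc, s1, one_mul]
  have c2 : aux2 p * flip R * aux1 p = flip R := by
    rw [mul_assoc, f1, ← mul_assoc, s2, one_mul]
  simp only [lax, rFlip, map_add, map_smul, map_one, add_mul, mul_add, smul_mul_assoc,
    mul_smul_comm, one_mul, mul_one, smul_add, smul_smul, c1, c2, h21, h12, f1, f2]
  module

/-- The Yang–Baxter equation, with the R-matrix of the auxiliary spaces on the outside. -/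
theorem IsExchange.yangBaxter {p : Matrix (Fin 2) (Fin 2) R} (hp : IsExchange p)
    (η x y : ℂ) :
    rFlip R η (x - y) * aux1 (lax η p x) * aux2 (lax η p y) =
      aux2 (lax η p y) * aux1 (lax η p x) * rFlip R η (x - y) := by
  have h12 := hp.aux1_mul_aux2
  have h21 := hp.aux2_mul_aux1
  have f1 := flip_mul_aux1 p
  have f2 := flip_mul_aux2 p
  have s1 : aux1 p * aux1 p = 1 := by rw [← map_mul, hp.mul_self, map_one]
  have s2 : aux2 p * aux2 p = 1 := by rw [← map_mul, hp.mul_self, map_one]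
  have c1 : aux2 p * flip R * aux2 p = aux1 p := by
    rw [← f1, ← h12, mul_assoc, s2, mul_one]
  have c2 : aux1 p * flip R * flip R = aux1 p := by
    rw [mul_assoc, flip_mul_flip, mul_one]
  simp only [lax, rFlip, map_add, map_smul, map_one, add_mul, mul_add, smul_mul_assoc,
    mul_smul_comm, one_mul, mul_one, smul_add, smul_smul, c1, c2, h21, h12, f1, f2]
  module

/-- The exchange relation of a bulk monodromy matrix. -/
def RTT (η x : ℂ) (U V : Matrix (Fin 2) (Fin 2) R) : Prop :=
  rFlip R η x * aux1 U * aux2 V = aux2 V * aux1 U * rFlip R η x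

/-- The reflection equation, with `x` and `y` the arguments of the two R-matrices. -/
def Reflection (η x y : ℂ) (U V : Matrix (Fin 2) (Fin 2) R) : Prop :=
  rFlip R η x * aux1 U * rFlip R η y * aux2 V = aux2 V * rFlip R η y * aux1 U * rFlip R η x

/-- Adding a site preserves the bulk exchange relation. -/
theorem RTT.lax_mul {p U V : Matrix (Fin 2) (Fin 2) R} {η x y : ℂ} (h : RTT η (x - y) U V)
    (hp : IsExchange p) (hU : ∀ i j k l, Commute (U i j) (p k l))
    (hV : ∀ i j k l, Commute (V i j) (p k l)) :
    RTT η (x - y) (lax η p x * U) (lax η p y * V) := by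
  have cU : Commute (aux1 U) (aux2 (lax η p y)) := by
    rw [lax, map_add, map_smul, map_smul, map_one]
    exact ((Commute.one_right _).smul_right _).add_right
      ((aux1_commute_aux2 hU).smul_right _)
  have cV : Commute (aux1 (lax η p x)) (aux2 V) := by
    rw [lax, map_add, map_smul, map_smul, map_one]
    exact ((Commute.one_left _).smul_left _).add_left
      ((aux1_commute_aux2 fun i j k l => (hV k l i j).symm).smul_left _)
  unfold RTT at *
  have yb := hp.yangBaxter η x y
  set r := rFlip R η (x - y)
  set L₁ := aux1 (lax η p x)
  set L₂ := aux2 (lax η p y)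
  simp only [map_mul]
  calc r * (L₁ * aux1 U) * (L₂ * aux2 V) = r * L₁ * (aux1 U * L₂) * aux2 V := by
        simp only [mul_assoc]
    _ = (r * L₁ * L₂) * aux1 U * aux2 V := by rw [cU.eq]; simp only [mul_assoc]
    _ = L₂ * L₁ * (r * aux1 U * aux2 V) := by rw [yb]; simp only [mul_assoc]
    _ = L₂ * (L₁ * aux2 V) * aux1 U * r := by rw [h]; simp only [mul_assoc]
    _ = L₂ * aux2 V * (L₁ * aux1 U) * r := by rw [cV.eq]; simp only [mul_assoc]

/-- Dressing with a site on both sides preserves the reflection equation. -/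
theorem Reflection.lax_mul_lax {p U V : Matrix (Fin 2) (Fin 2) R} {η x x' y y' : ℂ}
    (h : Reflection η (x - y) (x' + y) U V) (hxy : x - y = x' - y')
    (hp : IsExchange p) (hU : ∀ i j k l, Commute (U i j) (p k l))
    (hV : ∀ i j k l, Commute (V i j) (p k l)) :
    Reflection η (x - y) (x' + y) (lax η p x * U * lax η p x') (lax η p y * V * lax η p y') := by
  have cU : ∀ u, Commute (aux1 U) (aux2 (lax η p u)) := fun u => by
    rw [lax, map_add, map_smul, map_smul, map_one]
    exact ((Commute.one_right _).smul_right _).add_right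
      ((aux1_commute_aux2 hU).smul_right _)
  have cV : ∀ u, Commute (aux1 (lax η p u)) (aux2 V) := fun u => by
    rw [lax, map_add, map_smul, map_smul, map_one]
    exact ((Commute.one_left _).smul_left _).add_left
      ((aux1_commute_aux2 fun i j k l => (hV k l i j).symm).smul_left _)
  have m1 := hp.yangBaxter_mid η x' y
  have m2 := hp.yangBaxter_mid η x y'
  have hyx : x + y' = x' + y := by linear_combination hxy
  rw [hyx] at m2
  have yb := hp.yangBaxter η x y
  have yb' := hp.yangBaxter η x' y'
  rw [← hxy] at yb'
  unfold Reflection at *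
  have cU₁ := (cU y).eq
  have cU₂ := (cU y').eq
  have cV₁ := (cV x).eq
  have cV₂ := (cV x').eq
  set r := rFlip R η (x - y)
  set q := rFlip R η (x' + y)
  simp only [map_mul]
  set L₁ := aux1 (lax η p x)
  set L₂ := aux2 (lax η p y)
  set K₁ := aux1 (lax η p x')
  set K₂ := aux2 (lax η p y')
  calc r * (L₁ * aux1 U * K₁) * q * (L₂ * aux2 V * K₂)
      = r * L₁ * aux1 U * (K₁ * q * L₂) * aux2 V * K₂ := by simp only [mul_assoc]
    _ = r * L₁ * (aux1 U * L₂) * q * (K₁ * aux2 V) * K₂ := by rw [m1]; simp only [mul_assoc]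
    _ = (r * L₁ * L₂) * aux1 U * q * aux2 V * K₁ * K₂ := by
        rw [cU₁, cV₂]; simp only [mul_assoc]
    _ = L₂ * L₁ * (r * aux1 U * q * aux2 V) * K₁ * K₂ := by rw [yb]; simp only [mul_assoc]
    _ = L₂ * L₁ * aux2 V * q * aux1 U * (r * K₁ * K₂) := by rw [h]; simp only [mul_assoc]
    _ = L₂ * (L₁ * aux2 V) * q * (aux1 U * K₂) * K₁ * r := by rw [yb']; simp only [mul_assoc]
    _ = L₂ * aux2 V * (L₁ * q * K₂) * aux1 U * K₁ * r := by
        rw [cV₁, cU₂]; simp only [mul_assoc]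
    _ = L₂ * aux2 V * K₂ * q * (L₁ * aux1 U * K₁) * r := by rw [m2]; simp only [mul_assoc]

/-- The bulk exchange relation in components. -/
theorem RTT.comp {U V : Matrix (Fin 2) (Fin 2) R} {η x : ℂ} (h : RTT η x U V) (i j k l : Fin 2) :
    x • (U i j * V k l) + η • (U k j * V i l) = x • (V k l * U i j) + η • (V k j * U i l) := by
  have := congrFun (congrFun h (i, k)) (j, l)
  simp only [rFlip, add_mul, mul_add, smul_mul_assoc, mul_smul_comm, one_mul, mul_one,
    Matrix.add_apply, Matrix.smul_apply, mul_assoc, flip_mul_apply] at this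
  simp only [← mul_assoc, mul_flip_apply, Prod.swap, aux1_mul_aux2_apply,
    aux2_mul_aux1_apply] at this
  exact this

theorem aux1_mul_aux1_apply (X Y : Matrix (Fin 2) (Fin 2) R) (i k j l : Fin 2) :
    (aux1 X * aux1 Y) (i, k) (j, l) = if k = l then (X * Y) i j else 0 := by
  rw [← map_mul, aux1_apply]

theorem aux2_mul_aux2_apply (X Y : Matrix (Fin 2) (Fin 2) R) (i k j l : Fin 2) :
    (aux2 X * aux2 Y) (i, k) (j, l) = if i = j then (X * Y) k l else 0 := by
  rw [← map_mul, aux2_apply]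

/-- The reflection equation in components. -/
theorem reflection_iff {U V : Matrix (Fin 2) (Fin 2) R} {η x y : ℂ} :
    Reflection η x y U V ↔ ∀ i j k l : Fin 2,
    (x * y) • (U i j * V k l) + (x * η) • (if k = j then (U * V) i l else 0) +
      (η * y) • (U k j * V i l) + (η * η) • (if i = j then (U * V) k l else 0) =
    (x * y) • (V k l * U i j) + (x * η) • (if i = l then (V * U) k j else 0) +
      (η * y) • (V k j * U i l) + (η * η) • (if i = j then (V * U) k l else 0) := by
  have e1 : aux1 U * flip R * aux2 V = aux1 U * aux1 V * flip R := by
    rw [mul_assoc, flip_mul_aux2, mul_assoc]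
  have e2 : flip R * aux1 U * flip R * aux2 V = aux2 U * aux2 V := by
    rw [flip_mul_aux1, mul_assoc (aux2 U), flip_mul_flip, mul_one]
  have e3 : aux2 V * flip R * aux1 U = flip R * (aux1 V * aux1 U) := by
    rw [← flip_mul_aux1, mul_assoc]
  have key : ∀ i k j l : Fin 2,
      (rFlip R η x * aux1 U * rFlip R η y * aux2 V) (i, k) (j, l) =
        (aux2 V * rFlip R η y * aux1 U * rFlip R η x) (i, k) (j, l) ↔
      (x * y) • (U i j * V k l) + (x * η) • (if k = j then (U * V) i l else 0) +
        (η * y) • (U k j * V i l) + (η * η) • (if i = j then (U * V) k l else 0) =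
      (x * y) • (V k l * U i j) + (x * η) • (if i = l then (V * U) k j else 0) +
        (η * y) • (V k j * U i l) + (η * η) • (if i = j then (V * U) k l else 0) := by
    intro i k j l
    unfold rFlip
    simp only [add_mul, mul_add, smul_mul_assoc, mul_smul_comm, one_mul, mul_one, e1, e2, e3,
      smul_add, smul_smul, Matrix.add_apply, Matrix.smul_apply]
    simp only [mul_assoc (flip R), mul_flip_apply, flip_mul_apply, Prod.swap,
      aux1_mul_aux2_apply, aux2_mul_aux1_apply, aux1_mul_aux1_apply, aux2_mul_aux2_apply]
    constructor <;> intro this <;> linear_combination (norm := module) this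
  constructor
  · intro h i j k l
    exact (key i k j l).1 (congrFun (congrFun h (i, k)) (j, l))
  · intro h
    ext ⟨i, k⟩ ⟨j, l⟩
    exact (key i k j l).2 (h i j k l)

/-- The relation which moves the diagonal entry `0 0` through the entry `0 1`. -/
theorem Reflection.entry00_mul_entry01 {U V : Matrix (Fin 2) (Fin 2) R} {η x y : ℂ}
    (h : Reflection η x y U V) :
    (x * (y + η)) • (V 0 0 * U 0 1) =
      (y * (x + η)) • (U 0 1 * V 0 0) - η • (V 0 1 * (x • U 1 1 + y • U 0 0)) := by
  have := reflection_iff.1 h 0 1 0 0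
  simp only [Matrix.mul_apply, Fin.sum_univ_two, mul_add, mul_smul_comm] at this ⊢
  simp at this
  linear_combination (norm := module) -this

/-- The relation which moves the entry `0 1` through the diagonal entry `1 1`. -/
theorem Reflection.entry01_mul_entry11 {U V : Matrix (Fin 2) (Fin 2) R} {η x y : ℂ}
    (h : Reflection η x y U V) :
    (x * (y + η)) • (U 0 1 * V 1 1) =
      (y * (x + η)) • (V 1 1 * U 0 1) - η • ((x • U 0 0 + y • U 1 1) * V 0 1) := by
  have := reflection_iff.1 h 0 1 1 1
  simp only [Matrix.mul_apply, Fin.sum_univ_two, add_mul, smul_mul_assoc] at this ⊢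
  simp at this
  linear_combination (norm := module) this

/-- Diagonal entries `0 0` commute on covectors killed by the entries `0 1`. -/
theorem Reflection.entry00_mul_entry00 {U V : Matrix (Fin 2) (Fin 2) R} {η x y : ℂ}
    (h : Reflection η x y U V) :
    ((x + η) * (y + η)) • (U 0 0 * V 0 0 - V 0 0 * U 0 0) =
      (η * (x + η)) • (V 0 1 * U 1 0 - U 0 1 * V 1 0) := by
  have := reflection_iff.1 h 0 0 0 0
  simp only [Matrix.mul_apply, Fin.sum_univ_two] at this ⊢
  simp at this
  linear_combination (norm := module) this

/-- Diagonal entries `1 1` commute on vectors killed by the entries `0 1`. -/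
theorem Reflection.entry11_mul_entry11 {U V : Matrix (Fin 2) (Fin 2) R} {η x y : ℂ}
    (h : Reflection η x y U V) :
    ((x + η) * (y + η)) • (U 1 1 * V 1 1 - V 1 1 * U 1 1) =
      (η * (x + η)) • (V 1 0 * U 0 1 - U 1 0 * V 0 1) := by
  have := reflection_iff.1 h 1 1 1 1
  simp only [Matrix.mul_apply, Fin.sum_univ_two] at this ⊢
  simp at this
  linear_combination (norm := module) this

/-- The boundary matrices `1 + u J` with a fixed traceless `J` solve the reflection equation. -/
theorem reflection_boundary (η u v a b b' : ℂ) :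
    Reflection (R := R) η (u - v) (u + v)
      ((!![1 + u * a, u * b; u * b', 1 - u * a] : Matrix (Fin 2) (Fin 2) ℂ).map fun x => x • 1)
      ((!![1 + v * a, v * b; v * b', 1 - v * a] : Matrix (Fin 2) (Fin 2) ℂ).map
        fun x => x • 1) := by
  rw [reflection_iff]
  intro i j k l
  fin_cases i <;> fin_cases j <;> fin_cases k <;> fin_cases l <;>
    simp [Matrix.mul_apply, Fin.sum_univ_two, smul_smul, -smul_add] <;> module

/-- Adjugate-type symmetry `λ ↦ -λ`: the combination `(2λ - η) U(-λ) + (2λ + η) U(λ)` is trivial in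
the auxiliary space. Here `U'` plays the role of `U(-λ)`. -/
def Crossing (η lam : ℂ) (U U' : Matrix (Fin 2) (Fin 2) R) : Prop :=
  (2 * lam - η) • U' + (2 * lam + η) • U = (2 * lam) • Matrix.diagonal fun _ => U 0 0 + U 1 1

theorem lax_mul_mul_lax (η u v : ℂ) (p X : Matrix (Fin 2) (Fin 2) R) :
    lax η p u * X * lax η p v =
      (u * v) • X + (u * η) • (X * p) + (v * η) • (p * X) + (η * η) • (p * X * p) := by
  simp only [lax, add_mul, mul_add, smul_mul_assoc, mul_smul_comm, one_mul, mul_one]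
  module

/-- Dressing with a site on both sides preserves the crossing symmetry. -/
theorem Crossing.lax_mul_lax {p U U' : Matrix (Fin 2) (Fin 2) R} {η lam x y : ℂ}
    (h : Crossing η lam U U') (hxy : x + y + η = 2 * lam)
    (hp : IsExchange p) (hU : ∀ i j k l, Commute (U i j) (p k l)) :
    Crossing η lam (lax η p x * U * lax η p y)
      (lax η p (-y - η) * U' * lax η p (-x - η)) := by
  set T := U 0 0 + U 1 1 with hT
  set S := U 0 0 * p 0 0 + U 0 1 * p 1 0 + U 1 0 * p 0 1 + U 1 1 * p 1 1 with hS
  have hp1 : p 1 1 = 1 - p 0 0 := by rw [← hp.trace_eq]; abel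
  have cm : ∀ i j k l, p k l * U i j = U i j * p k l := fun i j k l => (hU i j k l).eq.symm
  -- Besides `p * p = 1` the decisive relation is `F1`: the anticommutator of `U` and `p` is
  -- `U + T p` up to a term which is trivial in the auxiliary space.
  have F1 : U * p + p * U - U - Matrix.diagonal (fun _ => T) * p =
      Matrix.diagonal fun _ => S - T := by
    ext i j
    fin_cases i <;> fin_cases j <;>
      simp [Matrix.mul_apply, Fin.sum_univ_two, hT, hS, cm, hp1] <;> noncomm_ring
  have F2 : p * Matrix.diagonal (fun _ => T) = Matrix.diagonal (fun _ => T) * p := by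
    ext i j
    simp [hT, mul_add, add_mul, cm]
  have F3 : Matrix.diagonal (fun _ => T) * p * p = Matrix.diagonal fun _ => T := by
    rw [mul_assoc, hp.mul_self, mul_one]
  have F4 : (p * U * p) 0 0 + (p * U * p) 1 1 = (2 : ℂ) • S := by
    have pp : ∀ i j k l m n, p i j * U m n * p k l = U m n * (if i = l then p k j else 0) := by
      intro i j k l m n
      rw [cm, mul_assoc, hp.mul_apply]
    simp only [Matrix.mul_apply, Fin.sum_univ_two, add_mul, pp, hS]
    simp
    module
  have F5 : (U * p) 0 0 + (U * p) 1 1 = S := by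
    simp only [Matrix.mul_apply, Fin.sum_univ_two, hS]; abel
  have F6 : (p * U) 0 0 + (p * U) 1 1 = S := by
    simp only [Matrix.mul_apply, Fin.sum_univ_two, hS, cm]; abel
  have hU' : (2 * lam - η) • U' =
      (2 * lam) • Matrix.diagonal (fun _ => T) - (2 * lam + η) • U := eq_sub_of_add_eq h
  have tr : (lax η p x * U * lax η p y) 0 0 + (lax η p x * U * lax η p y) 1 1 =
      (x * y) • T + ((x + y + 2 * η) * η) • S := by
    simp only [lax_mul_mul_lax, Matrix.add_apply, Matrix.smul_apply]
    linear_combination (norm := module) (x * η) • F5 + (y * η) • F6 + (η * η) • F4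
  have dg : ∀ (s : ℂ) (X : R), s • Matrix.diagonal (fun _ : Fin 2 => X) =
      Matrix.diagonal fun _ => s • X := fun s X => (Matrix.diagonal_smul s _).symm
  have dS : Matrix.diagonal (fun _ : Fin 2 => S - T) =
      Matrix.diagonal (fun _ => S) - Matrix.diagonal fun _ => T := (Matrix.diagonal_sub _ _).symm
  rw [dS] at F1
  have dT : ∀ s t : ℂ, Matrix.diagonal (fun _ : Fin 2 => s • T + t • S) =
      s • Matrix.diagonal (fun _ => T) + t • Matrix.diagonal fun _ => S := fun s t => by
    rw [dg, dg, Matrix.diagonal_add]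
  unfold Crossing
  rw [tr, ← smul_mul_assoc, ← mul_smul_comm, hU', dT]
  obtain rfl : lam = (x + y + η) / 2 := by rw [hxy]; ring
  simp only [lax_mul_mul_lax, mul_sub, sub_mul, mul_smul_comm, smul_mul_assoc, F3, F2]
  linear_combination (norm := module) ((x + y + 2 * η) * (η * (x + y + η))) • F1

end Algebra

/-! ### Operators acting on single sites -/

section Sites

variable {N : ℕ}

theorem siteOp_mul_apply (n : Fin N) (X : Matrix (Fin 2) (Fin 2) ℂ) (Y : Op N) (s t : Conf N) :
    (siteOp n X * Y) s t = ∑ j, X (s n) j * Y (Function.update s n j) t := by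
  rw [Matrix.mul_apply]
  symm
  refine Fintype.sum_of_injective (Function.update s n) (Function.update_injective s n) _ _ ?_ ?_
  · intro r hr
    have : ¬ ∀ m, m ≠ n → s m = r m := by
      intro h
      refine hr ⟨r n, ?_⟩
      ext m
      by_cases hm : m = n
      · subst hm; simp
      · simp [hm, h m hm]
    simp [siteOp, this]
  · intro j
    have : ∀ m, m ≠ n → s m = Function.update s n j m := fun m hm => by simp [hm]
    simp only [siteOp, Matrix.of_apply, if_pos this, Function.update_self]

theorem mul_siteOp_apply (n : Fin N) (X : Matrix (Fin 2) (Fin 2) ℂ) (Y : Op N) (s t : Conf N) :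
    (Y * siteOp n X) s t = ∑ j, Y s (Function.update t n j) * X j (t n) := by
  rw [Matrix.mul_apply]
  symm
  refine Fintype.sum_of_injective (Function.update t n) (Function.update_injective t n) _ _ ?_ ?_
  · intro r hr
    have : ¬ ∀ m, m ≠ n → r m = t m := by
      intro h
      refine hr ⟨r n, ?_⟩
      ext m
      by_cases hm : m = n
      · subst hm; simp
      · simp [hm, h m hm]
    simp [siteOp, this]
  · intro j
    have : ∀ m, m ≠ n → Function.update t n j m = t m := fun m hm => by simp [hm]
    simp only [siteOp, Matrix.of_apply, if_pos this, Function.update_self]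

theorem siteOp_mul_siteOp (n : Fin N) (X Y : Matrix (Fin 2) (Fin 2) ℂ) :
    siteOp n X * siteOp n Y = siteOp n (X * Y) := by
  ext s t
  rw [siteOp_mul_apply]
  have : ∀ j, (∀ m, m ≠ n → Function.update s n j m = t m) ↔ ∀ m, m ≠ n → s m = t m := by
    intro j
    refine forall_congr' fun m => imp_congr_right fun hm => ?_
    simp [hm]
  by_cases h : ∀ m, m ≠ n → s m = t m <;> simp [siteOp, this, h, Matrix.mul_apply]

theorem siteOp_one (n : Fin N) : siteOp n 1 = 1 := by
  ext s t
  by_cases hst : s = t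
  · subst hst; simp [siteOp]
  · rw [Matrix.one_apply_ne hst]
    by_cases h : ∀ m, m ≠ n → s m = t m
    · have : s n ≠ t n := fun h' => hst (funext fun m => by
        by_cases hm : m = n
        · subst hm; exact h'
        · exact h m hm)
      simp [siteOp, Matrix.one_apply_ne this]
    · simp only [siteOp, Matrix.of_apply, if_neg h]

theorem siteOp_add (n : Fin N) (X Y : Matrix (Fin 2) (Fin 2) ℂ) :
    siteOp n (X + Y) = siteOp n X + siteOp n Y := by
  ext s t
  by_cases h : ∀ m, m ≠ n → s m = t m
  · simp only [siteOp, Matrix.of_apply, if_pos h, Matrix.add_apply]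
  · simp only [siteOp, Matrix.of_apply, if_neg h, Matrix.add_apply, add_zero]

theorem siteOp_smul (n : Fin N) (r : ℂ) (X : Matrix (Fin 2) (Fin 2) ℂ) :
    siteOp n (r • X) = r • siteOp n X := by
  ext s t
  by_cases h : ∀ m, m ≠ n → s m = t m
  · simp only [siteOp, Matrix.of_apply, if_pos h, Matrix.smul_apply]
  · simp only [siteOp, Matrix.of_apply, if_neg h, Matrix.smul_apply, smul_zero]

theorem siteOp_zero (n : Fin N) : siteOp n 0 = 0 := by
  ext s t
  simp [siteOp]

theorem siteOp_commute {n m : Fin N} (hnm : n ≠ m) (X Y : Matrix (Fin 2) (Fin 2) ℂ) :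
    Commute (siteOp n X) (siteOp m Y) := by
  -- Both products have the same explicit entries, a product of an entry of `X` and one of `Y`.
  have key : ∀ (n m : Fin N) (_ : n ≠ m) (X Y : Matrix (Fin 2) (Fin 2) ℂ) (s t : Conf N),
      (siteOp n X * siteOp m Y) s t = if ∀ p, p ≠ n → p ≠ m → s p = t p then
        X (s n) (t n) * Y (s m) (t m) else 0 := by
    intro n m hnm X Y s t
    rw [siteOp_mul_apply, Finset.sum_eq_single (t n)]
    · have : (∀ p, p ≠ m → Function.update s n (t n) p = t p) ↔
          ∀ p, p ≠ n → p ≠ m → s p = t p := by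
        refine forall_congr' fun p => ?_
        by_cases hp : p = n
        · subst hp; simp
        · simp [hp]
      simp only [siteOp, Matrix.of_apply, this, Function.update_of_ne hnm.symm, mul_ite, mul_zero]
    · intro j _ hj
      have : ¬ ∀ p, p ≠ m → Function.update s n j p = t p := fun h => hj (by
        simpa using h n hnm)
      simp only [siteOp, Matrix.of_apply, if_neg this, mul_zero]
    · simp
  ext s t
  rw [key n m hnm, key m n hnm.symm]
  have : (∀ p, p ≠ n → p ≠ m → s p = t p) ↔ ∀ p, p ≠ m → p ≠ n → s p = t p :=
    forall_congr' fun p => by tauto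
  simp only [this, mul_comm]

/-- The exchange of the auxiliary space with site `n`. -/
def permAux (n : Fin N) : AuxOp N := Matrix.of fun i j => siteOp n (Matrix.single j i 1)

theorem permAux_apply (n : Fin N) (i j : Fin 2) : permAux n i j = siteOp n (Matrix.single j i 1) :=
  rfl

theorem isExchange_permAux (n : Fin N) : IsExchange (permAux n) where
  mul_apply i j k l := by
    rw [permAux_apply, permAux_apply, siteOp_mul_siteOp]
    split_ifs with h
    · subst h; simp [permAux_apply]
    · simp [h, siteOp_zero]
  trace_eq := by
    rw [permAux_apply, permAux_apply, ← siteOp_add, ← siteOp_one n]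
    congr 1
    ext i j
    fin_cases i <;> fin_cases j <;> simp

/-- The R-matrix on the auxiliary space and a site is `u + η P`. -/
theorem rAux_eq_lax (η : ℂ) (n : Fin N) (u : ℂ) : rAux η n u = lax η (permAux n) u := by
  ext1 i j
  rw [lax, Matrix.add_apply, Matrix.smul_apply, Matrix.smul_apply, permAux_apply,
    ← siteOp_smul]
  have h1 : u • (1 : AuxOp N) i j = siteOp n (if i = j then u • 1 else 0) := by
    by_cases h : i = j
    · subst h; rw [if_pos rfl, siteOp_smul, siteOp_one, Matrix.one_apply_eq]
    · simp [h, siteOp_zero]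
  rw [h1, ← siteOp_add]
  simp only [rAux, Matrix.of_apply]
  congr 1
  ext s t
  fin_cases i <;> fin_cases j <;> fin_cases s <;> fin_cases t <;>
    simp [rMatrix, finProdFinEquiv, Fin.divNat]

theorem permAux_commute {n m : Fin N} (h : n ≠ m) (i j k l : Fin 2) :
    Commute (permAux n i j) (permAux m k l) := siteOp_commute h _ _

theorem rAux_apply (η : ℂ) (n : Fin N) (u : ℂ) (i j : Fin 2) :
    rAux η n u i j = u • (if i = j then 1 else 0) + η • permAux n i j := by
  rw [rAux_eq_lax]; simp [lax, Matrix.one_apply]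

theorem rAux_commute_permAux {n m : Fin N} (h : n ≠ m) (η u : ℂ) (i j k l : Fin 2) :
    Commute (rAux η n u i j) (permAux m k l) := by
  rw [rAux_apply]
  refine (Commute.smul_left ?_ _).add_left ((permAux_commute h i j k l).smul_left _)
  split_ifs
  · exact Commute.one_left _
  · exact Commute.zero_left _

end Sites

/-! ### Monodromy matrices over lists of sites -/

section Dressing

variable {N : ℕ} (c : OpenXXX N)

/-- The bulk monodromy over a list of sites; the head of the list is the leftmost factor. -/
noncomputable def bulk (l : List (Fin N)) (lam : ℂ) : AuxOp N :=
  (l.map fun n => rAux c.η n (lam - c.ξ n - c.η / 2)).prod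

/-- The boundary monodromy over a list of sites, with the boundary matrix `K`; the head of the list
is the outermost site. -/
noncomputable def dressed (K : Matrix (Fin 2) (Fin 2) ℂ) (lam : ℂ) : List (Fin N) → AuxOp N
  | [] => auxOp N K
  | n :: l => rAux c.η n (lam - c.ξ n - c.η / 2) * dressed K lam l *
      rAux c.η n (lam + c.ξ n - c.η / 2)

theorem commute_mul_entry {R : Type*} [Ring R] {X Y : Matrix (Fin 2) (Fin 2) R} {z : R}
    (hX : ∀ i j, Commute (X i j) z) (hY : ∀ i j, Commute (Y i j) z) (i j : Fin 2) :
    Commute ((X * Y) i j) z := by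
  rw [Matrix.mul_apply]
  exact Commute.sum_left _ _ _ fun k _ => (hX i k).mul_left (hY k j)

theorem bulk_commute_permAux {l : List (Fin N)} {m : Fin N} (hm : m ∉ l) (lam : ℂ)
    (i j k r : Fin 2) : Commute (c.bulk l lam i j) (permAux m k r) := by
  induction l generalizing i j with
  | nil =>
    by_cases h : i = j
    · simp [bulk, h]
    · simp [bulk, h]
  | cons n l ih =>
    simp only [List.mem_cons, not_or] at hm
    rw [bulk, List.map_cons, List.prod_cons]
    exact commute_mul_entry (fun i j => rAux_commute_permAux (Ne.symm hm.1) _ _ i j k r)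
      (fun i j => ih hm.2 i j) i j

theorem dressed_commute_permAux (K : Matrix (Fin 2) (Fin 2) ℂ) {l : List (Fin N)} {m : Fin N}
    (hm : m ∉ l) (lam : ℂ) (i j k r : Fin 2) :
    Commute (c.dressed K lam l i j) (permAux m k r) := by
  induction l generalizing i j with
  | nil => simpa [dressed, auxOp] using (Commute.one_left _).smul_left (K i j)
  | cons n l ih =>
    simp only [List.mem_cons, not_or] at hm
    have h := fun u i j => rAux_commute_permAux (Ne.symm hm.1) c.η u i j k r
    exact commute_mul_entry (commute_mul_entry (h _) (fun i j => ih hm.2 i j)) (h _) i j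

theorem rtt_bulk {l : List (Fin N)} (hl : l.Nodup) (lam mu : ℂ) :
    RTT c.η (lam - mu) (c.bulk l lam) (c.bulk l mu) := by
  induction l with
  | nil => simp [RTT, bulk]
  | cons n l ih =>
    rw [List.nodup_cons] at hl
    have := (RTT.lax_mul (x := lam - c.ξ n - c.η / 2) (y := mu - c.ξ n - c.η / 2)
      (by convert ih hl.2 using 1; ring) (isExchange_permAux n)
      (fun i j k r => c.bulk_commute_permAux hl.1 lam i j k r)
      (fun i j k r => c.bulk_commute_permAux hl.1 mu i j k r))
    convert this using 1
    · abel
    · rw [← rAux_eq_lax]; simp [bulk]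
    · rw [← rAux_eq_lax]; simp [bulk]

theorem reflection_dressed {l : List (Fin N)} (hl : l.Nodup)
    {K : ℂ → Matrix (Fin 2) (Fin 2) ℂ} {lam mu : ℂ}
    (hK : Reflection c.η (lam - mu) (lam + mu - c.η) (auxOp N (K lam)) (auxOp N (K mu))) :
    Reflection c.η (lam - mu) (lam + mu - c.η)
      (c.dressed (K lam) lam l) (c.dressed (K mu) mu l) := by
  induction l with
  | nil => exact hK
  | cons n l ih =>
    rw [List.nodup_cons] at hl
    have e1 : lam - mu = lam - c.ξ n - c.η / 2 - (mu - c.ξ n - c.η / 2) := by ring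
    have e2 : lam + mu - c.η = lam + c.ξ n - c.η / 2 + (mu - c.ξ n - c.η / 2) := by ring
    simp only [dressed, rAux_eq_lax]
    rw [e1, e2] at ih ⊢
    exact Reflection.lax_mul_lax (ih hl.2) (by ring) (isExchange_permAux n)
      (fun i j k r => c.dressed_commute_permAux _ hl.1 lam i j k r)
      (fun i j k r => c.dressed_commute_permAux _ hl.1 mu i j k r)

theorem crossing_dressed {l : List (Fin N)} (hl : l.Nodup)
    {K : ℂ → Matrix (Fin 2) (Fin 2) ℂ} {lam : ℂ}
    (hK : Crossing c.η lam (auxOp N (K lam)) (auxOp N (K (-lam)))) :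
    Crossing c.η lam (c.dressed (K lam) lam l) (c.dressed (K (-lam)) (-lam) l) := by
  induction l with
  | nil => exact hK
  | cons n l ih =>
    rw [List.nodup_cons] at hl
    simp only [dressed, rAux_eq_lax]
    have := Crossing.lax_mul_lax (x := lam - c.ξ n - c.η / 2) (y := lam + c.ξ n - c.η / 2)
      (ih hl.2) (by ring) (isExchange_permAux n)
      (fun i j k r => c.dressed_commute_permAux _ hl.1 lam i j k r)
    have e1 : -lam - c.ξ n - c.η / 2 = -(lam + c.ξ n - c.η / 2) - c.η := by ring
    have e2 : -lam + c.ξ n - c.η / 2 = -(lam - c.ξ n - c.η / 2) - c.η := by ring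
    rw [e1, e2]
    exact this

end Dressing

/-! ### The gauge transformation -/

section Gauge

variable {N : ℕ} (c : OpenXXX N)

theorem auxOp_mul (X Y : Matrix (Fin 2) (Fin 2) ℂ) : auxOp N (X * Y) = auxOp N X * auxOp N Y := by
  ext1 i j
  simp [auxOp, Matrix.mul_apply, smul_smul, add_smul, mul_comm]

theorem auxOp_one : auxOp N 1 = 1 := by
  ext1 i j
  by_cases h : i = j
  · subst h; simp [auxOp]
  · simp [auxOp, h]

theorem auxOp_sigmaY_mul_transpose_mul (X : AuxOp N) :
    auxOp N sigmaY * Xᵀ * auxOp N sigmaY = !![X 1 1, -X 0 1; -X 1 0, X 0 0] := by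
  ext1 i j
  fin_cases i <;> fin_cases j <;>
    simp [Matrix.mul_apply, Fin.sum_univ_two, auxOp, sigmaY, smul_smul]

/-- The factors of the second monodromy matrix, in the order of the list. -/
noncomputable def bulkHat (l : List (Fin N)) (lam : ℂ) : AuxOp N :=
  (l.map fun n => rAux c.η n (lam + c.ξ n - c.η / 2)).prod

theorem transpose_mul_of_commute {R : Type*} [Ring R] {X Y : Matrix (Fin 2) (Fin 2) R}
    (h : ∀ i j k l, Commute (X i j) (Y k l)) : (X * Y)ᵀ = Yᵀ * Xᵀ := by
  ext i j
  simp only [Matrix.transpose_apply, Matrix.mul_apply]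
  exact Finset.sum_congr rfl fun k _ => h _ _ _ _

/-- Crossing symmetry of the R-matrix. -/
theorem sigmaY_rAux_transpose (η : ℂ) (n : Fin N) (u : ℂ) :
    auxOp N sigmaY * (rAux η n u)ᵀ * auxOp N sigmaY = -rAux η n (-u - η) := by
  have h : permAux n 1 1 = (1 : Op N) - permAux n 0 0 := by
    rw [← (isExchange_permAux n).trace_eq]; abel
  rw [auxOp_sigmaY_mul_transpose_mul]
  ext1 i j
  rw [Matrix.neg_apply]
  fin_cases i <;> fin_cases j <;> simp only [rAux_apply] <;> simp [h] <;> module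

/-- The matrix `M̂` is the product of the R-matrices at reflected arguments in the opposite order;
the sign of the crossing symmetry of each factor is absorbed by `(-1)^N`. -/
theorem hat_eq_bulkHat {l : List (Fin N)} (hl : l.Nodup) (lam : ℂ) :
    (-1 : ℂ) ^ l.length • (auxOp N sigmaY * (c.bulk l (-lam))ᵀ * auxOp N sigmaY) =
      c.bulkHat l.reverse lam := by
  have hs : auxOp N sigmaY * auxOp N sigmaY = 1 := by
    rw [← auxOp_mul, ← auxOp_one]
    congr 1
    ext i j
    fin_cases i <;> fin_cases j <;> simp [sigmaY]
  induction l with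
  | nil => simp [bulk, bulkHat, hs]
  | cons n l ih =>
    rw [List.nodup_cons] at hl
    have hc : ∀ i j k r, Commute (rAux c.η n (-lam - c.ξ n - c.η / 2) i j)
        (c.bulk l (-lam) k r) := by
      intro i j k r
      rw [rAux_apply]
      refine (Commute.smul_left ?_ _).add_left
        ((c.bulk_commute_permAux hl.1 (-lam) k r i j).symm.smul_left _)
      split_ifs
      · exact Commute.one_left _
      · exact Commute.zero_left _
    have e : c.bulk (n :: l) (-lam) = rAux c.η n (-lam - c.ξ n - c.η / 2) * c.bulk l (-lam) := by
      simp [bulk]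
    have e' : c.bulkHat (n :: l).reverse lam =
        c.bulkHat l.reverse lam * rAux c.η n (lam + c.ξ n - c.η / 2) := by
      simp [bulkHat]
    have hr := sigmaY_rAux_transpose c.η n (-lam - c.ξ n - c.η / 2)
    have ea : -(-lam - c.ξ n - c.η / 2) - c.η = lam + c.ξ n - c.η / 2 := by ring
    rw [ea] at hr
    rw [e, e', transpose_mul_of_commute hc, ← ih hl.2, List.length_cons, pow_succ]
    have : auxOp N sigmaY * ((c.bulk l (-lam))ᵀ * (rAux c.η n (-lam - c.ξ n - c.η / 2))ᵀ) *
        auxOp N sigmaY = auxOp N sigmaY * (c.bulk l (-lam))ᵀ * auxOp N sigmaY *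
          (auxOp N sigmaY * (rAux c.η n (-lam - c.ξ n - c.η / 2))ᵀ * auxOp N sigmaY) := by
      simp only [mul_assoc]
      rw [← mul_assoc (auxOp N sigmaY) (auxOp N sigmaY), hs, one_mul]
    rw [this, hr, mul_neg, mul_one, neg_smul, mul_neg, smul_neg, neg_neg, smul_mul_assoc]

/-- The list of all sites, last site first: in the monodromy matrix, the factor of the last site is
the leftmost one. -/
def sites (N : ℕ) : List (Fin N) := (List.finRange N).reverse

theorem nodup_sites : (sites N).Nodup := List.nodup_reverse.2 (List.nodup_finRange N)

theorem monodromy_eq_bulk (lam : ℂ) : c.monodromy lam = c.bulk (sites N) lam := by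
  rw [monodromy, bulk, sites, List.map_reverse, List.ofFn_eq_map]

theorem monodromyHat_eq_bulkHat (lam : ℂ) :
    c.monodromyHat lam = c.bulkHat (List.finRange N) lam := by
  have := c.hat_eq_bulkHat (nodup_sites (N := N)) lam
  rw [sites, List.reverse_reverse, List.length_reverse, List.length_finRange] at this
  rw [monodromyHat, monodromy_eq_bulk, sites, this]

theorem dressed_eq (K : Matrix (Fin 2) (Fin 2) ℂ) (lam : ℂ) (l : List (Fin N)) :
    c.dressed K lam l = c.bulk l lam * auxOp N K * c.bulkHat l.reverse lam := by
  induction l with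
  | nil => simp [dressed, bulk, bulkHat]
  | cons n l ih => simp [dressed, ih, bulk, bulkHat, mul_assoc]

theorem gammaW_update (n : Fin N) (s t : Conf N) (j : Fin 2) :
    c.gammaW s (Function.update t n j) =
      c.W (s n) j * ∏ m ∈ Finset.univ.erase n, c.W (s m) (t m) := by
  rw [gammaW, Matrix.of_apply, ← Finset.mul_prod_erase _ _ (Finset.mem_univ n),
    Function.update_self]
  congr 1
  refine Finset.prod_congr rfl fun m hm => ?_
  rw [Function.update_of_ne (Finset.ne_of_mem_erase hm)]

theorem gammaW_update_left (n : Fin N) (s t : Conf N) (j : Fin 2) :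
    c.gammaW (Function.update s n j) t =
      c.W j (t n) * ∏ m ∈ Finset.univ.erase n, c.W (s m) (t m) := by
  rw [gammaW, Matrix.of_apply, ← Finset.mul_prod_erase _ _ (Finset.mem_univ n),
    Function.update_self]
  congr 1
  refine Finset.prod_congr rfl fun m hm => ?_
  rw [Function.update_of_ne (Finset.ne_of_mem_erase hm)]

theorem gammaW_mul_inv (hW : c.W.det ≠ 0) : c.gammaW * c.gammaW⁻¹ = 1 := by
  refine Matrix.mul_nonsing_inv _ ?_
  rw [← Matrix.isUnit_iff_isUnit_det]
  refine IsUnit.of_mul_eq_one (Matrix.of fun s t => ∏ n, c.W⁻¹ (s n) (t n)) ?_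
  ext s t
  rw [Matrix.mul_apply]
  simp only [gammaW, Matrix.of_apply, ← Finset.prod_mul_distrib]
  rw [← Fintype.prod_sum (fun n j => c.W (s n) j * c.W⁻¹ j (t n))]
  simp only [← Matrix.mul_apply, Matrix.mul_nonsing_inv _ (isUnit_iff_ne_zero.2 hW)]
  by_cases h : s = t
  · subst h; simp
  · obtain ⟨n, hn⟩ := Function.ne_iff.1 h
    rw [Matrix.one_apply_ne h]
    exact Finset.prod_eq_zero (Finset.mem_univ n) (Matrix.one_apply_ne hn)

/-- The R-matrix is invariant under the simultaneous gauge transformation of both factors. -/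
theorem gauge_commute_permAux (n : Fin N) :
    Commute (auxOp N c.W * Matrix.diagonal fun _ => c.gammaW) (permAux n) := by
  set S : AuxOp N := auxOp N c.W * Matrix.diagonal fun _ => c.gammaW with hS
  have e : ∀ i j, S i j = c.W i j • c.gammaW := by
    intro i j; rw [hS, Matrix.mul_diagonal]; simp [auxOp]
  ext1 i j
  rw [Matrix.mul_apply, Matrix.mul_apply]
  simp only [e, permAux_apply, smul_mul_assoc, mul_smul_comm]
  ext s t
  simp only [Matrix.sum_apply, Matrix.smul_apply, mul_siteOp_apply, siteOp_mul_apply,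
    gammaW_update, gammaW_update_left, smul_eq_mul]
  generalize ∏ m ∈ Finset.univ.erase n, c.W (s m) (t m) = Q
  generalize s n = x
  generalize t n = y
  fin_cases i <;> fin_cases j <;> fin_cases x <;> fin_cases y <;>
    simp [Fin.sum_univ_two, Matrix.single_apply] <;> ring

theorem gauge_commute_rAux (n : Fin N) (u : ℂ) :
    Commute (auxOp N c.W * Matrix.diagonal fun _ => c.gammaW) (rAux c.η n u) := by
  rw [rAux_eq_lax, lax]
  exact ((Commute.one_right _).smul_right _).add_right ((c.gauge_commute_permAux n).smul_right _)

theorem commute_diagonal_auxOp (X : Matrix (Fin 2) (Fin 2) ℂ) (Y : Op N) :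
    Commute (Matrix.diagonal fun _ => Y) (auxOp N X) := by
  ext1 i j
  simp [auxOp]

/-- After the gauge transformation, the chain is the one with boundary matrix `K̄₋`. -/
theorem uBar_eq_dressed (hW : c.W.det ≠ 0) (lam : ℂ) :
    c.uBar lam = c.dressed (c.kBar lam) lam (sites N) := by
  set D : AuxOp N := Matrix.diagonal fun _ => c.gammaW with hD
  set D' : AuxOp N := Matrix.diagonal fun _ => c.gammaW⁻¹ with hD'
  have hDD : D * D' = 1 := by
    rw [hD, hD', Matrix.diagonal_mul_diagonal, c.gammaW_mul_inv hW, Matrix.diagonal_one]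
  have hmap : (c.uMinus lam).map (fun X => c.gammaW * X * c.gammaW⁻¹) = D * c.uMinus lam * D' := by
    ext1 i j
    rw [hD, hD', Matrix.mul_diagonal, Matrix.diagonal_mul, Matrix.map_apply]
  have hWW : auxOp N c.W * auxOp N c.W⁻¹ = 1 := by
    rw [← auxOp_mul, Matrix.mul_nonsing_inv _ (isUnit_iff_ne_zero.2 hW), auxOp_one]
  obtain ⟨S, hS⟩ : ∃ S : AuxOp N, S = auxOp N c.W * D := ⟨_, rfl⟩
  obtain ⟨S', hS'⟩ : ∃ S' : AuxOp N, S' = D' * auxOp N c.W⁻¹ := ⟨_, rfl⟩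
  have hSS : S * S' = 1 := by
    rw [hS, hS', mul_assoc, ← mul_assoc D, hDD, one_mul, hWW]
  have hSS' : S' * S = 1 := by
    rw [hS, hS', mul_assoc, ← mul_assoc (auxOp N c.W⁻¹), ← auxOp_mul,
      Matrix.nonsing_inv_mul _ (isUnit_iff_ne_zero.2 hW), auxOp_one, one_mul, hD, hD',
      Matrix.diagonal_mul_diagonal, mul_eq_one_comm.1 (c.gammaW_mul_inv hW), Matrix.diagonal_one]
  have c1 : Commute S (c.bulk (sites N) lam) := by
    refine Commute.list_prod_right _ _ fun X hX => ?_
    obtain ⟨n, -, rfl⟩ := List.mem_map.1 hX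
    rw [hS]; exact c.gauge_commute_rAux n _
  have c2 : Commute S (c.bulkHat (List.finRange N) lam) := by
    refine Commute.list_prod_right _ _ fun X hX => ?_
    obtain ⟨n, -, rfl⟩ := List.mem_map.1 hX
    rw [hS]; exact c.gauge_commute_rAux n _
  have c3 : c.bulkHat (List.finRange N) lam * S' = S' * c.bulkHat (List.finRange N) lam := by
    calc _ = S' * (S * c.bulkHat (List.finRange N) lam) * S' := by
            rw [← mul_assoc S', hSS', one_mul]
      _ = _ := by rw [c2.eq, mul_assoc S', mul_assoc _ S, hSS, mul_one]
  have hK : S * auxOp N (c.kMinus lam) * S' = auxOp N (c.kBar lam) := by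
    have := (commute_diagonal_auxOp (c.kMinus lam) c.gammaW).eq
    rw [← hD] at this
    rw [kBar, auxOp_mul, auxOp_mul, hS, hS', mul_assoc (auxOp N c.W), this]
    calc _ = auxOp N c.W * auxOp N (c.kMinus lam) * (D * D') * auxOp N c.W⁻¹ := by
            simp only [mul_assoc]
      _ = _ := by rw [hDD, mul_one]
  rw [dressed_eq, uBar, hmap, uMinus, monodromy_eq_bulk, monodromyHat_eq_bulkHat]
  have : (sites N).reverse = List.finRange N := by rw [sites, List.reverse_reverse]
  rw [this, ← hK]
  calc _ = S * c.bulk (sites N) lam * auxOp N (c.kMinus lam) *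
          (c.bulkHat (List.finRange N) lam * S') := by
        simp only [hS, hS', mul_assoc]
    _ = _ := by rw [c1.eq, c3]; simp only [mul_assoc]

end Gauge

/-! ### The boundary matrix in the new gauge -/

section Boundary

variable {N : ℕ} (c : OpenXXX N)

theorem sq_sqrt_sign (ε : ℤˣ) (z : ℂ) : (((ε : ℤ) : ℂ) * Complex.sqrt z) ^ 2 = z := by
  have : (((ε : ℤ) : ℂ)) ^ 2 = 1 := by
    rcases Int.units_eq_one_or ε with h | h <;> simp [h]
  rw [mul_pow, this, one_mul, Complex.sqrt, ← Complex.cpow_mul_nat]; simp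

theorem sm_sq : c.sm ^ 2 = 1 + 4 * c.κm ^ 2 := sq_sqrt_sign _ _

theorem sm_ne_zero (hκm : 1 + 4 * c.κm ^ 2 ≠ 0) : c.sm ≠ 0 := by
  intro h; apply hκm; rw [← c.sm_sq, h]; ring

theorem zetaBarM_ne_zero (hζm : c.ζm ≠ 0) (hκm : 1 + 4 * c.κm ^ 2 ≠ 0) : c.zetaBarM ≠ 0 :=
  div_ne_zero hζm (c.sm_ne_zero hκm)

/-- The gauge-transformed boundary matrix is upper triangular. -/
theorem kBar_eq (hζm : c.ζm ≠ 0) (hκm : 1 + 4 * c.κm ^ 2 ≠ 0)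
    (hκm0 : c.κm = 0 → c.εm = 1) (hW : c.W.det ≠ 0) (lam : ℂ) :
    c.kBar lam = !![1 + (lam - c.η / 2) * (1 / c.zetaBarM),
        (lam - c.η / 2) * (c.bConst / c.zetaBarM);
      (lam - c.η / 2) * 0, 1 - (lam - c.η / 2) * (1 / c.zetaBarM)] := by
  have hs := c.sm_ne_zero hκm
  have hs2 := c.sm_sq
  have hsm1 : c.κm = 0 → c.sm = 1 := fun h => by simp [sm, h, hκm0 h]
  have hE : Complex.exp (-c.τm) = (Complex.exp c.τm)⁻¹ := Complex.exp_neg _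
  have hEp : Complex.exp (-c.τp) = (Complex.exp c.τp)⁻¹ := Complex.exp_neg _
  have hE0 := Complex.exp_ne_zero c.τm
  have hEp0 := Complex.exp_ne_zero c.τp
  set X := 2 * c.κm * Complex.exp c.τm with hX
  set Y := 2 * c.κm * Complex.exp (-c.τm) with hY
  set q := (1 - c.sm) / X with hq
  set p := -((1 - c.sp) / (2 * c.κp * Complex.exp (-c.τp))) with hp
  -- The two relations that also hold for `κ₋ = 0`, where `q` is `0 / 0 = 0` and `s₋ = 1`.
  have hXq : X * q = 1 - c.sm := by
    by_cases h : c.κm = 0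
    · rw [hsm1 h, hX, h]; simp
    · rw [hq, mul_div_cancel₀]; simp [hX, h]
  have hYq : q * (1 + c.sm) = -Y := by
    by_cases h : c.κm = 0
    · rw [hq, hY, hX, h]; simp
    · have hX0 : X ≠ 0 := by simp [hX, h]
      have : X * Y = c.sm ^ 2 - 1 := by
        rw [hs2, hX, hY, hE]; field_simp; ring
      apply mul_left_cancel₀ hX0
      linear_combination (1 + c.sm) * hXq + this
  have hW' : c.W = !![1, p; q, 1] := rfl
  have hb : c.bConst * c.sm = X - p * (1 + c.sm) := by
    rw [bConst, div_mul_cancel₀ _ hs, hp, hEp]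
    by_cases h : c.κp = 0
    · simp [h, hX]
    · field_simp; ring
  have hz : 1 / c.zetaBarM = c.sm / c.ζm := by rw [zetaBarM, one_div_div]
  have hbz : c.bConst / c.zetaBarM = (X - p * (1 + c.sm)) / c.ζm := by
    rw [zetaBarM, ← hb]; field_simp
  rw [hz, hbz, kBar, kMinus, kMatrix, ← hX, ← hY]
  clear_value p q X Y
  generalize lam - c.η / 2 = u
  -- `K̄₋ = W K₋ W⁻¹` is checked in the form `W K₋ = K̄₋ W`.
  have key : c.W * ((1 / c.ζm) • !![c.ζm + u, X * u; Y * u, c.ζm - u]) =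
      !![1 + u * (c.sm / c.ζm), u * ((X - p * (1 + c.sm)) / c.ζm); u * 0,
        1 - u * (c.sm / c.ζm)] * c.W := by
    rw [hW']
    ext i j
    fin_cases i <;> fin_cases j <;> simp [Matrix.mul_apply, Fin.sum_univ_two] <;> field_simp
    · linear_combination u * p * hYq - u * hXq
    · ring
    · linear_combination u * hYq
    · linear_combination u * hXq
  rw [key, mul_assoc, Matrix.mul_nonsing_inv _ (isUnit_iff_ne_zero.2 hW), mul_one]

end Boundary

/-! ### The extreme states -/

section Vacuum

variable {N : ℕ} (c : OpenXXX N)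

theorem single_vecMul_permAux (s : Conf N) (n : Fin N) (i j : Fin 2) :
    Pi.single s 1 ᵥ* permAux n i j =
      if s n = j then Pi.single (Function.update s n i) 1 else 0 := by
  ext t
  rw [Matrix.single_one_vecMul, Matrix.row, permAux_apply, siteOp, Matrix.of_apply]
  have : (∀ m, m ≠ n → s m = t m) ∧ t n = i ↔ t = Function.update s n i := by
    rw [Function.eq_update_iff]
    exact ⟨fun h => ⟨h.2, fun m hm => (h.1 m hm).symm⟩, fun h => ⟨fun m hm => (h.2 m hm).symm, h.1⟩⟩
  by_cases hs : s n = j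
  · rw [if_pos hs, Pi.single_apply]
    simp only [← this, Matrix.single_apply, hs]
    split_ifs <;> grind
  · rw [if_neg hs]
    simp [Ne.symm hs]

theorem permAux_mulVec_single (t : Conf N) (n : Fin N) (i j : Fin 2) :
    permAux n i j *ᵥ Pi.single t 1 =
      if t n = i then Pi.single (Function.update t n j) 1 else 0 := by
  ext s
  rw [Matrix.mulVec_single_one, Matrix.col_apply, permAux_apply, siteOp, Matrix.of_apply]
  have : (∀ m, m ≠ n → s m = t m) ∧ s n = j ↔ s = Function.update t n j := by
    rw [Function.eq_update_iff]
    exact ⟨fun h => ⟨h.2, h.1⟩, fun h => ⟨h.2, h.1⟩⟩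
  by_cases hs : t n = i
  · rw [if_pos hs, Pi.single_apply]
    simp only [← this, Matrix.single_apply, hs]
    split_ifs <;> grind
  · rw [if_neg hs]
    simp [Ne.symm hs]

theorem single_vecMul_rAux (s : Conf N) (n : Fin N) (u : ℂ) (i j : Fin 2) :
    Pi.single s 1 ᵥ* rAux c.η n u i j = u • (if i = j then Pi.single s 1 else 0) +
      c.η • (if s n = j then Pi.single (Function.update s n i) 1 else 0) := by
  rw [rAux_apply, Matrix.vecMul_add, Matrix.vecMul_smul, Matrix.vecMul_smul,
    single_vecMul_permAux]
  congr 2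
  split_ifs <;> simp

theorem rAux_mulVec_single (t : Conf N) (n : Fin N) (u : ℂ) (i j : Fin 2) :
    rAux c.η n u i j *ᵥ Pi.single t 1 = u • (if i = j then Pi.single t 1 else 0) +
      c.η • (if t n = i then Pi.single (Function.update t n j) 1 else 0) := by
  rw [rAux_apply, Matrix.add_mulVec, Matrix.smul_mulVec, Matrix.smul_mulVec,
    permAux_mulVec_single]
  congr 2
  split_ifs
  · rw [Matrix.one_mulVec]
  · rw [Matrix.zero_mulVec]

theorem commute_rAux {n : Fin N} {X : Op N} (h : ∀ k r, Commute X (permAux n k r)) (u : ℂ)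
    (i j : Fin 2) : Commute X (rAux c.η n u i j) := by
  rw [rAux_apply]
  refine (Commute.smul_right ?_ _).add_right ((h i j).smul_right _)
  split_ifs
  · exact Commute.one_right _
  · exact Commute.zero_right _

theorem dressed_cons_apply01 (K : Matrix (Fin 2) (Fin 2) ℂ) (lam : ℂ) (n : Fin N)
    (l : List (Fin N)) : c.dressed K lam (n :: l) 0 1 =
      ∑ j, ∑ i, rAux c.η n (lam - c.ξ n - c.η / 2) 0 i * c.dressed K lam l i j *
        rAux c.η n (lam + c.ξ n - c.η / 2) j 1 := by
  simp only [dressed, Matrix.mul_apply, Finset.sum_mul]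

/-- The all-up covector is a left eigenvector of the entry `0 1`. -/
theorem bra0_vecMul_dressed (K : Matrix (Fin 2) (Fin 2) ℂ) (lam : ℂ) {l : List (Fin N)}
    (hl : l.Nodup) : bra0 N ᵥ* c.dressed K lam l 0 1 =
      (K 0 1 * (l.map fun n => lam ^ 2 - (c.ξ n - c.η / 2) ^ 2).prod) • bra0 N := by
  induction l with
  | nil => simp [dressed, auxOp, Matrix.vecMul_smul]
  | cons n l ih =>
    rw [List.nodup_cons] at hl
    have hL := fun u i j => c.single_vecMul_rAux (fun _ => 0) n u i j
    have hcm := fun u i j => (c.commute_rAux (n := n)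
      (fun k r => c.dressed_commute_permAux K hl.1 lam 0 i k r) u j 1).eq
    have ih := ih hl.2
    have e : Function.update (fun _ : Fin N => (0 : Fin 2)) n 0 = fun _ => 0 :=
      Function.update_eq_self n _
    rw [dressed_cons_apply01]
    unfold bra0 at *
    simp only [Fin.sum_univ_two, Matrix.vecMul_add, mul_assoc, hcm]
    simp only [← Matrix.vecMul_vecMul, hL]
    simp only [e, if_true, if_false, Fin.isValue, zero_ne_one, smul_zero, add_zero,
      Matrix.zero_vecMul, ← add_smul, Matrix.smul_vecMul, hL, ih, smul_smul]
    rw [List.map_cons, List.prod_cons, zero_add]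
    congr 1
    ring

/-- The all-down vector is a right eigenvector of the entry `0 1`. -/
theorem dressed_mulVec_ketDown (K : Matrix (Fin 2) (Fin 2) ℂ) (lam : ℂ) {l : List (Fin N)}
    (hl : l.Nodup) : c.dressed K lam l 0 1 *ᵥ ketDown N =
      (K 0 1 * (l.map fun n => lam ^ 2 - (c.ξ n + c.η / 2) ^ 2).prod) • ketDown N := by
  induction l with
  | nil => simp [dressed, auxOp, Matrix.smul_mulVec]
  | cons n l ih =>
    rw [List.nodup_cons] at hl
    have hL := fun u i j => c.rAux_mulVec_single (fun _ => 1) n u i j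
    have hcm := fun u i j => (c.commute_rAux (n := n)
      (fun k r => c.dressed_commute_permAux K hl.1 lam i 1 k r) u 0 j).eq.symm
    have ih := ih hl.2
    have e : Function.update (fun _ : Fin N => (1 : Fin 2)) n 1 = fun _ => 1 :=
      Function.update_eq_self n _
    rw [dressed_cons_apply01]
    unfold ketDown at *
    simp only [Fin.sum_univ_two, Matrix.add_mulVec, hcm]
    simp only [← Matrix.mulVec_mulVec, hL]
    simp only [e, if_true, if_false, Fin.isValue, zero_ne_one, one_ne_zero, smul_zero, add_zero,
      Matrix.mulVec_zero, ← add_smul, Matrix.mulVec_smul, hL, ih, smul_smul]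
    rw [List.map_cons, List.prod_cons, zero_add]
    congr 1
    ring

end Vacuum

/-! ### Eigenvectors and operators flipping one label -/

section States

variable {N : ℕ}

/-- A chain whose gauge matrix is nonsingular, with `b̄₋ ≠ 0` and generic inhomogeneities: the
assumptions under which the eigenvectors of `B̄₋` form dual bases. -/
structure Generic (c : OpenXXX N) : Prop where
  η : c.η ≠ 0
  ζm : c.ζm ≠ 0
  κm : 1 + 4 * c.κm ^ 2 ≠ 0
  κm0 : c.κm = 0 → c.εm = 1
  W : c.W.det ≠ 0
  b : c.bConst ≠ 0
  ξ : ∀ j, c.ξ j ≠ 0 ∧ c.ξ j ≠ c.η ∧ c.ξ j ≠ -c.η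
  ξ2 : ∀ j, 2 * c.ξ j ≠ c.η ∧ 2 * c.ξ j ≠ -c.η
  add : ∀ j k, j ≠ k → c.ξ j + c.ξ k ≠ 0 ∧ c.ξ j + c.ξ k ≠ c.η ∧ c.ξ j + c.ξ k ≠ -c.η
  sub : ∀ j k, j ≠ k → c.ξ j - c.ξ k ≠ 0 ∧ c.ξ j - c.ξ k ≠ c.η ∧ c.ξ j - c.ξ k ≠ -c.η
  gm : ∀ j, c.ξ j ≠ c.zetaBarM ∧ c.ξ j ≠ -c.zetaBarM

variable {c : OpenXXX N}

theorem Generic.uBar_eq (hc : c.Generic) (lam : ℂ) :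
    c.uBar lam = c.dressed (c.kBar lam) lam (sites N) := c.uBar_eq_dressed hc.W lam

theorem Generic.kBar_eq (hc : c.Generic) (lam : ℂ) :
    c.kBar lam = !![1 + (lam - c.η / 2) * (1 / c.zetaBarM),
        (lam - c.η / 2) * (c.bConst / c.zetaBarM);
      (lam - c.η / 2) * 0, 1 - (lam - c.η / 2) * (1 / c.zetaBarM)] :=
  OpenXXX.kBar_eq c hc.ζm hc.κm hc.κm0 hc.W lam

theorem Generic.kBar01 (hc : c.Generic) (lam : ℂ) :
    c.kBar lam 0 1 = (lam - c.η / 2) * (c.bConst / c.zetaBarM) := by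
  rw [hc.kBar_eq]; simp

theorem Generic.zetaBarM_ne_zero (hc : c.Generic) : c.zetaBarM ≠ 0 :=
  OpenXXX.zetaBarM_ne_zero c hc.ζm hc.κm

theorem Generic.reflection (hc : c.Generic) (lam mu : ℂ) :
    Reflection c.η (lam - mu) (lam + mu - c.η) (c.uBar lam) (c.uBar mu) := by
  rw [hc.uBar_eq, hc.uBar_eq]
  refine c.reflection_dressed nodup_sites ?_
  rw [hc.kBar_eq, hc.kBar_eq]
  convert reflection_boundary (R := Op N) c.η (lam - c.η / 2) (mu - c.η / 2) (1 / c.zetaBarM)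
    (c.bConst / c.zetaBarM) 0 using 1 <;> first | rfl | ring

theorem Generic.crossing (hc : c.Generic) (lam : ℂ) :
    Crossing c.η lam (c.uBar lam) (c.uBar (-lam)) := by
  rw [hc.uBar_eq, hc.uBar_eq]
  refine c.crossing_dressed nodup_sites ?_
  rw [hc.kBar_eq, hc.kBar_eq, Crossing]
  ext1 i j
  fin_cases i <;> fin_cases j <;> simp [auxOp] <;> module

theorem Generic.continuous_uBar (hc : c.Generic) : Continuous c.uBar := by
  have hr : ∀ (n : Fin N) (a : ℂ), Continuous fun lam : ℂ => rAux c.η n (lam + a) := by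
    intro n a
    simp only [rAux_eq_lax, lax]
    fun_prop
  have hK : Continuous fun lam => auxOp N (c.kBar lam) := by
    refine continuous_matrix fun i j => ?_
    have : Continuous fun lam => c.kBar lam i j := by
      simp only [hc.kBar_eq]
      fin_cases i <;> fin_cases j <;> simp <;> fun_prop
    simp only [auxOp, Matrix.map_apply]
    fun_prop
  have : c.uBar = fun lam => c.dressed (c.kBar lam) lam (sites N) := funext hc.uBar_eq
  rw [this]
  generalize sites N = l
  induction l with
  | nil => exact hK
  | cons n l ih =>
    simp only [dressed]
    have h1 := hr n (-c.ξ n - c.η / 2)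
    have h2 := hr n (c.ξ n - c.η / 2)
    simp only [← add_sub_assoc, ← sub_eq_add_neg] at h1 h2
    exact (h1.matrix_mul ih).matrix_mul h2

theorem Generic.continuous_opB (hc : c.Generic) : Continuous c.opB :=
  hc.continuous_uBar.matrix_elem 0 1

/-- A continuous identity which holds up to the factor `λ² - r²` holds everywhere. -/
theorem eq_of_smul_sq_sub_sq {E : Type*} [AddCommGroup E] [Module ℂ E] [TopologicalSpace E]
    [T2Space E] {p q : ℂ → E} (hp : Continuous p) (hq : Continuous q) (r : ℂ)
    (h : ∀ lam : ℂ, (lam ^ 2 - r ^ 2) • p lam = (lam ^ 2 - r ^ 2) • q lam) : p = q := by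
  have hd : Dense (({r, -r} : Set ℂ)ᶜ) :=
    (Set.toFinite _).countable.dense_compl ℂ
  refine Continuous.ext_on hd hp hq fun lam hlam => ?_
  simp only [Set.mem_compl_iff, Set.mem_insert_iff, Set.mem_singleton_iff, not_or] at hlam
  refine smul_right_injective E (r := lam ^ 2 - r ^ 2) ?_ (h lam)
  rw [sq_sub_sq]
  exact mul_ne_zero (fun h => hlam.2 (by linear_combination h)) (sub_ne_zero.2 hlam.1)

variable (c) in
/-- The eigenvalue of `B̄₋(λ) / b̄₋(λ)` attached to the configuration `h`. -/
noncomputable def eig (h : Conf N) (lam : ℂ) : ℂ := ∏ n, (lam ^ 2 - c.xiH n (h n) ^ 2)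

theorem xiH_zero (n : Fin N) : c.xiH n 0 = c.ξ n + c.η / 2 := by simp [xiH]

theorem xiH_one (n : Fin N) : c.xiH n 1 = c.ξ n - c.η / 2 := by simp [xiH]; ring

theorem continuous_eig (h : Conf N) : Continuous (c.eig h) := by
  unfold eig
  fun_prop

theorem eig_eq_zero {h : Conf N} {lam : ℂ} (n : Fin N) (hn : lam ^ 2 = c.xiH n (h n) ^ 2) :
    c.eig h lam = 0 :=
  Finset.prod_eq_zero (Finset.mem_univ n) (by rw [hn, sub_self])

theorem eig_eq_mul (h : Conf N) (n : Fin N) (lam : ℂ) :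
    c.eig h lam = (lam ^ 2 - c.xiH n (h n) ^ 2) *
      ∏ m ∈ Finset.univ.erase n, (lam ^ 2 - c.xiH m (h m) ^ 2) :=
  (Finset.mul_prod_erase _ _ (Finset.mem_univ n)).symm

theorem eig_update (h : Conf N) (n : Fin N) (j : Fin 2) (lam : ℂ) :
    c.eig (Function.update h n j) lam = (lam ^ 2 - c.xiH n j ^ 2) *
      ∏ m ∈ Finset.univ.erase n, (lam ^ 2 - c.xiH m (h m) ^ 2) := by
  rw [eig_eq_mul _ n, Function.update_self]
  congr 1
  refine Finset.prod_congr rfl fun m hm => ?_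
  rw [Function.update_of_ne (Finset.ne_of_mem_erase hm)]

variable (c) in
/-- `v` is a left eigenvector of all `B̄₋(λ)`, with the eigenvalues attached to `h`. -/
def EigL (h : Conf N) (v : Vec N) : Prop :=
  ∀ lam, v ᵥ* c.opB lam = (c.kBar lam 0 1 * c.eig h lam) • v

variable (c) in
/-- `v` is a right eigenvector of all `B̄₋(λ)`, with the eigenvalues attached to `h`. -/
def EigR (h : Conf N) (v : Vec N) : Prop :=
  ∀ lam, c.opB lam *ᵥ v = (c.kBar lam 0 1 * c.eig h lam) • v

theorem EigL.vecMul_eq_zero {h : Conf N} {v : Vec N} (hv : c.EigL h v) (n : Fin N) {lam : ℂ}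
    (hn : lam ^ 2 = c.xiH n (h n) ^ 2) : v ᵥ* c.opB lam = 0 := by
  rw [hv, eig_eq_zero n hn, mul_zero, zero_smul]

theorem EigR.mulVec_eq_zero {h : Conf N} {v : Vec N} (hv : c.EigR h v) (n : Fin N) {lam : ℂ}
    (hn : lam ^ 2 = c.xiH n (h n) ^ 2) : c.opB lam *ᵥ v = 0 := by
  rw [hv, eig_eq_zero n hn, mul_zero, zero_smul]

theorem Generic.continuous_kBar01 (hc : c.Generic) : Continuous fun lam => c.kBar lam 0 1 := by
  simp only [hc.kBar01]
  fun_prop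

theorem Generic.opA_mul_opB (hc : c.Generic) (lam mu : ℂ) :
    (lam ^ 2 - mu ^ 2) • (c.opA mu * c.opB lam) =
      (lam ^ 2 - (mu - c.η) ^ 2) • (c.opB lam * c.opA mu) -
        c.η • (c.opB mu * ((lam - mu) • c.opD lam + (lam + mu - c.η) • c.opA lam)) := by
  have := (hc.reflection lam mu).entry00_mul_entry01
  unfold opA opB opD
  convert this using 3 <;> ring

theorem Generic.opB_mul_opD (hc : c.Generic) (lam mu : ℂ) :
    (lam ^ 2 - mu ^ 2) • (c.opB lam * c.opD mu) =
      (lam ^ 2 - (mu - c.η) ^ 2) • (c.opD mu * c.opB lam) -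
        c.η • (((lam - mu) • c.opA lam + (lam + mu - c.η) • c.opD lam) * c.opB mu) := by
  have := (hc.reflection lam mu).entry01_mul_entry11
  unfold opA opB opD
  convert this using 3 <;> ring

/-- `Ā₋(η/2 - ξ_n)` lowers the label of site `n` of a left eigenvector from `1` to `0`. -/
theorem EigL.vecMul_opA (hc : c.Generic) {h : Conf N} {v : Vec N} (hv : c.EigL h v) {n : Fin N}
    (hn : h n = 1) : c.EigL (Function.update h n 0) (v ᵥ* c.opA (c.η / 2 - c.ξ n)) := by
  -- The unwanted term of the exchange relation starts with `B̄₋` at a zero of its eigenvalue.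
  have hz : v ᵥ* c.opB (c.η / 2 - c.ξ n) = 0 :=
    hv.vecMul_eq_zero n (by rw [hn, xiH_one]; ring)
  refine congrFun (eq_of_smul_sq_sub_sq (r := c.xiH n 1) ?_ ?_ fun lam => ?_)
  · exact Continuous.matrix_vecMul continuous_const hc.continuous_opB
  · exact (hc.continuous_kBar01.mul (continuous_eig _)).smul continuous_const
  · have h1 := congrArg (v ᵥ* ·) (hc.opA_mul_opB lam (c.η / 2 - c.ξ n))
    simp only [Matrix.vecMul_smul, Matrix.vecMul_sub, ← Matrix.vecMul_vecMul, hz,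
      Matrix.zero_vecMul, smul_zero, sub_zero, hv lam, Matrix.smul_vecMul, smul_smul] at h1
    rw [xiH_one, eig_update, xiH_zero, smul_smul]
    rw [eig_eq_mul h n, hn, xiH_one] at h1
    convert h1 using 2 <;> ring

/-- `D̄₋(ξ_n + η/2)` raises the label of site `n` of a right eigenvector from `0` to `1`. -/
theorem EigR.opD_mulVec (hc : c.Generic) {h : Conf N} {v : Vec N} (hv : c.EigR h v) {n : Fin N}
    (hn : h n = 0) : c.EigR (Function.update h n 1) (c.opD (c.ξ n + c.η / 2) *ᵥ v) := by
  have hz : c.opB (c.ξ n + c.η / 2) *ᵥ v = 0 :=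
    hv.mulVec_eq_zero n (by rw [hn, xiH_zero])
  refine congrFun (eq_of_smul_sq_sub_sq (r := c.xiH n 0) ?_ ?_ fun lam => ?_)
  · exact Continuous.matrix_mulVec hc.continuous_opB continuous_const
  · exact (hc.continuous_kBar01.mul (continuous_eig _)).smul continuous_const
  · have h1 := congrArg (· *ᵥ v) (hc.opB_mul_opD lam (c.ξ n + c.η / 2))
    simp only [Matrix.smul_mulVec, Matrix.sub_mulVec, ← Matrix.mulVec_mulVec, hz,
      Matrix.mulVec_zero, smul_zero, sub_zero, hv lam, Matrix.mulVec_smul, smul_smul] at h1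
    rw [xiH_zero, eig_update, xiH_one, smul_smul]
    rw [eig_eq_mul h n, hn, xiH_zero] at h1
    convert h1 using 2; ring

/-- The operators lowering different labels commute on left eigenvectors: the reflection equation
expresses their commutator through operators starting with `B̄₋` at a zero of its eigenvalue. -/
theorem EigL.opA_comm (hc : c.Generic) {h : Conf N} {v : Vec N} (hv : c.EigL h v) {n m : Fin N}
    (hnm : n ≠ m) (hn : h n = 1) (hm : h m = 1) :
    v ᵥ* c.opA (c.η / 2 - c.ξ n) ᵥ* c.opA (c.η / 2 - c.ξ m) =
      v ᵥ* c.opA (c.η / 2 - c.ξ m) ᵥ* c.opA (c.η / 2 - c.ξ n) := by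
  have hz : v ᵥ* c.opB (c.η / 2 - c.ξ n) = 0 :=
    hv.vecMul_eq_zero n (by rw [hn, xiH_one]; ring)
  have hz' : v ᵥ* c.opB (c.η / 2 - c.ξ m) = 0 :=
    hv.vecMul_eq_zero m (by rw [hm, xiH_one]; ring)
  have h1 := congrArg (v ᵥ* ·)
    (hc.reflection (c.η / 2 - c.ξ n) (c.η / 2 - c.ξ m)).entry00_mul_entry00
  unfold opB at hz hz'
  simp only [Matrix.vecMul_smul, Matrix.vecMul_sub, ← Matrix.vecMul_vecMul, hz, hz',
    Matrix.zero_vecMul, smul_zero, sub_self] at h1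
  rw [smul_eq_zero] at h1
  rcases h1 with h1 | h1
  · exfalso
    refine mul_ne_zero (fun h2 => (hc.sub n m hnm).2.1 ?_) (fun h2 => (hc.add n m hnm).2.1 ?_) h1
    · linear_combination -h2
    · linear_combination -h2
  · exact sub_eq_zero.1 h1

/-- The operators raising different labels commute on right eigenvectors. -/
theorem EigR.opD_comm (hc : c.Generic) {h : Conf N} {v : Vec N} (hv : c.EigR h v) {n m : Fin N}
    (hnm : n ≠ m) (hn : h n = 0) (hm : h m = 0) :
    c.opD (c.ξ n + c.η / 2) *ᵥ c.opD (c.ξ m + c.η / 2) *ᵥ v =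
      c.opD (c.ξ m + c.η / 2) *ᵥ c.opD (c.ξ n + c.η / 2) *ᵥ v := by
  have hz : c.opB (c.ξ n + c.η / 2) *ᵥ v = 0 :=
    hv.mulVec_eq_zero n (by rw [hn, xiH_zero])
  have hz' : c.opB (c.ξ m + c.η / 2) *ᵥ v = 0 :=
    hv.mulVec_eq_zero m (by rw [hm, xiH_zero])
  have h1 := congrArg (· *ᵥ v)
    (hc.reflection (c.ξ n + c.η / 2) (c.ξ m + c.η / 2)).entry11_mul_entry11
  unfold opB at hz hz'
  simp only [Matrix.smul_mulVec, Matrix.sub_mulVec, ← Matrix.mulVec_mulVec, hz, hz',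
    Matrix.mulVec_zero, smul_zero, sub_self] at h1
  rw [smul_eq_zero] at h1
  rcases h1 with h1 | h1
  · exfalso
    refine mul_ne_zero (fun h2 => (hc.sub n m hnm).2.2 ?_) (fun h2 => (hc.add n m hnm).2.2 ?_) h1
    · linear_combination h2
    · linear_combination h2
  · exact sub_eq_zero.1 h1

end States

/-! ### The separated states and their matrix elements -/

section SoV

variable {N : ℕ}

/-- States built by applying operators `T n`, each of which changes the label of site `n` from `a`
to `b`: the result carries the prescribed labels, and by commutativity any of the operators can be
taken to act last. -/
theorem foldr_labels {V : Type*} (T : Fin N → V → V) (P : Conf N → V → Prop) (a b : Fin 2)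
    (hT : ∀ h v n, P h v → h n = a → P (Function.update h n b) (T n v))
    (hcomm : ∀ h v n m, n ≠ m → P h v → h n = a → h m = a → T n (T m v) = T m (T n v))
    (hab : ∀ j, j ≠ b → j = a) (hab' : a ≠ b)
    {v₀ : V} (h₀ : P (fun _ => a) v₀) {l : List (Fin N)} (hl : l.Nodup) (h : Conf N) :
    P (fun m => if m ∈ l then h m else a)
        (l.foldr (fun n v => if h n = b then T n v else v) v₀) ∧
      ∀ n ∈ l, h n = b → l.foldr (fun n v => if h n = b then T n v else v) v₀ =
        T n (l.foldr (fun m v => if Function.update h n a m = b then T m v else v) v₀) := by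
  -- The first part is also needed for shorter lists and for the configuration with `n` reset.
  have key : ∀ (h : Conf N) {l : List (Fin N)}, l.Nodup →
      P (fun m => if m ∈ l then h m else a)
        (l.foldr (fun n v => if h n = b then T n v else v) v₀) := by
    intro h l hl
    induction l with
    | nil => simpa using h₀
    | cons n l ih =>
      rw [List.nodup_cons] at hl
      have ih := ih hl.2
      rw [List.foldr_cons]
      split_ifs with hn
      · have := hT _ _ n ih (by simp [hl.1])
        convert this using 1
        ext1 m
        by_cases hm : m = n
        · subst hm; simp [hn]
        · simp [hm]
      · convert ih using 1
        ext1 m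
        by_cases hm : m = n
        · subst hm; simp [hl.1, hab _ hn]
        · simp [hm]
  refine ⟨key h hl, ?_⟩
  intro n hnl hn
  induction l with
  | nil => simp at hnl
  | cons m l ih =>
    rw [List.nodup_cons] at hl
    rw [List.foldr_cons, List.foldr_cons]
    by_cases hmn : m = n
    · subst hmn
      rw [if_pos hn, Function.update_self, if_neg hab']
      congr 1
      refine List.foldr_ext _ _ _ fun k hk v => ?_
      rw [Function.update_of_ne (by rintro rfl; exact hl.1 hk)]
    · have hnl' : n ∈ l := (List.mem_cons.1 hnl).resolve_left (Ne.symm hmn)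
      rw [ih hl.2 hnl', Function.update_of_ne hmn]
      split_ifs with hm
      · exact hcomm _ _ m n hmn (key (Function.update h n a) hl.2) (by simp [hl.1])
          (by simp [hnl'])
      · rfl

variable (c : OpenXXX N)

theorem vecMul_prod_map {M : Type*} [Fintype M] [DecidableEq M] {ι : Type*}
    (F : ι → Matrix M M ℂ) (v : M → ℂ) (l : List ι) :
    v ᵥ* (l.map F).prod = l.reverse.foldr (fun n v => v ᵥ* F n) v := by
  rw [List.foldr_reverse]
  induction l generalizing v with
  | nil => simp
  | cons n l ih =>
    rw [List.map_cons, List.prod_cons, ← Matrix.vecMul_vecMul, ih]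
    rfl

theorem prod_map_mulVec {M : Type*} [Fintype M] [DecidableEq M] {ι : Type*}
    (F : ι → Matrix M M ℂ) (v : M → ℂ) (l : List ι) :
    (l.map F).prod *ᵥ v = l.foldr (fun n v => F n *ᵥ v) v := by
  induction l with
  | nil => simp
  | cons n l ih =>
    rw [List.map_cons, List.prod_cons, ← Matrix.mulVec_mulVec, ih]
    rfl

/-- The normalized operator `Ā₋(η/2 - ξ_n) / A₋(η/2 - ξ_n)`, from which `⟨h₋|` is built. -/
noncomputable def normA (n : Fin N) : Op N :=
  (c.aMinus (c.η / 2 - c.ξ n))⁻¹ • c.opA (c.η / 2 - c.ξ n)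

/-- The normalized operator `D̄₋(ξ_n + η/2) / (k_n A₋(η/2 - ξ_n))`, from which `|h₋⟩` is built. -/
noncomputable def normD (n : Fin N) : Op N :=
  (c.kCoef n * c.aMinus (c.η / 2 - c.ξ n))⁻¹ • c.opD (c.ξ n + c.η / 2)

theorem braSoV_eq_foldr (h : Conf N) : c.braSoV h =
    (sites N).foldr (fun n v => if h n = 0 then v ᵥ* c.normA n else v) (bra0 N) := by
  rw [braSoV, List.ofFn_eq_map, vecMul_prod_map, sites]
  congr 1
  ext1 n
  ext1 v
  rcases Fin.exists_fin_two.1 ⟨h n, rfl⟩ with hn | hn <;> simp [hn, normA]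

theorem ketSoV_eq_foldr (h : Conf N) : c.ketSoV h =
    (List.finRange N).foldr (fun n v => if h n = 1 then c.normD n *ᵥ v else v) (ketDown N) := by
  rw [ketSoV, List.ofFn_eq_map, prod_map_mulVec]
  congr 1
  ext1 n
  ext1 v
  rcases Fin.exists_fin_two.1 ⟨h n, rfl⟩ with hn | hn <;> simp [hn, normD]

variable {c}

theorem EigL.smul {h : Conf N} {v : Vec N} (hv : c.EigL h v) (r : ℂ) : c.EigL h (r • v) := by
  intro lam
  rw [Matrix.smul_vecMul, hv lam, smul_comm]

theorem EigR.smul {h : Conf N} {v : Vec N} (hv : c.EigR h v) (r : ℂ) : c.EigR h (r • v) := by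
  intro lam
  rw [Matrix.mulVec_smul, hv lam, smul_comm]

theorem prod_map_sites {f : Fin N → ℂ} : ((sites N).map f).prod = ∏ n, f n := by
  rw [sites, List.map_reverse, List.prod_reverse, ← List.ofFn_eq_map, List.prod_ofFn]

theorem Generic.eigL_bra0 (hc : c.Generic) : c.EigL (fun _ => 1) (bra0 N) := by
  intro lam
  rw [opB, hc.uBar_eq, c.bra0_vecMul_dressed _ _ nodup_sites, prod_map_sites]
  simp only [eig, xiH_one]

theorem Generic.eigR_ketDown (hc : c.Generic) : c.EigR (fun _ => 0) (ketDown N) := by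
  intro lam
  rw [opB, hc.uBar_eq, c.dressed_mulVec_ketDown _ _ nodup_sites, prod_map_sites]
  simp only [eig, xiH_zero]

/-- `⟨h₋|` is a left eigenvector with label `h`, and the factor of any site may be applied last. -/
theorem Generic.braSoV_labels (hc : c.Generic) (h : Conf N) :
    c.EigL h (c.braSoV h) ∧
      ∀ n, h n = 0 → c.braSoV h = c.braSoV (Function.update h n 1) ᵥ* c.normA n := by
  have := foldr_labels (fun n v => v ᵥ* c.normA n) c.EigL 1 0
    (fun h v n hv hn => by
      simp only [normA, Matrix.vecMul_smul]
      exact (hv.vecMul_opA hc hn).smul _)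
    (fun _ v n m hnm hv hn hm => by
      simp only [normA, Matrix.vecMul_smul, Matrix.smul_vecMul]
      rw [hv.opA_comm hc hnm hn hm, smul_comm])
    (by decide) (by decide) hc.eigL_bra0 nodup_sites h
  simp only [← braSoV_eq_foldr] at this
  have hs : ∀ n : Fin N, n ∈ sites N := fun n => by simp [sites]
  simp only [hs, if_true] at this
  exact ⟨this.1, fun n => this.2 n trivial⟩

/-- `|h₋⟩` is a right eigenvector with label `h`, and the factor of any site may be applied last. -/
theorem Generic.ketSoV_labels (hc : c.Generic) (h : Conf N) :
    c.EigR h (c.ketSoV h) ∧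
      ∀ n, h n = 1 → c.ketSoV h = c.normD n *ᵥ c.ketSoV (Function.update h n 0) := by
  have := foldr_labels (fun n v => c.normD n *ᵥ v) c.EigR 0 1
    (fun h v n hv hn => by
      simp only [normD, Matrix.smul_mulVec]
      exact (hv.opD_mulVec hc hn).smul _)
    (fun h v n m hnm hv hn hm => by
      simp only [normD, Matrix.mulVec_smul, Matrix.smul_mulVec]
      rw [hv.opD_comm hc hnm hn hm, smul_comm])
    (by decide) (by decide) hc.eigR_ketDown (List.nodup_finRange N) h
  simp only [← ketSoV_eq_foldr] at this
  simp only [List.mem_finRange, if_true] at this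
  exact ⟨this.1, fun n => this.2 n trivial⟩

theorem Generic.xiH_sq_ne (hc : c.Generic) {n m : Fin N} (hnm : n ≠ m) (i j : Fin 2) :
    c.xiH n i ^ 2 ≠ c.xiH m j ^ 2 := by
  obtain ⟨a1, a2, a3⟩ := hc.add n m hnm
  obtain ⟨s1, s2, s3⟩ := hc.sub n m hnm
  intro h
  rw [sq_eq_sq_iff_eq_or_eq_neg] at h
  rcases h with h | h <;>
  rcases Fin.exists_fin_two.1 ⟨i, rfl⟩ with hi | hi <;>
  rcases Fin.exists_fin_two.1 ⟨j, rfl⟩ with hj | hj <;>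
  rw [hi, hj] at h <;> simp only [xiH_zero, xiH_one] at h
  · exact s1 (by linear_combination h)
  · exact s3 (by linear_combination h)
  · exact s2 (by linear_combination h)
  · exact s1 (by linear_combination h)
  · exact a3 (by linear_combination h)
  · exact a1 (by linear_combination h)
  · exact a1 (by linear_combination h)
  · exact a2 (by linear_combination h)

theorem Generic.xiH_zero_sq_ne (hc : c.Generic) (n : Fin N) : c.xiH n 0 ^ 2 ≠ c.xiH n 1 ^ 2 := by
  rw [xiH_zero, xiH_one]
  intro h
  have : c.ξ n * c.η = 0 := by linear_combination h / 2
  exact mul_ne_zero (hc.ξ n).1 hc.η this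

theorem Generic.kBar01_xiH_ne (hc : c.Generic) (n : Fin N) (i : Fin 2) :
    c.kBar (c.xiH n i) 0 1 ≠ 0 := by
  rw [hc.kBar01]
  refine mul_ne_zero (fun h => ?_) (div_ne_zero hc.b hc.zetaBarM_ne_zero)
  rcases Fin.exists_fin_two.1 ⟨i, rfl⟩ with hi | hi <;> rw [hi] at h <;>
    simp only [xiH_zero, xiH_one] at h
  · exact (hc.ξ n).1 (by linear_combination h)
  · exact (hc.ξ n).2.1 (by linear_combination h)

theorem Generic.prod_erase_ne (hc : c.Generic) (h : Conf N) (n : Fin N) (i : Fin 2) :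
    ∏ m ∈ Finset.univ.erase n, (c.xiH n i ^ 2 - c.xiH m (h m) ^ 2) ≠ 0 :=
  Finset.prod_ne_zero_iff.2 fun _ hm =>
    sub_ne_zero.2 (hc.xiH_sq_ne (Finset.ne_of_mem_erase hm).symm _ _)

/-- Left and right eigenvectors with different labels are orthogonal. -/
theorem EigL.dotProduct_eq_zero (hc : c.Generic) {h k : Conf N} {v w : Vec N} (hv : c.EigL h v)
    (hw : c.EigR k w) (hhk : h ≠ k) : v ⬝ᵥ w = 0 := by
  obtain ⟨n, hn⟩ := Function.ne_iff.1 hhk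
  have h1 : (v ᵥ* c.opB (c.xiH n (h n))) ⬝ᵥ w = v ⬝ᵥ (c.opB (c.xiH n (h n)) *ᵥ w) :=
    (Matrix.dotProduct_mulVec _ _ _).symm
  rw [hv.vecMul_eq_zero n rfl, hw, zero_dotProduct, dotProduct_smul, smul_eq_mul] at h1
  refine (mul_eq_zero.1 h1.symm).resolve_left (mul_ne_zero (hc.kBar01_xiH_ne n _) ?_)
  rw [eig_eq_mul k n]
  refine mul_ne_zero (sub_ne_zero.2 ?_) (hc.prod_erase_ne k n _)
  have hne := hc.xiH_zero_sq_ne n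
  rcases Fin.exists_fin_two.1 ⟨h n, rfl⟩ with hi | hi <;>
  rcases Fin.exists_fin_two.1 ⟨k n, rfl⟩ with hj | hj <;> rw [hi, hj] at hn ⊢
  · exact absurd rfl hn
  · exact hne
  · exact hne.symm
  · exact absurd rfl hn

/-- Between eigenvectors whose labels differ at `n`, the matrix element of `D̄₋(ξ_n + η/2)` is
determined by that of `Ā₋(η/2 - ξ_n)`, because of the exchange relation with `B̄₋` and the crossing
symmetry. -/
theorem EigL.opD_ratio (hc : c.Generic) {k : Conf N} {v w : Vec N} {n : Fin N}
    (hv : c.EigL (Function.update k n 1) v) (hw : c.EigR k w) (hk : k n = 0) :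
    (v ⬝ᵥ (c.opD (c.ξ n + c.η / 2) *ᵥ w)) *
        ∏ m ∈ Finset.univ.erase n, (c.xiH n 1 ^ 2 - c.xiH m (k m) ^ 2) =
      c.kCoef n * (v ⬝ᵥ (c.opA (c.η / 2 - c.ξ n) *ᵥ w)) *
        ∏ m ∈ Finset.univ.erase n, (c.xiH n 0 ^ 2 - c.xiH m (k m) ^ 2) := by
  obtain ⟨Φ, hΦ⟩ : ∃ Φ : ℂ → ℂ, Φ = fun lam => v ⬝ᵥ (c.opA lam *ᵥ w) := ⟨_, rfl⟩
  obtain ⟨Ψ, hΨ⟩ : ∃ Ψ : ℂ → ℂ, Ψ = fun lam => v ⬝ᵥ (c.opD lam *ᵥ w) := ⟨_, rfl⟩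
  obtain ⟨G, hG⟩ : ∃ G : ℂ → ℂ, G = fun x => ∏ m ∈ Finset.univ.erase n,
    (x - c.xiH m (k m) ^ 2) := ⟨_, rfl⟩
  have hG0 : G ((c.ξ n + c.η / 2) ^ 2) ≠ 0 := by
    rw [hG, ← xiH_zero]; exact hc.prod_erase_ne k n 0
  set β := c.bConst / c.zetaBarM with hβ
  have hβ0 : β ≠ 0 := div_ne_zero hc.b hc.zetaBarM_ne_zero
  -- The exchange relation of `Ā₋` and `B̄₋`, between `v` and `w`.
  have hS : ∀ lam mu : ℂ, (lam ^ 2 - mu ^ 2) *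
      (Φ mu * ((lam - c.η / 2) * β * ((lam ^ 2 - (c.ξ n + c.η / 2) ^ 2) * G (lam ^ 2)))) =
      (lam ^ 2 - (mu - c.η) ^ 2) *
        (((lam - c.η / 2) * β * ((lam ^ 2 - (c.ξ n - c.η / 2) ^ 2) * G (lam ^ 2))) * Φ mu) -
      c.η * (((mu - c.η / 2) * β * ((mu ^ 2 - (c.ξ n - c.η / 2) ^ 2) * G (mu ^ 2))) *
        ((lam - mu) * Ψ lam + (lam + mu - c.η) * Φ lam)) := by
    intro lam mu
    have h1 := congrArg (fun X => v ⬝ᵥ (X *ᵥ w)) (hc.opA_mul_opB lam mu)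
    have hvB : ∀ x, ∀ u : Vec N, v ⬝ᵥ (c.opB x *ᵥ u) = (c.kBar x 0 1 *
        c.eig (Function.update k n 1) x) * (v ⬝ᵥ u) := by
      intro x u
      rw [Matrix.dotProduct_mulVec, hv, smul_dotProduct, smul_eq_mul]
    simp only [Matrix.smul_mulVec, Matrix.sub_mulVec, ← Matrix.mulVec_mulVec, Matrix.add_mulVec,
      dotProduct_smul, dotProduct_sub, dotProduct_add, hvB, hw lam, Matrix.mulVec_smul,
      smul_eq_mul] at h1
    rw [eig_eq_mul k n, hk, eig_update, eig_update, hc.kBar01, hc.kBar01, xiH_zero, xiH_one] at h1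
    rw [hΦ, hΨ, hG]
    linear_combination h1
  -- The crossing symmetry, between `v` and `w`.
  have hC : ∀ lam : ℂ, 2 * lam * Ψ lam = (2 * lam - c.η) * Φ (-lam) + c.η * Φ lam := by
    intro lam
    have h1 := congrArg (fun X : AuxOp N => v ⬝ᵥ (X 0 0 *ᵥ w)) (hc.crossing lam)
    simp only [Matrix.add_apply, Matrix.smul_apply, Matrix.diagonal_apply_eq, Matrix.add_mulVec,
      Matrix.smul_mulVec, dotProduct_add, dotProduct_smul, smul_eq_mul] at h1
    rw [hΦ, hΨ]
    simp only [opA, opD]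
    linear_combination -h1
  have hη := hc.η
  have hξ := (hc.ξ n).1
  have hr1 : 2 * c.ξ n - c.η ≠ 0 := sub_ne_zero.2 (hc.ξ2 n).1
  have hr0 : 2 * c.ξ n + c.η ≠ 0 := fun h => (hc.ξ2 n).2 (by linear_combination h)
  have goal : Ψ (c.ξ n + c.η / 2) * G ((c.ξ n - c.η / 2) ^ 2) = c.kCoef n *
      Φ (c.η / 2 - c.ξ n) * G ((c.ξ n + c.η / 2) ^ 2) := by
    rw [kCoef]
    set ξ := c.ξ n
    set η := c.η
    have e1 : (-(η / 2 - ξ)) = ξ - η / 2 := by ring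
    have e2 : (η / 2 - ξ) ^ 2 = (ξ - η / 2) ^ 2 := by ring
    have e3 : (-(ξ + η / 2)) ^ 2 = (ξ + η / 2) ^ 2 := by ring
    -- The values of `Φ` and `Ψ` at the points `±(ξ + η/2)` and `±(ξ - η/2)` enter. The exchange
    -- relation at pairs of these points and the crossing symmetry eliminate all but two of them.
    have H1 : Φ (ξ - η / 2) = 0 := by
      have h := hS (ξ + η / 2) (ξ - η / 2)
      have : (2 * η * (2 * ξ - η)) * ((ξ * β * ((2 * ξ * η) * G ((ξ + η / 2) ^ 2)))) *
          Φ (ξ - η / 2) = 0 := by linear_combination -h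
      refine (mul_eq_zero.1 this).resolve_left ?_
      simp [hη, hr1, hξ, hβ0, hG0]
    have H2 := hC (η / 2 - ξ)
    rw [e1, H1] at H2
    have H3 := hS (η / 2 - ξ) (ξ + η / 2)
    have H4 := hS (η / 2 - ξ) (-(ξ + η / 2))
    have H5 := hC (ξ + η / 2)
    rw [e2] at H3 H4
    rw [e3] at H4
    generalize G ((ξ + η / 2) ^ 2) = G0 at *
    generalize G ((ξ - η / 2) ^ 2) = G1 at *
    generalize Φ (η / 2 - ξ) = P at *
    generalize Φ (ξ + η / 2) = P0 at *
    generalize Φ (-(ξ + η / 2)) = P1 at *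
    generalize Ψ (η / 2 - ξ) = Q at *
    generalize Ψ (ξ + η / 2) = Q0 at *
    have H3' : P0 * G1 = -G0 * Q := by
      have h : β * ξ ^ 3 * η ^ 2 ≠ 0 := by simp [hβ0, hξ, hη]
      apply mul_left_cancel₀ h
      linear_combination -H3 / 4
    have H4' : 2 * ξ ^ 2 * G1 * P1 = -(ξ + η) * G0 * (η * Q - (2 * ξ + η) * P) := by
      have h : β * ξ * η ^ 2 ≠ 0 := by simp [hβ0, hξ, hη]
      apply mul_left_cancel₀ h
      linear_combination -H4 / 2
    have h : (2 * ξ + η) * ξ ≠ 0 := mul_ne_zero hr0 hξ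
    rw [div_mul_eq_mul_div, div_mul_eq_mul_div, eq_div_iff hr1]
    apply mul_left_cancel₀ h
    linear_combination ξ * G1 * (2 * ξ - η) * H5 + (2 * ξ - η) * H4' + η * ξ * (2 * ξ - η) * H3' +
      η * (2 * ξ + η) * G0 * H2
  rw [hΨ, hG, hΦ] at goal
  rw [xiH_zero, xiH_one]
  exact goal

end SoV

/-! ### The grading by the number of down spins -/

section Grading

variable {N : ℕ}

/-- The number of down spins. -/
def downs (s : Conf N) : ℕ := ∑ n, (s n : ℕ)

/-- Operators whose matrix elements connect only configurations `s`, `t` for which `t` has exactly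
`k` more down spins than `s`. -/
def HasDegree (k : ℤ) (X : Op N) : Prop := ∀ s t, X s t ≠ 0 → (downs t : ℤ) = downs s + k

theorem HasDegree.add {k : ℤ} {X Y : Op N} (hX : HasDegree k X) (hY : HasDegree k Y) :
    HasDegree k (X + Y) := by
  intro s t h
  by_cases h1 : X s t = 0
  · exact hY s t fun h2 => h (by rw [Matrix.add_apply, h1, h2, add_zero])
  · exact hX s t h1

theorem HasDegree.smul {k : ℤ} {X : Op N} (hX : HasDegree k X) (r : ℂ) : HasDegree k (r • X) := by
  intro s t h
  exact hX s t fun h1 => h (by rw [Matrix.smul_apply, h1, smul_zero])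

theorem HasDegree.mul {k l : ℤ} {X Y : Op N} (hX : HasDegree k X) (hY : HasDegree l Y) :
    HasDegree (k + l) (X * Y) := by
  intro s t h
  rw [Matrix.mul_apply] at h
  obtain ⟨r, -, hr⟩ := Finset.exists_ne_zero_of_sum_ne_zero h
  rw [hY r t (right_ne_zero_of_mul hr), hX s r (left_ne_zero_of_mul hr)]
  ring

theorem hasDegree_one : HasDegree 0 (1 : Op N) := by
  intro s t h
  by_cases hst : s = t
  · rw [hst, add_zero]
  · exact absurd (Matrix.one_apply_ne hst) h

theorem hasDegree_zero (k : ℤ) : HasDegree k (0 : Op N) := fun _ _ h => absurd rfl h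

theorem hasDegree_permAux (n : Fin N) (i j : Fin 2) :
    HasDegree (((i : ℕ) : ℤ) - ((j : ℕ) : ℤ)) (permAux n i j) := by
  intro s t h
  rw [permAux_apply, siteOp, Matrix.of_apply] at h
  split_ifs at h with h1
  · rw [Matrix.single_apply] at h
    split_ifs at h with h2
    · have hs : downs s = s n + ∑ m ∈ Finset.univ.erase n, (s m : ℕ) :=
        (Finset.add_sum_erase _ _ (Finset.mem_univ n)).symm
      have ht : downs t = t n + ∑ m ∈ Finset.univ.erase n, (s m : ℕ) := by
        rw [downs, ← Finset.add_sum_erase _ _ (Finset.mem_univ n)]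
        congr 1
        exact Finset.sum_congr rfl fun m hm => by rw [h1 m (Finset.ne_of_mem_erase hm)]
      rw [hs, ht, ← h2.1, ← h2.2]
      push_cast
      ring
    · exact absurd rfl h
  · exact absurd rfl h

/-- Conservation of the total spin, including that of the auxiliary space. -/
def SpinConserving (M : AuxOp N) : Prop :=
  ∀ i j : Fin 2, HasDegree (((i : ℕ) : ℤ) - ((j : ℕ) : ℤ)) (M i j)

theorem SpinConserving.mul {X Y : AuxOp N} (hX : SpinConserving X) (hY : SpinConserving Y) :
    SpinConserving (X * Y) := by
  intro i j
  have h : ∀ k, HasDegree (((i : ℕ) : ℤ) - ((j : ℕ) : ℤ)) (X i k * Y k j) := fun k => by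
    have := (hX i k).mul (hY k j)
    rwa [sub_add_sub_cancel] at this
  rw [Matrix.mul_apply, Fin.sum_univ_two]
  exact (h 0).add (h 1)

theorem spinConserving_one : SpinConserving (1 : AuxOp N) := by
  intro i j
  by_cases h : i = j
  · subst h
    rw [sub_self, Matrix.one_apply_eq]
    exact hasDegree_one
  · rw [Matrix.one_apply_ne h]
    exact hasDegree_zero _

theorem spinConserving_rAux (η : ℂ) (n : Fin N) (u : ℂ) : SpinConserving (rAux η n u) := by
  intro i j
  rw [rAux_eq_lax, lax, Matrix.add_apply, Matrix.smul_apply, Matrix.smul_apply]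
  exact ((spinConserving_one i j).smul u).add ((hasDegree_permAux n i j).smul η)

theorem spinConserving_list_prod {l : List (AuxOp N)} (h : ∀ X ∈ l, SpinConserving X) :
    SpinConserving l.prod := by
  induction l with
  | nil => exact spinConserving_one
  | cons X l ih =>
    rw [List.prod_cons]
    exact (h X (by simp)).mul (ih fun Y hY => h Y (by simp [hY]))

theorem spinConserving_bulk (c : OpenXXX N) (l : List (Fin N)) (lam : ℂ) :
    SpinConserving (c.bulk l lam) :=
  spinConserving_list_prod fun X hX => by
    obtain ⟨n, -, rfl⟩ := List.mem_map.1 hX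
    exact spinConserving_rAux _ _ _

theorem spinConserving_bulkHat (c : OpenXXX N) (l : List (Fin N)) (lam : ℂ) :
    SpinConserving (c.bulkHat l lam) :=
  spinConserving_list_prod fun X hX => by
    obtain ⟨n, -, rfl⟩ := List.mem_map.1 hX
    exact spinConserving_rAux _ _ _

/-- In a matrix element of a product which has to create as many down spins as there are factors,
only the degree one part of each factor contributes. -/
theorem list_prod_top_degree {ι : Type*} {P Q : ι → Op N} (hP : ∀ n, HasDegree 1 (P n))
    (hQ : ∀ n, HasDegree 0 (Q n)) (l : List ι) (s t : Conf N) (h : downs s + l.length ≤ downs t) :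
    (l.map fun n => P n + Q n).prod s t = (l.map P).prod s t ∧
      (downs s + l.length < downs t → (l.map fun n => P n + Q n).prod s t = 0) := by
  induction l generalizing s with
  | nil =>
    refine ⟨rfl, fun h' => Matrix.one_apply_ne ?_⟩
    rintro rfl
    simp at h'
  | cons n l ih =>
    rw [List.length_cons] at h
    have hz : ∀ r, downs r = downs s → (l.map fun n => P n + Q n).prod r t = 0 :=
      fun r hr => (ih r (by omega)).2 (by omega)
    have hQz : ∀ r, Q n s r * (l.map fun n => P n + Q n).prod r t = 0 := by
      intro r
      by_cases hr : Q n s r = 0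
      · rw [hr, zero_mul]
      · have := hQ n s r hr
        rw [hz r (by omega), mul_zero]
    rw [List.map_cons, List.prod_cons, List.map_cons, List.prod_cons, List.length_cons]
    simp only [Matrix.mul_apply, Matrix.add_apply, add_mul, hQz, add_zero]
    constructor
    · refine Finset.sum_congr rfl fun r _ => ?_
      by_cases hr : P n s r = 0
      · rw [hr, zero_mul, zero_mul]
      · have := hP n s r hr
        rw [(ih r (by omega)).1]
    · intro h'
      refine Finset.sum_eq_zero fun r _ => ?_
      by_cases hr : P n s r = 0
      · rw [hr, zero_mul]
      · have := hP n s r hr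
        rw [(ih r (by omega)).2 (by omega), mul_zero]

end Grading

/-! ### The bulk operators `A` and `C` -/

section Bulk

variable {N : ℕ} (c : OpenXXX N)

theorem bulk_cons (n : Fin N) (l : List (Fin N)) (lam : ℂ) :
    c.bulk (n :: l) lam = rAux c.η n (lam - c.ξ n - c.η / 2) * c.bulk l lam := by
  simp [bulk]

theorem bra0_vecMul_bulk (lam : ℂ) (l : List (Fin N)) :
    bra0 N ᵥ* c.bulk l lam 0 0 = (l.map fun n => lam - c.ξ n + c.η / 2).prod • bra0 N := by
  induction l with
  | nil => simp [bulk]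
  | cons n l ih =>
    have hL := fun u i j => c.single_vecMul_rAux (fun _ => 0) n u i j
    have e : Function.update (fun _ : Fin N => (0 : Fin 2)) n 0 = fun _ => 0 :=
      Function.update_eq_self n _
    rw [bulk_cons, Matrix.mul_apply, Fin.sum_univ_two, Matrix.vecMul_add, ← Matrix.vecMul_vecMul,
      ← Matrix.vecMul_vecMul]
    unfold bra0 at *
    simp only [hL, e, if_true, if_false, Fin.isValue, zero_ne_one, smul_zero, add_zero,
      Matrix.zero_vecMul, ← add_smul, Matrix.smul_vecMul, ih, smul_smul]
    rw [List.map_cons, List.prod_cons]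
    congr 1
    ring

theorem bulk00_mulVec_single (lam : ℂ) {l : List (Fin N)} (hl : l.Nodup) {s : Conf N}
    (hs : ∀ n ∈ l, s n = 1) : c.bulk l lam 0 0 *ᵥ Pi.single s 1 =
      (l.map fun n => lam - c.ξ n - c.η / 2).prod • Pi.single s 1 := by
  induction l with
  | nil =>
    simp only [bulk, List.map_nil, List.prod_nil, Matrix.one_apply_eq, Matrix.one_mulVec, one_smul]
  | cons n l ih =>
    rw [List.nodup_cons] at hl
    have hcm := fun u i j => (c.commute_rAux (n := n)
      (fun k r => c.bulk_commute_permAux hl.1 lam j 0 k r) u i j).eq.symm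
    have hL := fun u i j => c.rAux_mulVec_single s n u i j
    have hn : s n = 1 := hs n (by simp)
    have ih := ih hl.2 fun m hm => hs m (by simp [hm])
    rw [bulk_cons, Matrix.mul_apply, Fin.sum_univ_two]
    simp only [hcm, Matrix.add_mulVec, ← Matrix.mulVec_mulVec, hL, hn, one_ne_zero, if_false,
      zero_ne_one, smul_zero, add_zero, if_true, Matrix.mulVec_zero, Matrix.mulVec_smul, ih,
      smul_smul]
    rw [List.map_cons, List.prod_cons]

/-- At `λ = ξ_n - η/2` the entry `1 0` of the monodromy flips exactly the site `n`, on
configurations which are down before `n` and up after `n`. -/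
theorem bulk10_mulVec_single (n : Fin N) {l₁ l₂ : List (Fin N)} (hl : (l₁ ++ n :: l₂).Nodup)
    {s : Conf N} (h₁ : ∀ m ∈ l₁, s m = 0) (hn : s n = 1) (h₂ : ∀ m ∈ l₂, s m = 1) :
    c.bulk (l₁ ++ n :: l₂) (c.ξ n - c.η / 2) 1 0 *ᵥ Pi.single s 1 =
      -((l₁ ++ n :: l₂).map fun m => c.ξ n - c.η / 2 - c.ξ m - c.η / 2).prod •
        Pi.single (Function.update s n 0) 1 := by
  induction l₁ with
  | nil =>
    rw [List.nil_append] at *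
    rw [List.nodup_cons] at hl
    have hcm := fun u i j => (c.commute_rAux (n := n)
      (fun k r => c.bulk_commute_permAux hl.1 (c.ξ n - c.η / 2) j 0 k r) u i j).eq.symm
    have hL := fun u i j => c.rAux_mulVec_single s n u i j
    have e : Function.update s n 1 = s := by rw [← hn]; exact Function.update_eq_self n s
    have h00 := c.bulk00_mulVec_single (c.ξ n - c.η / 2) hl.2 (s := Function.update s n 0)
      fun m hm => by
        rw [Function.update_of_ne (by rintro rfl; exact hl.1 hm), h₂ m hm]
    rw [bulk_cons, Matrix.mul_apply, Fin.sum_univ_two]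
    simp only [hcm, Matrix.add_mulVec, ← Matrix.mulVec_mulVec, hL, hn, one_ne_zero, if_false,
      smul_zero, zero_add, if_true, e, ← add_smul, Matrix.mulVec_smul, h00, smul_smul]
    rw [List.map_cons, List.prod_cons]
    have : c.ξ n - c.η / 2 - c.ξ n - c.η / 2 + c.η = 0 := by ring
    rw [this, zero_smul, add_zero]
    congr 1
    ring
  | cons m l₁ ih =>
    rw [List.cons_append] at *
    rw [List.nodup_cons] at hl
    have hcm := fun u i j => (c.commute_rAux (n := m)
      (fun k r => c.bulk_commute_permAux hl.1 (c.ξ n - c.η / 2) j 0 k r) u i j).eq.symm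
    have hL := fun u i j => c.rAux_mulVec_single s m u i j
    have hm : s m = 0 := h₁ m (by simp)
    have ih := ih hl.2 fun m hm => h₁ m (by simp [hm])
    rw [bulk_cons, Matrix.mul_apply, Fin.sum_univ_two]
    simp only [hcm, Matrix.add_mulVec, ← Matrix.mulVec_mulVec, hL, hm, one_ne_zero, if_false,
      zero_ne_one, smul_zero, add_zero, zero_add, if_true, Matrix.mulVec_zero,
      Matrix.mulVec_smul, ih, smul_smul]
    rw [List.map_cons, List.prod_cons]
    congr 1
    ring

/-- The entry `0 0` of the bulk monodromy matrix. -/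
noncomputable def bulkA (lam : ℂ) : Op N := c.bulk (sites N) lam 0 0

/-- The entry `1 0` of the bulk monodromy matrix. -/
noncomputable def bulkC (lam : ℂ) : Op N := c.bulk (sites N) lam 1 0

theorem bulkC_mul_bulkA (lam mu : ℂ) : (lam - mu) • (c.bulkC lam * c.bulkA mu) =
    (lam - mu + c.η) • (c.bulkA mu * c.bulkC lam) - c.η • (c.bulkA lam * c.bulkC mu) := by
  have := (c.rtt_bulk nodup_sites lam mu).comp 1 0 0 0
  unfold bulkA bulkC
  linear_combination (norm := module) this

theorem bra0_vecMul_bulkA (lam : ℂ) : bra0 N ᵥ* c.bulkA lam = c.a lam • bra0 N := by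
  rw [bulkA, bra0_vecMul_bulk, prod_map_sites, a]

theorem a_eq_zero (n : Fin N) : c.a (c.ξ n - c.η / 2) = 0 :=
  Finset.prod_eq_zero (Finset.mem_univ n) (by ring)

/-- The operators `A(λ)` can be moved to the left vacuum: no unwanted terms survive, because
`⟨0| A(ξ_m - η/2) = 0`. -/
theorem bra0_vecMul_prod_bulkC_bulkA (hξ : Function.Injective c.ξ) {l : List (Fin N)}
    (hl : l.Nodup) (lam : ℂ) (hlam : ∀ m ∈ l, c.ξ m - c.η / 2 ≠ lam) :
    bra0 N ᵥ* (l.map fun m => c.bulkC (c.ξ m - c.η / 2)).prod ᵥ* c.bulkA lam =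
      (c.a lam * (l.map fun m => (c.ξ m - c.η / 2 - lam + c.η) / (c.ξ m - c.η / 2 - lam)).prod) •
        (bra0 N ᵥ* (l.map fun m => c.bulkC (c.ξ m - c.η / 2)).prod) := by
  induction l using List.reverseRecOn generalizing lam with
  | nil => simp [bra0_vecMul_bulkA]
  | append_singleton l m ih =>
    rw [List.nodup_append_comm, List.singleton_append, List.nodup_cons] at hl
    have hm : c.ξ m - c.η / 2 - lam ≠ 0 := sub_ne_zero.2 (hlam m (by simp))
    have hz := ih hl.2 (c.ξ m - c.η / 2) fun k hk h =>
      hl.1 (hξ (sub_left_injective h) ▸ hk)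
    rw [a_eq_zero, zero_mul, zero_smul] at hz
    have ih := ih hl.2 lam fun k hk => hlam k (by simp [hk])
    simp only [List.map_append, List.prod_append, List.map_singleton, List.prod_singleton,
      ← Matrix.vecMul_vecMul]
    set w := bra0 N ᵥ* (l.map fun m => c.bulkC (c.ξ m - c.η / 2)).prod
    have h1 := congrArg (w ᵥ* ·) (c.bulkC_mul_bulkA (c.ξ m - c.η / 2) lam)
    simp only [Matrix.vecMul_smul, Matrix.vecMul_sub, ← Matrix.vecMul_vecMul, hz, ih,
      Matrix.zero_vecMul, smul_zero, sub_zero, Matrix.smul_vecMul, smul_smul] at h1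
    apply smul_right_injective _ hm
    simp only [h1, smul_smul]
    congr 1
    generalize (l.map fun m => (c.ξ m - c.η / 2 - lam + c.η) / (c.ξ m - c.η / 2 - lam)).prod = L
    generalize c.ξ m - c.η / 2 - lam = x at *
    field_simp

/-- All operators `A` can be moved to the left vacuum; the factor indexed by `m < n` comes from
moving the operator `A` of site `n` through the operator `C` of site `m`. -/
theorem bra0_vecMul_prod_bulkA_bulkC (hξ : Function.Injective c.ξ)
    (hadd : ∀ m n, m ≠ n → c.ξ m + c.ξ n ≠ c.η) {l : List (Fin N)} (hl : l.Pairwise (· < ·)) :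
    bra0 N ᵥ* (l.map fun n => c.bulkA (c.η / 2 - c.ξ n) * c.bulkC (c.ξ n - c.η / 2)).prod =
      (∏ n ∈ l.toFinset, c.a (c.η / 2 - c.ξ n) * ∏ m ∈ l.toFinset with m < n,
        (c.ξ m + c.ξ n) / (c.ξ m + c.ξ n - c.η)) •
        (bra0 N ᵥ* (l.map fun m => c.bulkC (c.ξ m - c.η / 2)).prod) := by
  induction l using List.reverseRecOn with
  | nil => simp
  | append_singleton l n ih =>
    rw [List.pairwise_append] at hl
    obtain ⟨hl, -, hln⟩ := hl
    have hln : ∀ m ∈ l, m < n := fun m hm => hln m hm n (by simp)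
    have hnl : n ∉ l.toFinset := fun h => lt_irrefl n (hln n (by simpa using h))
    have hnd : l.Nodup := hl.imp fun h => ne_of_lt h
    have hA := c.bra0_vecMul_prod_bulkC_bulkA hξ hnd (c.η / 2 - c.ξ n) fun m hm h =>
      hadd m n (hln m hm).ne (by linear_combination h)
    have hset : (l ++ [n]).toFinset = insert n l.toFinset := by ext; simp
    rw [hset, Finset.prod_insert hnl]
    have e1 : (insert n l.toFinset).filter (· < n) = l.toFinset := by
      ext k
      simp only [Finset.mem_filter, Finset.mem_insert, List.mem_toFinset]
      constructor
      · rintro ⟨rfl | h, h'⟩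
        · exact absurd h' (lt_irrefl _)
        · exact h
      · exact fun h => ⟨Or.inr h, hln k h⟩
    have e2 : ∀ k ∈ l.toFinset,
        (insert n l.toFinset).filter (· < k) = l.toFinset.filter (· < k) := by
      intro k hk
      rw [Finset.filter_insert, if_neg]
      exact fun h => lt_asymm h (hln k (by simpa using hk))
    have e3 : (∏ k ∈ l.toFinset, c.a (c.η / 2 - c.ξ k) *
          ∏ m ∈ insert n l.toFinset with m < k, (c.ξ m + c.ξ k) / (c.ξ m + c.ξ k - c.η)) =
        ∏ k ∈ l.toFinset, c.a (c.η / 2 - c.ξ k) *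
          ∏ m ∈ l.toFinset with m < k, (c.ξ m + c.ξ k) / (c.ξ m + c.ξ k - c.η) :=
      Finset.prod_congr rfl fun k hk => by rw [e2 k hk]
    rw [e1, e3]
    simp only [List.map_append, List.prod_append, List.map_singleton, List.prod_singleton,
      ← Matrix.vecMul_vecMul, ih hl, Matrix.smul_vecMul, hA, smul_smul]
    rw [← List.prod_toFinset _ hnd, mul_comm]
    congr 3
    refine Finset.prod_congr rfl fun m _ => ?_
    congr 1 <;> ring

/-- `C(ξ_n - η/2)` flips exactly the site `n` if the sites up to `n` are down and the later ones are
up. -/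
theorem bulkC_mulVec_single (n : Fin N) {s : Conf N} (h₁ : ∀ m, n < m → s m = 0) (hn : s n = 1)
    (h₂ : ∀ m, m < n → s m = 1) :
    c.bulkC (c.ξ n - c.η / 2) *ᵥ Pi.single s 1 =
      -c.d (c.ξ n - c.η / 2) • Pi.single (Function.update s n 0) 1 := by
  obtain ⟨l₁, l₂, hl⟩ := List.append_of_mem (show n ∈ sites N by simp [sites])
  have hp : (sites N).Pairwise (fun a b => b < a) :=
    List.pairwise_reverse.2 (List.pairwise_lt_finRange N)
  rw [hl, List.pairwise_append, List.pairwise_cons] at hp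
  obtain ⟨-, ⟨hp2, -⟩, hp1⟩ := hp
  have h := c.bulk10_mulVec_single n (l₁ := l₁) (l₂ := l₂) (hl ▸ nodup_sites) (s := s)
    (fun m hm => h₁ m (hp1 m hm n (by simp))) hn (fun m hm => h₂ m (hp2 m hm))
  rw [← hl, prod_map_sites] at h
  rw [bulkC, h, d]

/-- On an initial segment of the chain, the operators `C(ξ_m - η/2)` flip the down spins one after
the other, starting from the last one. -/
theorem prod_bulkC_mulVec_single {l : List (Fin N)} (hl : l.Pairwise (· < ·))
    (hl' : ∀ n ∈ l, ∀ m, m < n → m ∈ l) :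
    (l.map fun m => c.bulkC (c.ξ m - c.η / 2)).prod *ᵥ
        Pi.single (fun m => if m ∈ l then 1 else 0) 1 =
      (l.map fun m => -c.d (c.ξ m - c.η / 2)).prod • Pi.single (fun _ => 0) 1 := by
  induction l using List.reverseRecOn with
  | nil => simp only [List.map_nil, List.prod_nil, Matrix.one_mulVec, one_smul, List.not_mem_nil,
      if_false]
  | append_singleton l n ih =>
    rw [List.pairwise_append] at hl
    obtain ⟨hl, -, hln⟩ := hl
    have hln : ∀ m ∈ l, m < n := fun m hm => hln m hm n (by simp)
    have hnl : n ∉ l := fun h => lt_irrefl n (hln n h)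
    have ih := ih hl fun k hk m hm => by
      have := hl' k (by simp [hk]) m hm
      simp only [List.mem_append, List.mem_singleton] at this
      rcases this with h | rfl
      · exact h
      · exact absurd hm (lt_asymm (hln k hk))
    have hC := c.bulkC_mulVec_single n (s := fun m => if m ∈ l ++ [n] then 1 else 0)
      (fun m hm => by
        have : m ∉ l := fun h => lt_asymm hm (hln m h)
        simp [this, hm.ne']) (by simp)
      (fun m hm => by simp only [hl' n (by simp) m hm, if_true])
    have hu : Function.update (fun m => if m ∈ l ++ [n] then (1 : Fin 2) else 0) n 0 =
        fun m => if m ∈ l then 1 else 0 := by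
      ext1 m
      by_cases hm : m = n
      · subst hm; simp [hnl]
      · simp [hm]
    rw [hu] at hC
    rw [List.map_append, List.prod_append, List.map_singleton, List.prod_singleton,
      ← Matrix.mulVec_mulVec, hC, Matrix.mulVec_smul, ih, smul_smul, List.map_append,
      List.prod_append, List.map_singleton, List.prod_singleton, mul_comm]

end Bulk

/-! ### The overlap at the reference configuration -/

section Overlap

variable {N : ℕ} {c : OpenXXX N}

theorem vdm_eq (x : Fin N → ℂ) :
    vdm x = ∏ i, ∏ j ∈ Finset.Ioi i, (x j ^ 2 - x i ^ 2) := by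
  rw [← Matrix.det_vandermonde fun i => x i ^ 2, vdm]
  congr 1
  ext i j
  simp [Matrix.vandermonde, pow_mul]

theorem Generic.injective (hc : c.Generic) : Function.Injective c.ξ := by
  intro i j h
  by_contra hij
  exact (hc.sub i j hij).1 (sub_eq_zero.2 h)

theorem Generic.vdmH_ne_zero (hc : c.Generic) (h : Conf N) : c.vdmH h ≠ 0 := by
  rw [vdmH, vdm_eq]
  exact Finset.prod_ne_zero_iff.2 fun i _ => Finset.prod_ne_zero_iff.2 fun j hj =>
    sub_ne_zero.2 (hc.xiH_sq_ne (Finset.mem_Ioi.1 hj).ne' _ _)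

theorem Generic.vdm_ξ_ne_zero (hc : c.Generic) : vdm c.ξ ≠ 0 := by
  rw [vdm_eq]
  refine Finset.prod_ne_zero_iff.2 fun i _ => Finset.prod_ne_zero_iff.2 fun j hj => ?_
  have hij := (Finset.mem_Ioi.1 hj).ne'
  rw [sq_sub_sq]
  exact mul_ne_zero (hc.add j i hij).1 (hc.sub j i hij).1

theorem Generic.a_ne_zero (hc : c.Generic) (n : Fin N) : c.a (c.η / 2 - c.ξ n) ≠ 0 := by
  refine Finset.prod_ne_zero_iff.2 fun m _ h => ?_
  by_cases hnm : n = m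
  · subst hnm
    exact (hc.ξ2 n).1 (by linear_combination -h)
  · exact (hc.add n m hnm).2.1 (by linear_combination -h)

theorem Generic.d_ne_zero (hc : c.Generic) (n : Fin N) : c.d (c.ξ n - c.η / 2) ≠ 0 := by
  refine Finset.prod_ne_zero_iff.2 fun m _ h => ?_
  by_cases hnm : n = m
  · subst hnm
    exact hc.η (by linear_combination -h)
  · exact (hc.sub n m hnm).2.1 (by linear_combination h)

theorem Generic.kBar00_ne_zero (hc : c.Generic) (n : Fin N) :
    c.kBar (c.η / 2 - c.ξ n) 0 0 ≠ 0 := by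
  have hz := hc.zetaBarM_ne_zero
  rw [hc.kBar_eq]
  simp only [Matrix.of_apply, Matrix.cons_val_zero, Matrix.cons_val', Matrix.cons_val_fin_one]
  intro h
  field_simp at h
  exact (hc.gm n).1 (by linear_combination -h / 2)

theorem Generic.aMinus_ne_zero (hc : c.Generic) (n : Fin N) :
    c.aMinus (c.η / 2 - c.ξ n) ≠ 0 := by
  have h : -(c.η / 2 - c.ξ n) = c.ξ n - c.η / 2 := by ring
  rw [aMinus, h]
  exact mul_ne_zero (mul_ne_zero (mul_ne_zero (pow_ne_zero _ (by norm_num)) (hc.kBar00_ne_zero n))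
    (hc.a_ne_zero n)) (hc.d_ne_zero n)

theorem bulkHat_apply10 (c : OpenXXX N) (lam : ℂ) :
    c.bulkHat (List.finRange N) lam 1 0 = (-1 : ℂ) ^ N • -c.bulkC (-lam) := by
  rw [← monodromyHat_eq_bulkHat, monodromyHat, monodromy_eq_bulk,
    auxOp_sigmaY_mul_transpose_mul]
  rfl

/-- `Ā₋(λ)` splits into a multiple of `b̄₋(λ) A(λ) C(-λ)`, which adds one down spin to the covectors
on which it acts, and a part which conserves the number of down spins. As `K̄₋` is upper triangular,
no part removes a down spin. -/
theorem Generic.opA_eq (hc : c.Generic) (lam : ℂ) : ∃ Q, HasDegree 0 Q ∧ c.opA lam =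
    (-(c.kBar lam 0 1 * (-1) ^ N)) • (c.bulkA lam * c.bulkC (-lam)) + Q := by
  have hrev : (sites N).reverse = List.finRange N := by rw [sites, List.reverse_reverse]
  have h10 : c.kBar lam 1 0 = 0 := by rw [hc.kBar_eq]; simp
  have hb := spinConserving_bulk c (sites N) lam
  have hh := spinConserving_bulkHat c (List.finRange N) lam
  refine ⟨c.kBar lam 0 0 • (c.bulk (sites N) lam 0 0 * c.bulkHat (List.finRange N) lam 0 0) +
    c.kBar lam 1 1 • (c.bulk (sites N) lam 0 1 * c.bulkHat (List.finRange N) lam 1 0),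
    ((((hb 0 0).mul (hh 0 0)).smul _).add (((hb 0 1).mul (hh 1 0)).smul _)), ?_⟩
  rw [opA, hc.uBar_eq, dressed_eq, hrev]
  simp only [Matrix.mul_apply, Fin.sum_univ_two, auxOp, Matrix.map_apply, h10, zero_smul,
    add_zero, mul_smul_comm, mul_one, add_mul, smul_mul_assoc]
  rw [bulkHat_apply10, bulkA]
  simp only [mul_smul_comm, mul_neg, smul_neg, smul_smul, neg_smul]
  abel

/-- The pairing of the covector with all labels `0` with the all-down vector, which fixes the
normalization. Of the product of `N` operators `Ā₋` between the all-up covector and the all-down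
vector, only the top degree part contributes. -/
theorem Generic.overlap_zero (hc : c.Generic) :
    (c.braSoV (fun _ => 0) ⬝ᵥ ketDown N) * c.vdmH (fun _ => 0) = c.normFactor := by
  choose Q hQ hA using hc.opA_eq
  set r : Fin N → ℂ := fun n => (c.aMinus (c.η / 2 - c.ξ n))⁻¹ *
    -(c.kBar (c.η / 2 - c.ξ n) 0 1 * (-1) ^ N) with hr
  have neg : ∀ n, -(c.η / 2 - c.ξ n) = c.ξ n - c.η / 2 := fun n => by ring
  set X : Fin N → Op N := fun n =>
    c.bulkA (c.η / 2 - c.ξ n) * c.bulkC (c.ξ n - c.η / 2) with hX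
  have hnA : ∀ n, c.normA n = r n • X n + (c.aMinus (c.η / 2 - c.ξ n))⁻¹ • Q (c.η / 2 - c.ξ n) := by
    intro n
    rw [normA, hA, smul_add, smul_smul, neg]
  have hXdeg : ∀ n, HasDegree 1 (r n • X n) := fun n =>
    HasDegree.smul (k := 1) ((spinConserving_bulk c (sites N) _ 0 0).mul
      (spinConserving_bulk c (sites N) _ 1 0)) _
  have e1 : c.braSoV (fun _ => 0) ⬝ᵥ ketDown N =
      ((List.finRange N).map c.normA).prod (fun _ => 0) (fun _ => 1) := by
    rw [braSoV, bra0, ketDown, Matrix.single_one_vecMul, dotProduct_single_one,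
      List.ofFn_eq_map]
    simp
    rfl
  have hsm : ∀ l : List (Fin N), (l.map fun n => r n • X n).prod =
      (l.map r).prod • (l.map X).prod := by
    intro l
    induction l with
    | nil => simp
    | cons n l ih =>
      simp only [List.map_cons, List.prod_cons, ih, smul_mul_assoc, mul_smul_comm, smul_smul]
      rw [mul_comm (r n)]
  have e2 : c.braSoV (fun _ => 0) ⬝ᵥ ketDown N = (∏ n, r n) *
      ((bra0 N ᵥ* ((List.finRange N).map X).prod) ⬝ᵥ ketDown N) := by
    rw [e1, show c.normA = fun n => r n • X n +
      (c.aMinus (c.η / 2 - c.ξ n))⁻¹ • Q (c.η / 2 - c.ξ n) from funext hnA,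
      (list_prod_top_degree hXdeg (fun n => (hQ _).smul _) _ _ _ (by simp [downs])).1, hsm,
      bra0, ketDown, Matrix.single_one_vecMul, dotProduct_single_one, Matrix.smul_apply,
      ← List.ofFn_eq_map, List.prod_ofFn]
    rfl
  have e3 := c.bra0_vecMul_prod_bulkA_bulkC hc.injective (fun m n h => (hc.add m n h).2.1)
    (List.pairwise_lt_finRange N)
  have e4 := c.prod_bulkC_mulVec_single (List.pairwise_lt_finRange N) (by simp)
  have hdown : ketDown N = Pi.single (fun m => if m ∈ List.finRange N then 1 else 0) 1 := by
    simp [ketDown]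
  have huniv : (List.finRange N).toFinset = Finset.univ := by ext; simp
  rw [huniv] at e3
  rw [e2, hX, e3, smul_dotProduct, ← Matrix.dotProduct_mulVec, hdown, e4, dotProduct_smul, bra0,
    single_dotProduct, Pi.single_eq_same, ← List.ofFn_eq_map, List.prod_ofFn]
  -- The scalar factors of the sites combine to the boundary part of `normFactor` …
  have e5 : ∏ n, (c.ξ n * c.bConst / (c.ξ n - c.zetaBarM)) =
      (∏ n, r n) * (∏ n, c.a (c.η / 2 - c.ξ n)) * ∏ n, -c.d (c.ξ n - c.η / 2) := by
    rw [← Finset.prod_mul_distrib, ← Finset.prod_mul_distrib]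
    refine Finset.prod_congr rfl fun n _ => ?_
    have h1 := hc.a_ne_zero n
    have h2 := hc.d_ne_zero n
    have h4 : ((-1 : ℂ)) ^ N ≠ 0 := pow_ne_zero _ (by norm_num)
    have h5 := hc.zetaBarM_ne_zero
    have h6 : c.ξ n - c.zetaBarM ≠ 0 := sub_ne_zero.2 (hc.gm n).1
    have h00 : c.kBar (c.η / 2 - c.ξ n) 0 0 = (c.zetaBarM - c.ξ n) / c.zetaBarM := by
      rw [hc.kBar_eq]
      simp only [Matrix.of_apply, Matrix.cons_val_zero, Matrix.cons_val', Matrix.cons_val_fin_one]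
      field_simp
      ring
    have h01 : c.kBar (c.η / 2 - c.ξ n) 0 1 = -c.ξ n * c.bConst / c.zetaBarM := by
      rw [hc.kBar01]
      field_simp
      ring
    have h7 : c.zetaBarM - c.ξ n ≠ 0 := fun h => h6 (by linear_combination -h)
    simp only [hr]
    rw [aMinus, neg, h00, h01]
    generalize c.a (c.η / 2 - c.ξ n) = A at *
    generalize c.d (c.ξ n - c.η / 2) = D at *
    field_simp
    ring
  -- … and those of the pairs of sites to its ratio of Vandermonde determinants.
  have e6 : vdm c.ξ = (∏ n, ∏ m with m < n, (c.ξ m + c.ξ n) / (c.ξ m + c.ξ n - c.η)) *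
      c.vdmH fun _ => 1 := by
    have : ∏ n, ∏ m with m < n, (c.ξ m + c.ξ n) / (c.ξ m + c.ξ n - c.η) =
        ∏ m, ∏ n ∈ Finset.Ioi m, (c.ξ m + c.ξ n) / (c.ξ m + c.ξ n - c.η) :=
      Finset.prod_comm' (by simp)
    rw [this, vdmH, vdm_eq, vdm_eq, ← Finset.prod_mul_distrib]
    refine Finset.prod_congr rfl fun m _ => ?_
    rw [← Finset.prod_mul_distrib]
    refine Finset.prod_congr rfl fun n hn => ?_
    have h : c.ξ m + c.ξ n - c.η ≠ 0 :=
      sub_ne_zero.2 (hc.add m n (Finset.mem_Ioi.1 hn).ne).2.1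
    rw [xiH_one, xiH_one]
    field_simp
    ring
  have hv := hc.vdmH_ne_zero fun _ => 1
  have e7 : c.normFactor = (∏ n, r n) * (∏ n, c.a (c.η / 2 - c.ξ n)) *
      (∏ n, -c.d (c.ξ n - c.η / 2)) *
      (∏ n, ∏ m with m < n, (c.ξ m + c.ξ n) / (c.ξ m + c.ξ n - c.η)) * c.vdmH fun _ => 0 := by
    rw [normFactor, e5, e6]
    field_simp
  rw [e7]
  simp only [smul_eq_mul, mul_one, Finset.prod_mul_distrib]
  ring

end Overlap

/-! ### The dual pairing of the two bases -/

section Pairing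

variable {N : ℕ} {c : OpenXXX N}

/-- A product over pairs of the factors that involve a given index. -/
theorem prod_pairs_ite (n : Fin N) (ψ : Fin N → ℂ) :
    ∏ i, ∏ j ∈ Finset.Ioi i, ((if i = n then ψ j else 1) * if j = n then ψ i else 1) =
      ∏ m ∈ Finset.univ.erase n, ψ m := by
  rw [Finset.prod_prod_Ioi_mul_eq_prod_prod_off_diag (fun j i => if i = n then ψ j else 1),
    Finset.prod_eq_single n]
  · simp only [if_true]
    exact Finset.prod_congr (by ext; simp) fun _ _ => rfl
  · intro i _ hi
    simp [hi]
  · simp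

/-- How the Vandermonde determinant depends on a single node. -/
theorem vdm_update_mul (x : Fin N → ℂ) (n : Fin N) (t : ℂ) :
    vdm (Function.update x n t) * ∏ m ∈ Finset.univ.erase n, (x n ^ 2 - x m ^ 2) =
      vdm x * ∏ m ∈ Finset.univ.erase n, (t ^ 2 - x m ^ 2) := by
  rw [← prod_pairs_ite, ← prod_pairs_ite, vdm_eq, vdm_eq, ← Finset.prod_mul_distrib,
    ← Finset.prod_mul_distrib]
  refine Finset.prod_congr rfl fun i _ => ?_
  rw [← Finset.prod_mul_distrib, ← Finset.prod_mul_distrib]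
  refine Finset.prod_congr rfl fun j hj => ?_
  have hij := (Finset.mem_Ioi.1 hj).ne
  by_cases hi : i = n
  · subst hi
    simp only [if_true, Function.update_self, Function.update_of_ne hij.symm, if_neg hij.symm]
    ring
  · by_cases hj' : j = n
    · subst hj'
      simp only [if_true, Function.update_self, Function.update_of_ne hij, if_neg hij]
      ring
    · simp [hi, hj']

theorem Generic.normFactor_ne_zero (hc : c.Generic) : c.normFactor ≠ 0 :=
  mul_ne_zero (mul_ne_zero hc.vdm_ξ_ne_zero
    (div_ne_zero (hc.vdmH_ne_zero _) (hc.vdmH_ne_zero _)))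
    (Finset.prod_ne_zero_iff.2 fun n _ =>
      div_ne_zero (mul_ne_zero (hc.ξ n).1 hc.b) (sub_ne_zero.2 (hc.gm n).1))

theorem Generic.kCoef_ne_zero (hc : c.Generic) (n : Fin N) : c.kCoef n ≠ 0 :=
  div_ne_zero (fun h => (hc.ξ2 n).2 (by linear_combination h)) (sub_ne_zero.2 (hc.ξ2 n).1)

/-- Flipping one label does not change the product of the pairing with the Vandermonde
determinant. -/
theorem Generic.overlap_update (hc : c.Generic) (k : Conf N) (n : Fin N) (hk : k n = 0) :
    (c.braSoV (Function.update k n 1) ⬝ᵥ c.ketSoV (Function.update k n 1)) *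
        c.vdmH (Function.update k n 1) = (c.braSoV k ⬝ᵥ c.ketSoV k) * c.vdmH k := by
  have hback : Function.update (Function.update k n 1) n 0 = k := by
    rw [Function.update_idem, ← hk, Function.update_eq_self]
  have hket := (hc.ketSoV_labels (Function.update k n 1)).2 n (Function.update_self ..)
  rw [hback] at hket
  have hbra := (hc.braSoV_labels k).2 n hk
  have hratio := (hc.braSoV_labels (Function.update k n 1)).1.opD_ratio hc
    (hc.ketSoV_labels k).1 hk
  have hA := hc.aMinus_ne_zero n
  have hκ := hc.kCoef_ne_zero n
  rw [hket, hbra, ← Matrix.dotProduct_mulVec]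
  simp only [normA, normD, Matrix.smul_mulVec, dotProduct_smul, smul_eq_mul]
  have hvdm := vdm_update_mul (fun m => c.xiH m (k m)) n (c.xiH n 1)
  have hupd : Function.update (fun m => c.xiH m (k m)) n (c.xiH n 1) =
      fun m => c.xiH m (Function.update k n 1 m) := by
    ext m
    by_cases hm : m = n
    · subst hm; simp
    · simp [hm]
  rw [hupd] at hvdm
  change c.vdmH (Function.update k n 1) * _ = c.vdmH k * _ at hvdm
  simp only [hk] at hvdm
  have hG0 := hc.prod_erase_ne k n 0
  have hG1 := hc.prod_erase_ne k n 1
  generalize c.vdmH (Function.update k n 1) = V' at *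
  generalize c.vdmH k = V at *
  generalize ∏ m ∈ Finset.univ.erase n, (c.xiH n 0 ^ 2 - c.xiH m (k m) ^ 2) = G0 at *
  generalize ∏ m ∈ Finset.univ.erase n, (c.xiH n 1 ^ 2 - c.xiH m (k m) ^ 2) = G1 at *
  generalize c.braSoV (Function.update k n 1) ⬝ᵥ (c.opD (c.ξ n + c.η / 2) *ᵥ c.ketSoV k) = D at *
  generalize c.braSoV (Function.update k n 1) ⬝ᵥ (c.opA (c.η / 2 - c.ξ n) *ᵥ c.ketSoV k) = A at *
  generalize c.aMinus (c.η / 2 - c.ξ n) = q at *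
  generalize c.kCoef n = κ at *
  have : D * V' = κ * A * V := by
    apply mul_left_cancel₀ (mul_ne_zero hG0 hG1)
    linear_combination G0 * V' * hratio + κ * A * G0 * hvdm
  field_simp
  linear_combination this

/-- The norms of the dual bases: the pairing times `vdmH h` does not depend on `h`. -/
theorem Generic.overlap (hc : c.Generic) (h : Conf N) :
    (c.braSoV h ⬝ᵥ c.ketSoV h) * c.vdmH h = c.normFactor := by
  have key : ∀ s : Finset (Fin N), (c.braSoV (fun m => if m ∈ s then 1 else 0) ⬝ᵥ
      c.ketSoV fun m => if m ∈ s then 1 else 0) * c.vdmH (fun m => if m ∈ s then 1 else 0) =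
        c.normFactor := by
    intro s
    induction s using Finset.induction_on with
    | empty =>
      rw [← hc.overlap_zero]
      simp [ketSoV]
    | insert n s hn ih =>
      have : (fun m => if m ∈ insert n s then (1 : Fin 2) else 0) =
          Function.update (fun m => if m ∈ s then 1 else 0) n 1 := by
        ext m
        by_cases hm : m = n <;> simp [hm]
      rw [this, hc.overlap_update _ n (by simp [hn]), ih]
  have hh : h = fun m => if m ∈ Finset.univ.filter (h · = 1) then 1 else 0 := by
    ext m
    rcases Fin.exists_fin_two.1 ⟨h m, rfl⟩ with hm | hm <;> simp [hm]
  rw [hh]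
  exact key _

theorem Generic.overlap_of_ne (hc : c.Generic) {h k : Conf N} (hhk : h ≠ k) :
    c.braSoV h ⬝ᵥ c.ketSoV k = 0 :=
  (hc.braSoV_labels h).1.dotProduct_eq_zero hc (hc.ketSoV_labels k).1 hhk

end Pairing

/-! ### The renormalized operators -/

section Renormalized

variable {N : ℕ} {c : OpenXXX N}

variable (c) in
/-- The matrix whose rows are the covectors `⟨h₋|`. -/
noncomputable def sovMatrix : Op N := Matrix.of c.braSoV

theorem Generic.isUnit_sovMatrix (hc : c.Generic) : IsUnit c.sovMatrix := by
  have h : c.sovMatrix * ((Matrix.of c.ketSoV)ᵀ * Matrix.diagonal fun h =>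
      c.vdmH h / c.normFactor) = 1 := by
    rw [← mul_assoc]
    ext h k
    rw [Matrix.mul_diagonal, Matrix.one_apply]
    change c.braSoV h ⬝ᵥ c.ketSoV k * _ = _
    split_ifs with hhk
    · rw [← hhk, ← mul_div_assoc, hc.overlap, div_self hc.normFactor_ne_zero]
    · rw [hc.overlap_of_ne hhk, zero_mul]
  exact IsUnit.of_mul_eq_one _ h

theorem Generic.opB_eq (hc : c.Generic) (lam : ℂ) : c.opB lam = c.kBar lam 0 1 •
    (c.sovMatrix⁻¹ * Matrix.diagonal (fun h => c.eig h lam) * c.sovMatrix) := by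
  have hdet := (Matrix.isUnit_iff_isUnit_det _).1 hc.isUnit_sovMatrix
  have h : c.sovMatrix * c.opB lam = c.kBar lam 0 1 •
      (Matrix.diagonal (fun h => c.eig h lam) * c.sovMatrix) := by
    ext h k
    have := congrFun ((hc.braSoV_labels h).1 lam) k
    rw [Matrix.smul_apply, Matrix.diagonal_mul]
    simp only [Pi.smul_apply, smul_eq_mul] at this ⊢
    rw [← mul_assoc]
    exact this
  rw [mul_assoc, ← Matrix.mul_smul, ← h, ← mul_assoc, Matrix.nonsing_inv_mul _ hdet, one_mul]

/-- In the basis of the `⟨h₋|`, the renormalized operator is diagonal with polynomial entries, also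
at the zero of `b̄₋(λ)`. -/
theorem Generic.renB_eq (hc : c.Generic) (lam : ℂ) : c.renB lam = (-1 : ℂ) ^ N •
    (c.sovMatrix⁻¹ * Matrix.diagonal (fun h => c.eig h lam) * c.sovMatrix) := by
  have hne : ∀ mu, c.kBar mu 0 1 ≠ 0 → ((-1) ^ N / c.kBar mu 0 1) • c.opB mu = (-1 : ℂ) ^ N •
      (c.sovMatrix⁻¹ * Matrix.diagonal (fun h => c.eig h mu) * c.sovMatrix) := by
    intro mu hmu
    rw [hc.opB_eq, smul_smul, div_mul_cancel₀ _ hmu]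
  rw [renB]
  split_ifs with h0
  · -- Near a zero of `b̄₋` the operator agrees with a polynomial, so the limit is its value.
    apply Tendsto.limUnder_eq
    have hcont : Continuous fun mu => (-1 : ℂ) ^ N •
        (c.sovMatrix⁻¹ * Matrix.diagonal (fun h => c.eig h mu) * c.sovMatrix) := by
      have h1 : Continuous fun mu => fun h : Conf N => c.eig h mu :=
        continuous_pi fun h => continuous_eig h
      have h2 : Continuous fun mu =>
          c.sovMatrix⁻¹ * Matrix.diagonal (fun h => c.eig h mu) * c.sovMatrix :=
        (continuous_const.matrix_mul h1.matrix_diagonal).matrix_mul continuous_const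
      exact h2.const_smul ((-1 : ℂ) ^ N)
    refine (hcont.tendsto lam).mono_left nhdsWithin_le_nhds |>.congr' ?_
    filter_upwards [self_mem_nhdsWithin] with mu hmu
    refine (hne mu fun h => hmu ?_).symm
    rw [hc.kBar01] at h h0
    have hβ := div_ne_zero hc.b hc.zetaBarM_ne_zero
    have e1 := (mul_eq_zero.1 h).resolve_right hβ
    have e0 := (mul_eq_zero.1 h0).resolve_right hβ
    exact Set.mem_singleton_iff.2 (by linear_combination e1 - e0)
  · exact hne lam h0

theorem Generic.braSoV_vecMul_renB (hc : c.Generic) (h : Conf N) (lam : ℂ) :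
    c.braSoV h ᵥ* c.renB lam = (∏ n, (c.xiH n (h n) ^ 2 - lam ^ 2)) • c.braSoV h := by
  have hdet := (Matrix.isUnit_iff_isUnit_det _).1 hc.isUnit_sovMatrix
  have h1 : c.sovMatrix * c.renB lam = (-1 : ℂ) ^ N •
      (Matrix.diagonal (fun h => c.eig h lam) * c.sovMatrix) := by
    rw [hc.renB_eq, Matrix.mul_smul, mul_assoc, ← mul_assoc, Matrix.mul_nonsing_inv _ hdet,
      one_mul]
  have h2 : ∏ n, (c.xiH n (h n) ^ 2 - lam ^ 2) = (-1) ^ N * c.eig h lam := by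
    have : ((-1 : ℂ)) ^ N = ∏ _n : Fin N, (-1 : ℂ) := by simp
    rw [this, eig, ← Finset.prod_mul_distrib]
    exact Finset.prod_congr rfl fun n _ => by ring
  ext k
  have h3 := congrFun (congrFun h1 h) k
  rw [Matrix.smul_apply, Matrix.diagonal_mul, smul_eq_mul, ← mul_assoc, ← h2] at h3
  exact h3

theorem Generic.braSoV_vecMul_prodB (hc : c.Generic) (h : Conf N) {n : ℕ} (b : Fin n → ℂ) :
    c.braSoV h ᵥ* c.prodB b = (∏ m, evenPoly b (c.xiH m (h m))) • c.braSoV h := by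
  induction n with
  | zero => simp [prodB, evenPoly]
  | succ n ih =>
    have h1 : c.prodB b = c.renB (b 0) * c.prodB fun k => b k.succ := by
      simp [prodB, List.ofFn_succ]
    rw [h1, ← Matrix.vecMul_vecMul, hc.braSoV_vecMul_renB, Matrix.smul_vecMul, ih, smul_smul,
      ← Finset.prod_mul_distrib]
    simp only [evenPoly, Fin.prod_univ_succ]

end Renormalized

/-! ### Scalar products as sums over configurations -/

section ScalarProducts

variable {N : ℕ} {c : OpenXXX N}

/-- The pairing of two combinations of the basis vectors with an operator product between them. -/
theorem Generic.pairing (hc : c.Generic) (p q : Conf N → ℂ) {nα nβ : ℕ} (α : Fin nα → ℂ)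
    (β : Fin nβ → ℂ) :
    (c.normFactor⁻¹ • ∑ h, (p h * c.vdmH h) • c.braSoV h) ⬝ᵥ ((c.prodB α * c.prodB β) *ᵥ
      (c.normFactor⁻¹ • ∑ h, (q h * c.vdmH h) • c.ketSoV h)) =
    1 / c.normFactor * ∑ h, (p h * q h * ∏ n, (evenPoly α (c.xiH n (h n)) *
      evenPoly β (c.xiH n (h n)))) * c.vdmH h := by
  have h1 : ∀ h, (c.braSoV h ᵥ* (c.prodB α * c.prodB β)) =
      (∏ n, (evenPoly α (c.xiH n (h n)) * evenPoly β (c.xiH n (h n)))) • c.braSoV h := by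
    intro h
    rw [← Matrix.vecMul_vecMul, hc.braSoV_vecMul_prodB, Matrix.smul_vecMul,
      hc.braSoV_vecMul_prodB, smul_smul, ← Finset.prod_mul_distrib]
  have hn := hc.normFactor_ne_zero
  rw [Matrix.dotProduct_mulVec, Matrix.smul_vecMul, smul_dotProduct, dotProduct_smul,
    Matrix.sum_vecMul, sum_dotProduct, smul_eq_mul, smul_eq_mul, one_div]
  congr 1
  rw [Finset.mul_sum]
  refine Finset.sum_congr rfl fun h _ => ?_
  rw [Matrix.smul_vecMul, h1, dotProduct_sum, Finset.sum_eq_single h]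
  · have := hc.overlap h
    rw [smul_dotProduct, smul_dotProduct, dotProduct_smul]
    simp only [smul_eq_mul]
    apply mul_left_cancel₀ hn
    rw [← mul_assoc, mul_inv_cancel₀ hn]
    linear_combination (p h * q h * c.vdmH h * ∏ n, (evenPoly α (c.xiH n (h n)) *
      evenPoly β (c.xiH n (h n)))) * this
  · intro k _ hk
    rw [smul_dotProduct, smul_dotProduct, dotProduct_smul, hc.overlap_of_ne hk.symm]
    simp
  · simp

/-- The multilinear expansion of a determinant whose rows are sums of two weighted Vandermonde
rows. -/
theorem det_sum_rows (w : Fin N → Fin 2 → ℂ) (x : Fin N → Fin 2 → ℂ) :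
    (Matrix.of fun i j : Fin N => ∑ h, w i h * x i h ^ (2 * (j : ℕ))).det =
      ∑ h : Conf N, (∏ n, w n (h n)) * vdm fun n => x n (h n) := by
  have h1 : (Matrix.of fun i j : Fin N => ∑ h, w i h * x i h ^ (2 * (j : ℕ))) =
      fun i => ∑ h : Fin 2, fun j : Fin N => w i h * x i h ^ (2 * (j : ℕ)) := by
    ext i j
    simp
  have h2 := (Matrix.detRowAlternating (n := Fin N) (R := ℂ)).toMultilinearMap.map_sum
    (fun (i : Fin N) (h : Fin 2) (j : Fin N) => w i h * x i h ^ (2 * (j : ℕ)))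
  rw [h1]
  refine h2.trans (Finset.sum_congr rfl fun h _ => ?_)
  exact Matrix.det_mul_column (fun n => w n (h n)) (Matrix.of fun i j => x i (h i) ^ (2 * (j : ℕ)))

/-- The expansion of the determinant `𝒟[w]` in its rows. -/
theorem detForm_eq (w : Fin N → ℂ) (α β : ℂ → ℂ) : c.detForm w α β =
    1 / c.normFactor * ∑ h : Conf N, ((∏ n, w n ^ (h n : ℕ)) *
      ∏ n, (α (c.xiH n (h n)) * β (c.xiH n (h n)))) * c.vdmH h := by
  rw [detForm, det_sum_rows (fun i h => w i ^ (h : ℕ) * α (c.xiH i h) * β (c.xiH i h))]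
  simp only [← Finset.prod_mul_distrib, mul_assoc, vdmH]

/-- The expansion of the determinant `𝒟'[v]` in its rows; the Vandermonde determinants are those of
the complementary configurations. -/
theorem detFormAlt_eq (v : Fin N → ℂ) (α β : ℂ → ℂ) : c.detFormAlt v α β =
    (∏ n, (c.ξ n - c.zetaBarM) / (c.ξ n * c.bConst)) * ((∑ h : Conf N, ((∏ n, v n ^ (h n : ℕ)) *
      ∏ n, (α (c.xiH n (h n)) * β (c.xiH n (h n)))) * c.vdmH fun n => 1 - h n) / vdm c.ξ) := by
  rw [detFormAlt, det_sum_rows (fun i h => v i ^ (h : ℕ) * α (c.xiH i h) * β (c.xiH i h))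
    (fun i h => c.xiH i (1 - h))]
  simp only [← Finset.prod_mul_distrib, mul_assoc, vdmH]

/-- The coefficients `f_n` exchange the Vandermonde determinants of a configuration and of its
complement; pair by pair this is an identity between four differences of squares. -/
theorem Generic.prod_f_mul_vdmH (hc : c.Generic) (h : Conf N) :
    (∏ n, c.f n ^ (h n : ℕ)) * c.vdmH h * c.vdmH (fun _ => 1) =
      (∏ n, (-1) ^ (h n : ℕ)) * c.vdmH (fun n => 1 - h n) * c.vdmH (fun _ => 0) := by
  set F : Fin N → Fin N → ℂ := fun n m => ((c.ξ n - c.ξ m + c.η) * (c.ξ n + c.ξ m + c.η)) /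
    ((c.ξ n - c.ξ m - c.η) * (c.ξ n + c.ξ m - c.η)) with hF
  have h1 : ∏ n, c.f n ^ (h n : ℕ) = (∏ n, (-1) ^ (h n : ℕ)) *
      ∏ i, ∏ j ∈ Finset.Ioi i, (F i j ^ (h i : ℕ) * F j i ^ (h j : ℕ)) := by
    rw [Finset.prod_prod_Ioi_mul_eq_prod_prod_off_diag (fun j i => F i j ^ (h i : ℕ)),
      ← Finset.prod_mul_distrib]
    refine Finset.prod_congr rfl fun n _ => ?_
    rw [f, neg_pow, Finset.prod_pow]
    congr 2
    exact Finset.prod_congr (by ext; simp) fun _ _ => rfl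
  rw [h1]
  simp only [mul_assoc]
  congr 1
  simp only [vdmH, vdm_eq, ← Finset.prod_mul_distrib]
  refine Finset.prod_congr rfl fun i _ => Finset.prod_congr rfl fun j hj => ?_
  have hij := (Finset.mem_Ioi.1 hj).ne
  have a1 := sub_ne_zero.2 (hc.add i j hij).2.1
  have s1 := sub_ne_zero.2 (hc.sub i j hij).2.1
  have a2 := sub_ne_zero.2 (hc.add j i hij.symm).2.1
  have s2 := sub_ne_zero.2 (hc.sub j i hij.symm).2.1
  rcases Fin.exists_fin_two.1 ⟨h i, rfl⟩ with hi | hi <;>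
  rcases Fin.exists_fin_two.1 ⟨h j, rfl⟩ with hj | hj <;>
  simp only [hi, hj, hF, sub_zero, sub_self, xiH_zero, xiH_one, Fin.val_zero, Fin.val_one, pow_zero,
    pow_one, one_mul, mul_one, Fin.isValue] <;> field_simp <;> ring

theorem Generic.detForm_eq_detFormAlt (hc : c.Generic) (u : Fin N → ℂ) (α β : ℂ → ℂ) :
    c.detForm (fun i => c.f i * u i) α β = c.detFormAlt (fun i => -u i) α β := by
  have hξ := hc.vdm_ξ_ne_zero
  have h0 := hc.vdmH_ne_zero fun _ => 0
  have h1 := hc.vdmH_ne_zero fun _ => 1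
  have h2 : ∏ n, (c.ξ n - c.zetaBarM) / (c.ξ n * c.bConst) =
      (∏ n, (c.ξ n * c.bConst / (c.ξ n - c.zetaBarM)))⁻¹ := by
    rw [← Finset.prod_inv_distrib]
    exact Finset.prod_congr rfl fun n _ => (inv_div _ _).symm
  have h3 : ∏ n, (c.ξ n * c.bConst / (c.ξ n - c.zetaBarM)) ≠ 0 :=
    Finset.prod_ne_zero_iff.2 fun n _ =>
      div_ne_zero (mul_ne_zero (hc.ξ n).1 hc.b) (sub_ne_zero.2 (hc.gm n).1)
  have h4 : c.vdmH (fun _ => 1) * ∑ h : Conf N, ((∏ n, (c.f n * u n) ^ (h n : ℕ)) *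
      ∏ n, (α (c.xiH n (h n)) * β (c.xiH n (h n)))) * c.vdmH h =
      c.vdmH (fun _ => 0) * ∑ h : Conf N, ((∏ n, (-u n) ^ (h n : ℕ)) *
        ∏ n, (α (c.xiH n (h n)) * β (c.xiH n (h n)))) * c.vdmH fun n => 1 - h n := by
    rw [Finset.mul_sum, Finset.mul_sum]
    refine Finset.sum_congr rfl fun h _ => ?_
    have h5 : ∏ n, (-u n) ^ (h n : ℕ) = (∏ n, (-1) ^ (h n : ℕ)) * ∏ n, u n ^ (h n : ℕ) := by
      rw [← Finset.prod_mul_distrib]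
      exact Finset.prod_congr rfl fun n _ => neg_pow _ _
    simp only [mul_pow]
    rw [h5, Finset.prod_mul_distrib]
    linear_combination ((∏ n, u n ^ (h n : ℕ)) *
      ∏ n, (α (c.xiH n (h n)) * β (c.xiH n (h n)))) * hc.prod_f_mul_vdmH h
  rw [detForm_eq, detFormAlt_eq, h2, normFactor]
  generalize ∏ n, (c.ξ n * c.bConst / (c.ξ n - c.zetaBarM)) = P at *
  generalize ∑ h : Conf N, ((∏ n, (c.f n * u n) ^ (h n : ℕ)) *
      ∏ n, (α (c.xiH n (h n)) * β (c.xiH n (h n)))) * c.vdmH h = S at *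
  generalize ∑ h : Conf N, ((∏ n, (-u n) ^ (h n : ℕ)) *
        ∏ n, (α (c.xiH n (h n)) * β (c.xiH n (h n)))) * c.vdmH (fun n => 1 - h n) = T at *
  field_simp
  linear_combination h4

end ScalarProducts

/-! ### Scalar products of separate states -/

section SeparateStates

variable {N : ℕ} {c : OpenXXX N}

/-- The gauge operator drops out of the scalar product of a left and a right separate state. -/
theorem vecMul_gammaW_dotProduct (hW : c.W.det ≠ 0) (v w : Vec N) (X Y : Op N) :
    ((v ᵥ* X) ᵥ* c.gammaW) ⬝ᵥ (c.gammaW⁻¹ *ᵥ (Y *ᵥ w)) = v ⬝ᵥ ((X * Y) *ᵥ w) := by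
  rw [Matrix.dotProduct_mulVec, Matrix.vecMul_vecMul, c.gammaW_mul_inv hW, Matrix.vecMul_one,
    Matrix.dotProduct_mulVec, Matrix.vecMul_vecMul, Matrix.dotProduct_mulVec]

theorem ketOmega_eq : c.ketOmega =
    c.normFactor⁻¹ • ∑ h : Conf N, (1 * c.vdmH h) • c.ketSoV h := by
  simp only [ketOmega, one_mul]

theorem detForm_comm (w : Fin N → ℂ) (α β : ℂ → ℂ) : c.detForm w α β = c.detForm w β α := by
  simp only [detForm_eq, mul_comm (α _)]

end SeparateStates

end OpenXXX

theorem mainTheorem3 {N : ℕ} (c : OpenXXX N)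
    -- the model and the gauge matrix are well defined
    (hη : c.η ≠ 0) (hζp : c.ζp ≠ 0) (hζm : c.ζm ≠ 0)
    (hκp : 1 + 4 * c.κp ^ 2 ≠ 0) (hκm : 1 + 4 * c.κm ^ 2 ≠ 0)
    (hκp0 : c.κp = 0 → c.εp = 1) (hκm0 : c.κm = 0 → c.εm = 1)
    (hW : c.W.det ≠ 0) (hb : c.bConst ≠ 0)
    -- generic inhomogeneities
    (hξ : ∀ j, c.ξ j ≠ 0 ∧ c.ξ j ≠ c.η ∧ c.ξ j ≠ -c.η)
    (hξ2 : ∀ j, 2 * c.ξ j ≠ c.η ∧ 2 * c.ξ j ≠ -c.η)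
    (hadd : ∀ j k, j ≠ k →
      c.ξ j + c.ξ k ≠ 0 ∧ c.ξ j + c.ξ k ≠ c.η ∧ c.ξ j + c.ξ k ≠ -c.η)
    (hsub : ∀ j k, j ≠ k →
      c.ξ j - c.ξ k ≠ 0 ∧ c.ξ j - c.ξ k ≠ c.η ∧ c.ξ j - c.ξ k ≠ -c.η)
    -- the coefficients `g_n` and their inverses are well defined
    (hgp : ∀ j, c.ξ j ≠ c.zetaBarP ∧ c.ξ j ≠ -c.zetaBarP)
    (hgm : ∀ j, c.ξ j ≠ c.zetaBarM ∧ c.ξ j ≠ -c.zetaBarM)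
    -- the roots of the two even polynomials
    {nα nβ : ℕ} (α : Fin nα → ℂ) (β : Fin nβ → ℂ) :
    (c.bra α ⬝ᵥ c.ket β = c.bra β ⬝ᵥ c.ket α ∧
      c.bra α ⬝ᵥ c.ket β = c.braOmegaL ⬝ᵥ ((c.prodB α * c.prodB β) *ᵥ c.ketOmega) ∧
      c.bra α ⬝ᵥ c.ket β =
        c.detForm (fun i => c.f i * c.g i) (OpenXXX.evenPoly α) (OpenXXX.evenPoly β) ∧
      c.bra α ⬝ᵥ c.ket β =
        c.detFormAlt (fun i => -c.g i) (OpenXXX.evenPoly α) (OpenXXX.evenPoly β)) ∧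
    (c.braU α ⬝ᵥ c.ket β = c.bra β ⬝ᵥ c.ketU α ∧
      c.braU α ⬝ᵥ c.ket β = c.bra α ⬝ᵥ c.ketU β ∧
      c.braU α ⬝ᵥ c.ket β = c.braU β ⬝ᵥ c.ket α ∧
      c.braU α ⬝ᵥ c.ket β = c.braOmegaU ⬝ᵥ ((c.prodB α * c.prodB β) *ᵥ c.ketOmega) ∧
      c.braU α ⬝ᵥ c.ket β =
        c.detForm (fun i => c.f i) (OpenXXX.evenPoly α) (OpenXXX.evenPoly β) ∧
      c.braU α ⬝ᵥ c.ket β =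
        c.detFormAlt (fun _ => -1) (OpenXXX.evenPoly α) (OpenXXX.evenPoly β)) ∧
    (c.braU α ⬝ᵥ c.ketU β = c.braU β ⬝ᵥ c.ketU α ∧
      c.braU α ⬝ᵥ c.ketU β = c.braOmegaU ⬝ᵥ ((c.prodB α * c.prodB β) *ᵥ c.ketOmegaUR) ∧
      c.braU α ⬝ᵥ c.ketU β =
        c.detForm (fun i => c.f i * (c.g i)⁻¹) (OpenXXX.evenPoly α) (OpenXXX.evenPoly β) ∧
      c.braU α ⬝ᵥ c.ketU β =
        c.detFormAlt (fun i => -(c.g i)⁻¹) (OpenXXX.evenPoly α) (OpenXXX.evenPoly β)) := by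
  have hc : c.Generic := ⟨hη, hζm, hκm, hκm0, hW, hb, hξ, hξ2, hadd, hsub, hgm⟩
  have hg : ∀ n, c.g n ≠ 0 := fun n => div_ne_zero
    (mul_ne_zero (fun h => (hgp n).2 (eq_neg_of_add_eq_zero_left h))
      (fun h => (hgm n).2 (eq_neg_of_add_eq_zero_left h)))
    (mul_ne_zero (sub_ne_zero.2 (hgp n).1) (sub_ne_zero.2 (hgm n).1))
  -- Each pairing is a determinant whose coefficient is the product of those of the two states.
  have LΩ : ∀ {n m : ℕ} (a : Fin n → ℂ) (b : Fin m → ℂ),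
      c.braOmegaL ⬝ᵥ ((c.prodB a * c.prodB b) *ᵥ c.ketOmega) =
        c.detForm (fun i => c.f i * c.g i) (OpenXXX.evenPoly a) (OpenXXX.evenPoly b) := by
    intro n m a b
    rw [OpenXXX.ketOmega_eq, OpenXXX.braOmegaL, hc.pairing _ (fun _ => 1), OpenXXX.detForm_eq]
    simp only [mul_one]
  have UΩ : ∀ {n m : ℕ} (a : Fin n → ℂ) (b : Fin m → ℂ),
      c.braOmegaU ⬝ᵥ ((c.prodB a * c.prodB b) *ᵥ c.ketOmega) =
        c.detForm (fun i => c.f i) (OpenXXX.evenPoly a) (OpenXXX.evenPoly b) := by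
    intro n m a b
    rw [OpenXXX.ketOmega_eq, OpenXXX.braOmegaU, hc.pairing _ (fun _ => 1), OpenXXX.detForm_eq]
    simp only [mul_one]
  have LR : ∀ {n m : ℕ} (a : Fin n → ℂ) (b : Fin m → ℂ),
      c.braOmegaL ⬝ᵥ ((c.prodB a * c.prodB b) *ᵥ c.ketOmegaUR) =
        c.detForm (fun i => c.f i) (OpenXXX.evenPoly a) (OpenXXX.evenPoly b) := by
    intro n m a b
    rw [OpenXXX.braOmegaL, OpenXXX.ketOmegaUR, hc.pairing, OpenXXX.detForm_eq]
    simp only [← Finset.prod_mul_distrib (s := Finset.univ), ← mul_pow, mul_assoc,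
      mul_inv_cancel₀ (hg _), mul_one]
  have UR : ∀ {n m : ℕ} (a : Fin n → ℂ) (b : Fin m → ℂ),
      c.braOmegaU ⬝ᵥ ((c.prodB a * c.prodB b) *ᵥ c.ketOmegaUR) =
        c.detForm (fun i => c.f i * (c.g i)⁻¹) (OpenXXX.evenPoly a) (OpenXXX.evenPoly b) := by
    intro n m a b
    rw [OpenXXX.braOmegaU, OpenXXX.ketOmegaUR, hc.pairing, OpenXXX.detForm_eq]
    simp only [← Finset.prod_mul_distrib (s := Finset.univ), ← mul_pow]
  have H := hc.detForm_eq_detFormAlt (fun _ => 1) (OpenXXX.evenPoly α) (OpenXXX.evenPoly β)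
  simp only [mul_one] at H
  simp only [OpenXXX.bra, OpenXXX.braU, OpenXXX.ket, OpenXXX.ketU,
    OpenXXX.vecMul_gammaW_dotProduct hW, LΩ, UΩ, LR, UR]
  simp only [OpenXXX.detForm_comm _ (OpenXXX.evenPoly β), true_and]
  exact ⟨hc.detForm_eq_detFormAlt _ _ _, H, hc.detForm_eq_detFormAlt _ _ _⟩
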